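/- **Model.** Fix a maximal degree $D$, a probability distribution $\Phi=(\Phi_1,\dots,\Phi_D)$ on $\{1,\dots,D\}$, and constants $\lambda>0$, $\eta>0$, $p_1<1/2$; these do not depend on $m$. For each $m$ let $x\in\{1,-1\}^m$ be an arbitrary true label vector, let there be $w=w(m)\ge 1$ workers, and let $\epsilon_{k,d}\in[\lambda,1/2)$ (which may depend on $m$) be the probability that worker $k$ answers a degree-$d$ query wrongly. There are $n=n(m)$ queries. Query $j\le m$ has degree one and asks for the label $x_j$; each later query draws a degree $d$ from $\Phi$ and then a uniformly random set of $d$ labels. Every query is given to a uniformly random worker, and its answer $y_j\in\{1,-1\}$ is the product of its labels, with the wrong sign with probability $\epsilon_{k,d}$. All these choices and errors are independent over the queries. Write $\partial y_j$, $d(j)$, $w(j)$ for the label set, degree and worker of query $j$. Let $A^{(1)}$ be the first $m$ queries, $A^{(2)}$ the next $\lfloor m\log m/\log\log m\rfloor$, $A^{(3)}$ the next $\lfloor w\log m\,\log\log m\rfloor$, and $A^{(4)}$ all the others. $\mathrm{sign}(0)$ is decided by a fair coin. **Algorithm.** It is given $\lambda$, the queries, their workers and the answers, but not the $\epsilon_{k,d}$.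 For each label $i$ separately it works as follows, where $S_4$ starts as the set of queries of $A^{(4)}$ that contain $i$, and, after the removals from $S_4$ (steps 1–3 below), $S_3$ starts as the set of queries of $A^{(3)}$ with $(w(j),d(j))=(w(j'),d(j'))$ for some remaining $j'\in S_4$. *Phase 0 (pruning).* The labels below $j\in S_4$ are those in $\partial y_j\setminus\{i\}$; the labels below $j\in S_3$ are those in $\partial y_j$. A query $q\in A^{(2)}$ is below $S_4$ (or $S_3$) if it contains a label that is below some query of this set. If exactly one label of $q$ lies below the queries considered, then the labels below $q$ are its other labels; if two or more do, then $q$ is called *bad*, its *badness* is their number, and the labels below $q$ are all its labels. A query $j\in S_3\cup S_4$ is *above* the labels that are below it and above the queries $q\in A^{(2)}$ that contain such a label. Two different queries with a common label below them (two queries of $S_3\cup S_4$, or two queries of $A^{(2)}$) form a *bad pair*. Each of the following steps is repeated until it no longer applies. Remove from $S_4$: (1) one query of a bad pair in $S_4$; (2) a query above one of two labels below $S_4$ that lie in one bad query; (3) a query above one of the two queries of a bad pair of $A^{(2)}$-queries below $S_4$. Then remove from $S_3$: (4) a query that forms a bad pair with a query of $S_4$; (5) a query above a label of an $A^{(2)}$-query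 that has another label below $S_4$; (6) one query of a bad pair in $S_3$; (7) a query above $q'$, where $q'$ is an $A^{(2)}$-query below $S_3$ that forms a bad pair with an $A^{(2)}$-query below $S_4$; (8) and (9) as (2) and (3), with $S_3$ in place of $S_4$. Where one of several queries has to be removed, the choice is made by an arbitrary rule that depends on the queries and their workers only. An error is claimed if a query of badness larger than two is present at the start of step (2) or (8), if more than three queries are removed from $S_4$ or more than five from $S_3$, or if a bad pair or bad query remains. *Phases 1–4.* With the remaining sets $S_4,S_3$, put $$\hat x^{(1)}_a=y_a,\qquad \hat x^{(2)}_a=\mathrm{sign}\Big(\sum_{j\in A^{(2)},\,a\in\partial y_j}y_j\prod_{b\in\partial y_j\setminus\{a\}}\hat x^{(1)}_b\Big),$$ let $\hat\epsilon_{k,d}$ be the fraction of those $j\in S_3$ with $w(j)=k$, $d(j)=d$ for which $y_j\ne\prod_{a\in\partial y_j}\hat x^{(2)}_a$, truncated to $[\lambda,1/2]$, and $$\hat x_i=\mathrm{sign}\Big(\sum_{j\in S_4}\log\frac{1-\hat\epsilon_{w(j),d(j)}}{\hat\epsilon_{w(j),d(j)}}\;y_j\prod_{a\in\partial y_j\setminus\{i\}}\hat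 x^{(2)}_a\Big).$$ **Theorem 2.** Assume that $w=o(m/\log\log m)$, that $\frac1w\sum_{k=1}^w\epsilon_{k,1}\le p_1$ for all large $m$ (the error probability of the first estimates stays bounded away from $1/2$), that $$n\ \ge\ (1+\eta)\,\frac{m\log m}{\sum_{d=1}^D\sum_{k=1}^w\frac{d\Phi_d}{w}\big(\sqrt{1-\epsilon_{k,d}}-\sqrt{\epsilon_{k,d}}\big)^2}$$ for all large $m$, and that $n=O(m\log m)$. Then the algorithm recovers all labels exactly with high probability: the probability that an error is claimed for some label or that $\hat x\ne x$ tends to $0$ as $m\to\infty$. -/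

import Mathlib

open Filter Asymptotics MeasureTheory
open scoped Topology

noncomputable section

namespace XorQuery

/-! ### Queries, workers and answers -/

/-- A query on `m` labels: the set of labels whose XOR it asks for, and the worker (out of `w`)
to whom it is assigned.  Its degree is the number of its labels. -/
@[ext] structure Query (m w : ℕ) where
  labels : Finset (Fin m)
  worker : Fin w
  deriving DecidableEq, Fintype

instance (m w : ℕ) : MeasurableSpace (Query m w) := ⊤

instance (m w : ℕ) : DiscreteMeasurableSpace (Query m w) := ⟨fun _ => trivial⟩

/-- The degree of a query. -/
def Query.degree {m w : ℕ} (q : Query m w) : ℕ := q.labels.card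

/-- The query design and worker assignment of `n` queries (the tripartite graph). -/
abbrev Design (m w n : ℕ) : Type := Fin n → Query m w

/-- A uniformly random `d`-element subset of the `m` labels. (If `d > m` there is none; the value
is then irrelevant.) -/
def uniformSubset (m d : ℕ) : PMF (Finset (Fin m)) :=
  if h : (Finset.powersetCard d (Finset.univ : Finset (Fin m))).Nonempty then
    PMF.uniformOfFinset _ h
  else PMF.pure ∅

/-- The law of the label set of the `j`-th query (counting from `0`): the first `m` queries have
degree one and ask each label exactly once; every later query draws its degree from `Φ` and then
a uniformly random set of labels of that size. -/
def labelsLaw (m : ℕ) (Φ : PMF ℕ) (j : ℕ) : PMF (Finset (Fin m)) :=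
  if h : j < m then PMF.pure {⟨j, h⟩} else Φ.bind (uniformSubset m)

/-- The law of a bit that is `true` with probability `p`. -/
def flipLaw (p : unitInterval) : PMF Bool :=
  PMF.ofFintype (fun b => if b then ENNReal.ofReal p else ENNReal.ofReal (1 - p)) (by
    have h0 : (0 : ℝ) ≤ p := p.2.1
    have h1 : (0 : ℝ) ≤ 1 - p := sub_nonneg.2 p.2.2
    simp [← ENNReal.ofReal_add h0 h1])

/-- The law of the `j`-th query together with the noise bit that says whether its answer is wrong:
the worker is uniformly random, and worker `k` errs on a degree-`d` query with probability
`ε k d`. -/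
def queryLaw (m w : ℕ) [NeZero w] (Φ : PMF ℕ) (ε : Fin w → ℕ → unitInterval) (j : ℕ) :
    PMF (Query m w × Bool) :=
  (labelsLaw m Φ j).bind fun S =>
    (PMF.uniformOfFintype (Fin w)).bind fun k =>
      (flipLaw (ε k S.card)).map fun b => (⟨S, k⟩, b)

/-- The sample space: the queries with their noise bits, and the fair coins with which the
algorithm breaks ties (one for every label and every label estimated on the way to it, and one
for every final estimate). -/
abbrev Sample (m w n : ℕ) : Type :=
  (Fin n → Query m w × Bool) × (Fin m → Fin m → Bool) × (Fin m → Bool)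

/-- A fair coin. -/
def coin : Measure Bool := (PMF.uniformOfFintype Bool).toMeasure

/-- The probability measure of the model: all queries, answers and coins are independent. -/
def law (m w n : ℕ) [NeZero w] (Φ : PMF ℕ) (ε : Fin w → ℕ → unitInterval) :
    Measure (Sample m w n) :=
  (Measure.pi fun j : Fin n => (queryLaw m w Φ ε j).toMeasure).prod
    ((Measure.pi fun _ : Fin m => Measure.pi fun _ : Fin m => coin).prod
      (Measure.pi fun _ : Fin m => coin))

variable {m w n : ℕ}

/-- The design that is part of an outcome. -/
def Sample.design (ω : Sample m w n) : Design m w n := fun j => (ω.1 j).1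

/-- The answers: the XOR (a product of signs) of the true labels of the query, with the wrong sign
if the noise bit says so. -/
def Sample.answers (x : Fin m → ℤˣ) (ω : Sample m w n) : Fin n → ℤˣ := fun j =>
  (if (ω.1 j).2 then -1 else 1) * ∏ i ∈ (ω.1 j).1.labels, x i

/-! ### The four sets of queries -/

/-- Number of queries of the second phase. -/
def size2 (m : ℕ) : ℕ := ⌊(m : ℝ) * (Real.log m / Real.log (Real.log m))⌋₊

/-- Number of queries of the third phase. -/
def size3 (m w : ℕ) : ℕ := ⌊(w : ℝ) * Real.log m * Real.log (Real.log m)⌋₊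

/-- The second set of queries: those after the first `m` (which form the first set). -/
def A2 (m n : ℕ) : Finset (Fin n) :=
  Finset.univ.filter fun j => m ≤ (j : ℕ) ∧ (j : ℕ) < m + size2 m

/-- The third set of queries. -/
def A3 (m w n : ℕ) : Finset (Fin n) :=
  Finset.univ.filter fun j => m + size2 m ≤ (j : ℕ) ∧ (j : ℕ) < m + size2 m + size3 m w

/-- The fourth set of queries: all the remaining ones. -/
def A4 (m w n : ℕ) : Finset (Fin n) :=
  Finset.univ.filter fun j => m + size2 m + size3 m w ≤ (j : ℕ)

/-! ### The inference graph of a label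

Fix a label `i`.  The graph `G_i` for the inference of `x i` consists of the root `i`, the
fourth-set queries `S₄` that contain `i`, the worker nodes `(k, d)` that answer them, the third-set
queries `S₃` answered by these worker nodes, the labels below `S₄` and `S₃` (whose second
estimates are used), the second-set queries that contain such labels, and the labels below those
(whose first estimates are used). -/

/-- The fourth-set queries that contain the label `i`. -/
def queries4 (G : Design m w n) (i : Fin m) : Finset (Fin n) :=
  (A4 m w n).filter fun j => i ∈ (G j).labels

/-- The worker nodes `(k, d)`: worker `k` answers some degree-`d` query of `S`. -/
def workerNodes (G : Design m w n) (S : Finset (Fin n)) : Finset (Fin w × ℕ) :=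
  S.image fun j => ((G j).worker, (G j).degree)

/-- The third-set queries that belong to a worker node of `S`. -/
def queries3 (G : Design m w n) (S : Finset (Fin n)) : Finset (Fin n) :=
  (A3 m w n).filter fun j => ((G j).worker, (G j).degree) ∈ workerNodes G S

/-- The labels below a fourth-set query (all its labels but the root) or below a third-set query
(all its labels). -/
def kids (G : Design m w n) (i : Fin m) (j : Fin n) : Finset (Fin m) :=
  if j ∈ A4 m w n then (G j).labels.erase i else (G j).labels

/-- The labels below a set `S` of third- and fourth-set queries. -/
def lower (G : Design m w n) (i : Fin m) (S : Finset (Fin n)) : Finset (Fin m) :=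
  S.biUnion (kids G i)

/-- The second-set queries that contain a label from `L`. -/
def touching (G : Design m w n) (L : Finset (Fin m)) : Finset (Fin n) :=
  (A2 m n).filter fun q => ¬ Disjoint (G q).labels L

/-- The number of labels of `L` to which the query `q` is connected.  For a second-set query it is
called its badness if it is at least two; the query is then called bad. -/
def badness (G : Design m w n) (L : Finset (Fin m)) (q : Fin n) : ℕ := ((G q).labels ∩ L).card

/-- The labels below a second-set query `q` when `L` is the set of labels on the level above: those
labels of `q` that are needed for the message of `q` to some other label of `q` in `L`.  If `q`
has a single label in `L` these are all labels of `q` but that one; if it has several, these are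
all labels of `q`. -/
def kids2 (G : Design m w n) (L : Finset (Fin m)) (q : Fin n) : Finset (Fin m) :=
  (G q).labels.filter fun a => ∃ b ∈ (G q).labels ∩ L, b ≠ a

/-- Two different third- or fourth-set queries with a common label below them. -/
def BadPair (G : Design m w n) (i : Fin m) (j j' : Fin n) : Prop :=
  j ≠ j' ∧ ¬ Disjoint (kids G i j) (kids G i j')

/-- Two different second-set queries with a common label below them. -/
def BadPair2 (G : Design m w n) (L : Finset (Fin m)) (q q' : Fin n) : Prop :=
  q ≠ q' ∧ ¬ Disjoint (kids2 G L q) (kids2 G L q')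

/-- The query `j` is a parent of some label of `q` (hence a grandparent of `q`). -/
def Above (G : Design m w n) (i : Fin m) (j q : Fin n) : Prop :=
  ¬ Disjoint (kids G i j) (G q).labels

/-- The query `j` is a parent of a label `a` of `q`, and `q` has another label in `L`. -/
def AboveOneOfTwo (G : Design m w n) (i : Fin m) (L : Finset (Fin m)) (j q : Fin n) : Prop :=
  ∃ a ∈ kids G i j ∩ (G q).labels, ∃ b ∈ (G q).labels ∩ L, a ≠ b

/-- The graph with surviving third- and fourth-set queries `S` has no loop: there is neither a bad
pair nor a bad query. -/
def LoopFree (G : Design m w n) (i : Fin m) (S : Finset (Fin n)) : Prop :=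
  (∀ j ∈ S, ∀ j' ∈ S, ¬ BadPair G i j j') ∧
  (∀ q ∈ A2 m n, badness G (lower G i S) q ≤ 1) ∧
  (∀ q ∈ touching G (lower G i S), ∀ q' ∈ touching G (lower G i S),
    ¬ BadPair2 G (lower G i S) q q')

/-! ### Phase 0: removing the queries that create loops -/

/-- `Prunes cand S T`: the set `T` arises from `S` by removing, one after the other, arbitrarily
chosen elements that are candidates for removal from the current set, until there is none. -/
inductive Prunes {ι : Type} [DecidableEq ι] (cand : Finset ι → ι → Prop) :
    Finset ι → Finset ι → Prop
  | done (S : Finset ι) : (∀ j ∈ S, ¬ cand S j) → Prunes cand S S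
  | remove (S T : Finset ι) (j : ι) :
      j ∈ S → cand S j → Prunes cand (S.erase j) T → Prunes cand S T

/-- One query of a bad pair in `S`. It serves for pairs of fourth-set queries and for pairs of
third-set queries. -/
def candPair (G : Design m w n) (i : Fin m) (S : Finset (Fin n)) (j : Fin n) : Prop :=
  ∃ j' ∈ S, BadPair G i j j'

/-- A parent of one of two labels below `S` to which one second-set query is connected. -/
def candBad (G : Design m w n) (i : Fin m) (S : Finset (Fin n)) (j : Fin n) : Prop :=
  ∃ q ∈ touching G (lower G i S), AboveOneOfTwo G i (lower G i S) j q

/-- A query above one of the queries of a bad pair of second-set queries that both contain labels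
below `S`. -/
def candPair2 (G : Design m w n) (i : Fin m) (S : Finset (Fin n)) (j : Fin n) : Prop :=
  ∃ q ∈ touching G (lower G i S), ∃ q' ∈ touching G (lower G i S),
    BadPair2 G (lower G i S) q q' ∧ Above G i j q

/-- A third-set query that forms a bad pair with a query of `S₄`. -/
def candMixedPair (G : Design m w n) (i : Fin m) (S₄ : Finset (Fin n)) (_S : Finset (Fin n))
    (j : Fin n) : Prop :=
  ∃ j' ∈ S₄, BadPair G i j j'

/-- A third-set query above a second-set query that is also connected to another label, which is
below `S₄`. -/
def candMixedBad (G : Design m w n) (i : Fin m) (S₄ : Finset (Fin n)) (_S : Finset (Fin n))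
    (j : Fin n) : Prop :=
  ∃ q ∈ touching G (lower G i S₄), AboveOneOfTwo G i (lower G i S₄) j q

/-- A third-set query above a second-set query that contains a label below `S` and forms a bad
pair with a second-set query that contains a label below `S₄`. -/
def candMixedPair2 (G : Design m w n) (i : Fin m) (S₄ : Finset (Fin n)) (S : Finset (Fin n))
    (j : Fin n) : Prop :=
  ∃ q ∈ touching G (lower G i S₄), ∃ q' ∈ touching G (lower G i S),
    BadPair2 G (lower G i (S₄ ∪ S)) q q' ∧ Above G i j q'

open Classical in
/-- The possible results of Phase 0 for the label `i`; a result is either `none` (an error is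
claimed) or the pair of the sets of surviving fourth-set and third-set queries.

First bad pairs in the fourth set, then bad second-set queries below it, then bad pairs of
second-set queries below it are removed, at the cost of fourth-set queries; then, at the cost of
third-set queries, the bad pairs and bad queries that involve the third-set queries.  An error is
claimed if a bad query of badness larger than two is found, if more than three fourth-set queries
or more than five third-set queries are removed, or if a loop remains.  Whenever the algorithm has
to remove one of several queries, the choice is left open. -/
inductive Phase0 (G : Design m w n) (i : Fin m) :
    Option (Finset (Fin n) × Finset (Fin n)) → Prop
  | run (S₁ S₂ S₄ T₁ T₂ T₃ T₄ T₅ S₃ : Finset (Fin n))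
      (step1 : Prunes (candPair G i) (queries4 G i) S₁)
      (step2 : Prunes (candBad G i) S₁ S₂)
      (step3 : Prunes (candPair2 G i) S₂ S₄)
      (step4 : Prunes (candMixedPair G i S₄) (queries3 G S₄) T₁)
      (step5 : Prunes (candMixedBad G i S₄) T₁ T₂)
      (step6 : Prunes (candPair G i) T₂ T₃)
      (step7 : Prunes (candMixedPair2 G i S₄) T₃ T₄)
      (step8 : Prunes (candBad G i) T₄ T₅)
      (step9 : Prunes (candPair2 G i) T₅ S₃) :
      Phase0 G i
        (if (∀ q ∈ touching G (lower G i S₁), badness G (lower G i S₁) q ≤ 2) ∧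
            (∀ q ∈ touching G (lower G i T₄), badness G (lower G i T₄) q ≤ 2) ∧
            (queries4 G i \ S₄).card ≤ 3 ∧ (queries3 G S₄ \ S₃).card ≤ 5 ∧
            LoopFree G i (S₄ ∪ S₃)
          then some (S₄, S₃) else none)

theorem Prunes.exists_result {ι : Type} [DecidableEq ι] (cand : Finset ι → ι → Prop)
    (S : Finset ι) : ∃ T, Prunes cand S T := by
  induction S using Finset.strongInduction with
  | H S ih =>
    by_cases h : ∃ j ∈ S, cand S j
    · obtain ⟨j, hj, hc⟩ := h
      obtain ⟨T, hT⟩ := ih (S.erase j) (Finset.erase_ssubset hj)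
      exact ⟨T, .remove S T j hj hc hT⟩
    · exact ⟨S, .done S fun j hj hc => h ⟨j, hj, hc⟩⟩

/-- Phase 0 always has a result. -/
theorem Phase0.exists_result (G : Design m w n) (i : Fin m) : ∃ r, Phase0 G i r := by
  obtain ⟨S₁, h1⟩ := Prunes.exists_result (candPair G i) (queries4 G i)
  obtain ⟨S₂, h2⟩ := Prunes.exists_result (candBad G i) S₁
  obtain ⟨S₄, h3⟩ := Prunes.exists_result (candPair2 G i) S₂
  obtain ⟨T₁, h4⟩ := Prunes.exists_result (candMixedPair G i S₄) (queries3 G S₄)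
  obtain ⟨T₂, h5⟩ := Prunes.exists_result (candMixedBad G i S₄) T₁
  obtain ⟨T₃, h6⟩ := Prunes.exists_result (candPair G i) T₂
  obtain ⟨T₄, h7⟩ := Prunes.exists_result (candMixedPair2 G i S₄) T₃
  obtain ⟨T₅, h8⟩ := Prunes.exists_result (candBad G i) T₄
  obtain ⟨S₃, h9⟩ := Prunes.exists_result (candPair2 G i) T₅
  exact ⟨_, .run S₁ S₂ S₄ T₁ T₂ T₃ T₄ T₅ S₃ h1 h2 h3 h4 h5 h6 h7 h8 h9⟩

/-- A pruning rule resolves, as a function of the query design and the worker assignment alone, all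
choices that Phase 0 leaves open, for every label. -/
structure PruningRule (m w n : ℕ) where
  result : Design m w n → Fin m → Option (Finset (Fin n) × Finset (Fin n))
  valid : ∀ G i, Phase0 G i (result G i)

instance (m w n : ℕ) : Nonempty (PruningRule m w n) :=
  ⟨⟨fun G i => (Phase0.exists_result G i).choose,
    fun G i => (Phase0.exists_result G i).choose_spec⟩⟩

/-! ### Phases 1 to 4

None of these definitions involves the noise parameters, the true labels or the degree
distribution; `lam` is the known lower bound for the noise parameters. -/

/-- The sign of a real number; a tie is broken by a coin. -/
def signWith (c : Bool) (r : ℝ) : ℤˣ :=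
  if 0 < r then 1 else if r < 0 then -1 else if c then 1 else -1

/-- The first estimate of the label `i`: the answer to the query among the first `m` that asks it. -/
def est1 (y : Fin n → ℤˣ) (i : Fin m) : ℤˣ :=
  if h : (i : ℕ) < n then y ⟨i, h⟩ else 1

/-- The message of the query `j` to its label `i`, computed from estimates `z` of the labels. -/
def message (G : Design m w n) (y : Fin n → ℤˣ) (z : Fin m → ℤˣ) (j : Fin n) (i : Fin m) : ℤˣ :=
  y j * ∏ a ∈ (G j).labels.erase i, z a

/-- The second estimate of the label `a`: the majority vote over the messages of the second-set
queries that contain `a`. -/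
def est2 (G : Design m w n) (y : Fin n → ℤˣ) (c : Fin m → Bool) (a : Fin m) : ℤˣ :=
  signWith (c a) (∑ j ∈ (A2 m n).filter fun j => a ∈ (G j).labels,
    ((message G y (est1 y) j a : ℤ) : ℝ))

/-- The estimate of the error probability of worker `k` on degree-`d` queries: the fraction of such
queries in `S₃` whose answer disagrees with the second estimates, truncated to `[lam, 1/2]`. -/
def noiseEst (lam : ℝ) (G : Design m w n) (y : Fin n → ℤˣ) (c : Fin m → Bool)
    (S₃ : Finset (Fin n)) (k : Fin w) (d : ℕ) : ℝ :=
  let Q := S₃.filter fun j => (G j).worker = k ∧ (G j).degree = d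
  max lam (min (1 / 2)
    (((Q.filter fun j => y j ≠ ∏ a ∈ (G j).labels, est2 G y c a).card : ℝ) / (Q.card : ℝ)))

/-- The final estimate of the label `i` from the surviving queries `S₄` and `S₃`: the majority vote
over the messages of the queries of `S₄`, weighted by the estimated log-likelihood ratios. -/
def est4 (lam : ℝ) (G : Design m w n) (y : Fin n → ℤˣ) (c : Fin m → Bool) (c' : Bool)
    (S₄ S₃ : Finset (Fin n)) (i : Fin m) : ℤˣ :=
  signWith c' (∑ j ∈ S₄,
    Real.log ((1 - noiseEst lam G y c S₃ (G j).worker (G j).degree) /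
        noiseEst lam G y c S₃ (G j).worker (G j).degree) *
      ((message G y (est2 G y c) j i : ℤ) : ℝ))

/-- The whole algorithm: the estimate of the label `i` from the design `G`, the answers `y`, and
the coins; `none` if an error is claimed for `i`. -/
def algorithm (lam : ℝ) (rule : PruningRule m w n) (G : Design m w n) (y : Fin n → ℤˣ)
    (coins : Fin m → Fin m → Bool) (coins' : Fin m → Bool) (i : Fin m) : Option ℤˣ :=
  (rule.result G i).map fun S => est4 lam G y (coins i) (coins' i) S.1 S.2 i

/-- The event that the algorithm does not return exactly the true label vector `x`. -/
def failure (lam : ℝ) (rule : PruningRule m w n) (x : Fin m → ℤˣ) : Set (Sample m w n) :=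
  {ω | ∃ i, algorithm lam rule ω.design (ω.answers x) ω.2.1 ω.2.2 i ≠ some (x i)}

/-- The optimal number of queries
`m log m / (∑ d, ∑ k, (d Φ_d / w) (√(1 - ε_{k,d}) - √ε_{k,d})²)`. -/
def optimalSize (m w D : ℕ) (Φ : PMF ℕ) (ε : Fin w → ℕ → unitInterval) : ℝ :=
  (m : ℝ) * Real.log m /
    ∑ d ∈ Finset.Icc 1 D, ∑ k : Fin w,
      (d : ℝ) * (Φ d).toReal / (w : ℝ) *
        (Real.sqrt (1 - (ε k d : ℝ)) - Real.sqrt (ε k d : ℝ)) ^ 2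

end XorQuery

end

/-!
The first estimates are right with probability bounded away from one half, so on all but a negligible
event their signs relative to the true labels have a positive mean `ρ`. A label takes part in about
`log m / log log m` queries of the second set. The votes of these decide the second estimates, which
may still be wrong too often for a union bound over all labels, but not for a union bound over groups
of `K` labels, `K` being of order `√(log m)`: in each of the sets of labels on which the estimate of
a label depends (the labels of its fourth-set queries and the labels below each worker node, roughly
`log m * log log m` of them) fewer than `K` second estimates are wrong (`pr_many_wrong_le`). For a
fixed group of labels this is a Chernoff bound for the sum of their votes, given the first estimates;
no independence of the votes, hence no tree structure below the second estimates, is needed.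

The pruning ensures that different queries of the third and fourth sets use disjoint sets of second
estimates, so that fewer than `K` of them are misled. It succeeds as soon as the inference graph of
the label does not contain two independent loops within a bounded number of queries (`Crowded`):
every removal breaks a loop (`Costly`), and after one removal in the fourth set or in the third set
no loop is left (`Phase0.eq_some`). Loops are counted by the excess of a set of queries, the number
of coincidences of labels beyond those that connect the set. A set of excess two costs a factor
`1 / m ^ 2` up to powers of `log m`, so a first-moment bound (`pr_crowded_le`) survives the union
bound over the labels.

Since each worker node has about `log m * log log m` third-set queries, of which fewer than `K` are
misled, all noise parameters are estimated within a small constant (`abs_noiseEst_sub_le`). The final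
vote then differs little from the one with the true log-likelihood ratios and no misled query. The
exponential moment of order one half of the log-likelihood ratio of an answer is
`1 - (√(1 - ε) - √ε) ^ 2`, so the probability that this vote is not clear is at most
`exp (-(n / m) * capacity)` up to a small change of the exponent (`pr_final_vote_le`), which is below
`m ^ (-1 - η / 4)` by the assumption on `n`. A union bound over all labels and worker nodes
(`law_failure_le`) completes the proof.

The coins are irrelevant, since no vote ties outside the exceptional events. Probabilities are
computed as finite sums over the queries and noise bits (`expect`, `pr`).
-/

noncomputable section

namespace XorQuery

/-! ### Expectations under finite product laws -/

section Expectation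

variable {ι X : Type*} [Fintype ι] [DecidableEq ι] [Fintype X]

/-- The expectation of `f` when the coordinates are independent and the `j`-th one has the
probability mass function `p j`. -/
def expect (p : ι → X → ℝ) (f : (ι → X) → ℝ) : ℝ := ∑ ω, (∏ j, p j (ω j)) * f ω

/-- The probability of an event when the coordinates are independent and the `j`-th one has the
probability mass function `p j`. -/
def pr (p : ι → X → ℝ) (E : Set (ι → X)) : ℝ := expect p (E.indicator 1)

theorem expect_mono {p : ι → X → ℝ} (hp : ∀ j x, 0 ≤ p j x) {f g : (ι → X) → ℝ}
    (h : ∀ ω, (∀ j, p j (ω j) ≠ 0) → f ω ≤ g ω) : expect p f ≤ expect p g := by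
  refine Finset.sum_le_sum fun ω _ => ?_
  by_cases hω : ∀ j, p j (ω j) ≠ 0
  · exact mul_le_mul_of_nonneg_left (h ω hω) (Finset.prod_nonneg fun j _ => hp _ _)
  · push Not at hω
    obtain ⟨j, hj⟩ := hω
    have : ∏ j, p j (ω j) = 0 := Finset.prod_eq_zero (Finset.mem_univ j) hj
    simp [this]

theorem expect_nonneg {p : ι → X → ℝ} (hp : ∀ j x, 0 ≤ p j x) {f : (ι → X) → ℝ}
    (h : ∀ ω, 0 ≤ f ω) : 0 ≤ expect p f :=
  Finset.sum_nonneg fun ω _ => mul_nonneg (Finset.prod_nonneg fun _ _ => hp _ _) (h ω)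

theorem expect_sum {p : ι → X → ℝ} {κ : Type*} (s : Finset κ) (f : κ → (ι → X) → ℝ) :
    expect p (fun ω => ∑ a ∈ s, f a ω) = ∑ a ∈ s, expect p (f a) := by
  simp only [expect, Finset.mul_sum]
  exact Finset.sum_comm

theorem expect_mul_const {p : ι → X → ℝ} (f : (ι → X) → ℝ) (c : ℝ) :
    expect p (fun ω => f ω * c) = expect p f * c := by
  simp only [expect, Finset.sum_mul, mul_assoc]

theorem expect_one {p : ι → X → ℝ} (hp : ∀ j, ∑ x, p j x = 1) : expect p (fun _ => 1) = 1 := by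
  have := Finset.prod_univ_sum (fun _ : ι => (Finset.univ : Finset X)) p
  simp only [Fintype.piFinset_univ] at this
  simp [expect, ← this, hp]

/-- Sampling one coordinate again does not change an expectation. -/
theorem expect_resample {p : ι → X → ℝ} (hp : ∀ j, ∑ x, p j x = 1) (f : (ι → X) → ℝ) (j : ι) :
    expect p f = expect p (fun ω => ∑ x, p j x * f (Function.update ω j x)) := by
  have key : ∀ (ω : ι → X) (x : X),
      (∏ l, p l (Function.update ω j x l)) * p j (ω j) = (∏ l, p l (ω l)) * p j x := by
    intro ω x
    rw [← Finset.mul_prod_erase _ _ (Finset.mem_univ j),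
      ← Finset.mul_prod_erase _ (fun l => p l (ω l)) (Finset.mem_univ j)]
    have : ∏ l ∈ Finset.univ.erase j, p l (Function.update ω j x l) =
        ∏ l ∈ Finset.univ.erase j, p l (ω l) :=
      Finset.prod_congr rfl fun l hl => by rw [Function.update_of_ne (Finset.ne_of_mem_erase hl)]
    rw [this, Function.update_self]
    ring
  -- the involution that exchanges the old and the new value of the coordinate
  let σ : (ι → X) × X → (ι → X) × X := fun z => (Function.update z.1 j z.2, z.1 j)
  have hσ : Function.Involutive σ := fun z => by simp [σ]
  have h1 : expect p f = ∑ z : (ι → X) × X, (∏ l, p l (z.1 l)) * p j z.2 * f z.1 := by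
    rw [Fintype.sum_prod_type]
    refine Finset.sum_congr rfl fun ω _ => ?_
    simp only
    rw [← Finset.sum_mul, ← Finset.mul_sum, hp, mul_one]
  have h2 : expect p (fun ω => ∑ x, p j x * f (Function.update ω j x)) =
      ∑ z : (ι → X) × X, (∏ l, p l (z.1 l)) * p j z.2 * f (Function.update z.1 j z.2) := by
    rw [Fintype.sum_prod_type]
    refine Finset.sum_congr rfl fun ω _ => ?_
    simp only [Finset.mul_sum, mul_assoc]
  rw [h1, h2]
  refine (Fintype.sum_equiv hσ.toPerm _ _ fun z => ?_).symm
  change _ = (∏ l, p l (Function.update z.1 j z.2 l)) * p j (z.1 j) * _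
  rw [key]
  rfl

/-- Integrating out the coordinates in `T`, given all the others: the factors of the product are
independent given the coordinates outside `T`. -/
theorem expect_mul_prod_le {p : ι → X → ℝ} (hp0 : ∀ j x, 0 ≤ p j x) (hp : ∀ j, ∑ x, p j x = 1)
    (T : Finset ι) (h : (ι → X) → ℝ) (g : ι → (ι → X) → X → ℝ) (c : ι → ℝ)
    (h0 : ∀ ω, 0 ≤ h ω) (g0 : ∀ j ω x, 0 ≤ g j ω x) (c0 : ∀ j, 0 ≤ c j)
    (hT : ∀ j ∈ T, ∀ ω x, h (Function.update ω j x) = h ω)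
    (gT : ∀ q ∈ T, ∀ j ∈ T, ∀ ω x, g q (Function.update ω j x) = g q ω)
    (hc : ∀ q ∈ T, ∀ ω, h ω ≠ 0 → ∑ x, p q x * g q ω x ≤ c q) :
    expect p (fun ω => h ω * ∏ q ∈ T, g q ω (ω q)) ≤ expect p h * ∏ q ∈ T, c q := by
  induction T using Finset.induction_on with
  | empty => simp
  | insert q T hq ih =>
    have ih' := ih (fun j hj => hT j (Finset.mem_insert_of_mem hj))
      (fun a ha j hj => gT a (Finset.mem_insert_of_mem ha) j (Finset.mem_insert_of_mem hj))
      (fun a ha => hc a (Finset.mem_insert_of_mem ha))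
    rw [expect_resample hp _ q, Finset.prod_insert hq, mul_comm (c q), ← mul_assoc]
    refine le_trans ?_ (mul_le_mul_of_nonneg_right ih' (c0 q))
    rw [← expect_mul_const]
    refine expect_mono hp0 fun ω _ => ?_
    have : ∀ x, h (Function.update ω q x) * ∏ a ∈ insert q T,
        g a (Function.update ω q x) (Function.update ω q x a) =
        (h ω * ∏ a ∈ T, g a ω (ω a)) * g q ω x := by
      intro x
      rw [hT q (Finset.mem_insert_self _ _), Finset.prod_insert hq, Function.update_self,
        gT q (Finset.mem_insert_self _ _) q (Finset.mem_insert_self _ _)]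
      have : ∏ a ∈ T, g a (Function.update ω q x) (Function.update ω q x a) =
          ∏ a ∈ T, g a ω (ω a) := Finset.prod_congr rfl fun a ha => by
        rw [Function.update_of_ne (ne_of_mem_of_not_mem ha hq),
          gT a (Finset.mem_insert_of_mem ha) q (Finset.mem_insert_self _ _)]
      rw [this]
      ring
    simp only [this]
    by_cases hω : h ω = 0
    · simp [hω]
    · have h1 := hc q (Finset.mem_insert_self _ _) ω hω
      calc ∑ x, p q x * ((h ω * ∏ a ∈ T, g a ω (ω a)) * g q ω x)
          = (h ω * ∏ a ∈ T, g a ω (ω a)) * ∑ x, p q x * g q ω x := by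
            rw [Finset.mul_sum]
            exact Finset.sum_congr rfl fun x _ => by ring
        _ ≤ _ := mul_le_mul_of_nonneg_left h1
            (mul_nonneg (h0 ω) (Finset.prod_nonneg fun a _ => g0 _ _ _))

theorem expect_prod_le {p : ι → X → ℝ} (hp0 : ∀ j x, 0 ≤ p j x) (hp : ∀ j, ∑ x, p j x = 1)
    (T : Finset ι) (g : ι → X → ℝ) (c : ι → ℝ) (g0 : ∀ j x, 0 ≤ g j x) (c0 : ∀ j, 0 ≤ c j)
    (hc : ∀ q ∈ T, ∑ x, p q x * g q x ≤ c q) :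
    expect p (fun ω => ∏ q ∈ T, g q (ω q)) ≤ ∏ q ∈ T, c q := by
  have := expect_mul_prod_le hp0 hp T (fun _ => 1) (fun q _ => g q) c (fun _ => zero_le_one)
    (fun j _ => g0 j) c0 (fun _ _ _ _ => rfl) (fun _ _ _ _ _ _ => rfl) (fun q hq _ _ => hc q hq)
  rw [expect_one hp, one_mul] at this
  simpa using this

/-- Markov's inequality. Only outcomes of positive probability need to be considered. -/
theorem pr_le_expect {p : ι → X → ℝ} (hp : ∀ j x, 0 ≤ p j x) {E : Set (ι → X)}
    {f : (ι → X) → ℝ} (f0 : ∀ ω, 0 ≤ f ω)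
    (hf : ∀ ω, (∀ j, p j (ω j) ≠ 0) → ω ∈ E → 1 ≤ f ω) : pr p E ≤ expect p f := by
  refine expect_mono hp fun ω hω => ?_
  by_cases h : ω ∈ E
  · simpa [h] using hf ω hω h
  · simpa [h] using f0 ω

/-- Monotonicity up to null events. -/
theorem pr_mono {p : ι → X → ℝ} (hp : ∀ j x, 0 ≤ p j x) {E F : Set (ι → X)}
    (h : ∀ ω, (∀ j, p j (ω j) ≠ 0) → ω ∈ E → ω ∈ F) : pr p E ≤ pr p F :=
  pr_le_expect hp (fun _ => Set.indicator_nonneg (fun _ _ => zero_le_one) _)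
    fun ω hω hE => by simp [h ω hω hE]

theorem pr_union_le {p : ι → X → ℝ} (hp : ∀ j x, 0 ≤ p j x) (E F : Set (ι → X)) :
    pr p (E ∪ F) ≤ pr p E + pr p F := by
  have : pr p E + pr p F = expect p (fun ω => E.indicator 1 ω + F.indicator 1 ω) := by
    simp only [pr, expect, mul_add, Finset.sum_add_distrib]
  have h0 : ∀ (A : Set (ι → X)) ω, 0 ≤ A.indicator (1 : (ι → X) → ℝ) ω :=
    fun A ω => Set.indicator_nonneg (fun _ _ => zero_le_one) _
  rw [this]
  refine pr_le_expect hp (fun ω => add_nonneg (h0 E ω) (h0 F ω)) fun ω _ h => ?_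
  have hE := h0 E ω
  have hF := h0 F ω
  rcases h with h | h
  · rw [Set.indicator_of_mem h, Pi.one_apply]
    linarith
  · rw [Set.indicator_of_mem h, Pi.one_apply]
    linarith

theorem pr_exists_le {p : ι → X → ℝ} (hp : ∀ j x, 0 ≤ p j x) {κ : Type*} (s : Finset κ)
    (E : κ → Set (ι → X)) : pr p {ω | ∃ a ∈ s, ω ∈ E a} ≤ ∑ a ∈ s, pr p (E a) := by
  have h0 : ∀ (a : κ) ω, 0 ≤ (E a).indicator (1 : (ι → X) → ℝ) ω :=
    fun a ω => Set.indicator_nonneg (fun _ _ => zero_le_one) _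
  have : ∑ a ∈ s, pr p (E a) = expect p (fun ω => ∑ a ∈ s, (E a).indicator 1 ω) :=
    (expect_sum s fun a => (E a).indicator 1).symm
  rw [this]
  refine pr_le_expect hp (fun ω => Finset.sum_nonneg fun a _ => h0 a ω) ?_
  rintro ω - ⟨a, ha, hω⟩
  refine le_trans ?_ (Finset.single_le_sum (fun b _ => h0 b ω) ha)
  simp [hω]

/-- Chernoff's bound for a sum of independent terms. -/
theorem pr_sum_ge_le {p : ι → X → ℝ} (hp0 : ∀ j x, 0 ≤ p j x) (hp : ∀ j, ∑ x, p j x = 1)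
    (T : Finset ι) (f : ι → X → ℝ) (θ c : ℝ) (c0 : 0 ≤ c)
    (hc : ∀ q ∈ T, ∑ x, p q x * Real.exp (f q x) ≤ c) :
    pr p {ω | θ ≤ ∑ q ∈ T, f q (ω q)} ≤ Real.exp (-θ) * c ^ T.card := by
  have h1 : pr p {ω | θ ≤ ∑ q ∈ T, f q (ω q)} ≤
      expect p (fun ω => (∏ q ∈ T, Real.exp (f q (ω q))) * Real.exp (-θ)) := by
    refine pr_le_expect hp0 (fun ω => by positivity) fun ω _ h => ?_
    rw [← Real.exp_sum, ← Real.exp_add]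
    exact Real.one_le_exp (by simpa using h)
  refine h1.trans ?_
  rw [expect_mul_const, mul_comm, ← Finset.prod_const]
  exact mul_le_mul_of_nonneg_left (expect_prod_le hp0 hp T (fun q x => Real.exp (f q x))
    (fun _ => c) (fun _ _ => (Real.exp_pos _).le) (fun _ => c0) hc) (Real.exp_pos _).le

/-- The product measure of probability mass functions on a finite type, in terms of `pr`. -/
theorem pi_toMeasure_eq_pr [MeasurableSpace X] [MeasurableSingletonClass X] (P : ι → PMF X)
    (E : Set (ι → X)) :
    Measure.pi (fun j => (P j).toMeasure) E =
      ENNReal.ofReal (pr (fun j x => (P j x).toReal) E) := by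
  classical
  have h1 : Measure.pi (fun j => (P j).toMeasure) E =
      ∑ ω ∈ Finset.univ.filter (· ∈ E), Measure.pi (fun j => (P j).toMeasure) {ω} := by
    rw [sum_measure_singleton]
    congr 1
    ext
    simp
  rw [h1, pr, expect, ENNReal.ofReal_sum_of_nonneg]
  · rw [Finset.sum_filter]
    refine Finset.sum_congr rfl fun ω _ => ?_
    split_ifs with h
    · rw [Measure.pi_singleton, Set.indicator_of_mem h, Pi.one_apply, mul_one,
        ENNReal.ofReal_prod_of_nonneg fun _ _ => ENNReal.toReal_nonneg]
      refine Finset.prod_congr rfl fun j _ => ?_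
      rw [PMF.toMeasure_apply_singleton _ _ (measurableSet_singleton _),
        ENNReal.ofReal_toReal (PMF.apply_ne_top _ _)]
    · simp [h]
  · intro ω _
    exact mul_nonneg (Finset.prod_nonneg fun _ _ => ENNReal.toReal_nonneg)
      (Set.indicator_nonneg (fun _ _ => zero_le_one) _)

end Expectation

section QueryLaw

/-! ### The law of one query -/

/-- The probability mass function of the `j`-th query with its noise bit. -/
def weight (m w n : ℕ) [NeZero w] (Φ : PMF ℕ) (ε : Fin w → ℕ → unitInterval) (j : Fin n)
    (x : Query m w × Bool) : ℝ :=
  (queryLaw m w Φ ε j x).toReal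

variable {m w n : ℕ} [NeZero w] {Φ : PMF ℕ} {ε : Fin w → ℕ → unitInterval} {D : ℕ}

theorem weight_nonneg (j : Fin n) (x : Query m w × Bool) : 0 ≤ weight m w n Φ ε j x :=
  ENNReal.toReal_nonneg

theorem _root_.PMF.sum_toReal {α : Type*} [Fintype α] (P : PMF α) : ∑ x, (P x).toReal = 1 := by
  rw [← ENNReal.toReal_sum fun x _ => P.apply_ne_top x, ← tsum_fintype (L := .unconditional _),
    P.tsum_coe, ENNReal.toReal_one]

theorem sum_weight (j : Fin n) : ∑ x, weight m w n Φ ε j x = 1 := PMF.sum_toReal _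

/-- Expectations with respect to a law that is composed of two random choices. -/
theorem _root_.PMF.sum_bind_toReal_mul {α β : Type*} [Fintype α] [Fintype β] (P : PMF α)
    (Q : α → PMF β) (f : β → ℝ) :
    ∑ b, (P.bind Q b).toReal * f b = ∑ a, (P a).toReal * ∑ b, (Q a b).toReal * f b := by
  have : ∀ b, (P.bind Q b).toReal = ∑ a, (P a).toReal * (Q a b).toReal := by
    intro b
    rw [PMF.bind_apply, tsum_fintype, ENNReal.toReal_sum fun a _ =>
      ENNReal.mul_ne_top (P.apply_ne_top a) ((Q a).apply_ne_top b)]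
    simp
  simp only [this, Finset.sum_mul, Finset.mul_sum]
  rw [Finset.sum_comm]
  exact Finset.sum_congr rfl fun a _ => Finset.sum_congr rfl fun b _ => by ring

/-- The expectation of a function of one query: its worker errs with probability `ε k d`. -/
theorem sum_weight_mul (j : Fin n) (f : Query m w × Bool → ℝ) :
    ∑ x, weight m w n Φ ε j x * f x =
      ∑ S, (labelsLaw m Φ j S).toReal * ((w : ℝ)⁻¹ * ∑ k : Fin w,
        ((1 - (ε k S.card : ℝ)) * f (⟨S, k⟩, false) + ε k S.card * f (⟨S, k⟩, true))) := by
  simp only [weight, queryLaw]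
  rw [PMF.sum_bind_toReal_mul]
  refine Finset.sum_congr rfl fun S _ => ?_
  rw [PMF.sum_bind_toReal_mul]
  refine congrArg _ ?_
  rw [Finset.mul_sum]
  refine Finset.sum_congr rfl fun k _ => ?_
  rw [PMF.map, PMF.sum_bind_toReal_mul]
  have h1 : (0 : ℝ) ≤ 1 - (ε k S.card : ℝ) := sub_nonneg.2 (ε k S.card).2.2
  have h2 : (0 : ℝ) ≤ (ε k S.card : ℝ) := (ε k S.card).2.1
  have h3 : ∀ y : Query m w × Bool,
      ∑ b, ((PMF.pure y) b).toReal * f b = f y := by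
    intro y
    simp [PMF.pure_apply, apply_ite ENNReal.toReal]
  simp only [Function.comp_apply, h3]
  simp [flipLaw, h1, h2]
  left
  ring

/-- The first `m` queries ask one label each. -/
theorem sum_weight_mul_of_lt (j : Fin n) (hj : (j : ℕ) < m) (f : Query m w × Bool → ℝ) :
    ∑ x, weight m w n Φ ε j x * f x =
      (w : ℝ)⁻¹ * ∑ k : Fin w, ((1 - (ε k 1 : ℝ)) * f (⟨{⟨j, hj⟩}, k⟩, false) +
        ε k 1 * f (⟨{⟨j, hj⟩}, k⟩, true)) := by
  rw [sum_weight_mul]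
  simp only [labelsLaw, hj, dite_true, PMF.pure_apply, apply_ite ENNReal.toReal,
    ENNReal.toReal_one, ENNReal.toReal_zero, ite_mul, one_mul, zero_mul]
  rw [Finset.sum_ite_eq_of_mem' _ _ _ (Finset.mem_univ _)]
  simp

theorem labelsLaw_toReal (hΦ : Φ.support ⊆ Set.Icc 1 D) (hD : D ≤ m) (j : ℕ) (hj : m ≤ j)
    (S : Finset (Fin m)) :
    (labelsLaw m Φ j S).toReal = ∑ d ∈ Finset.Icc 1 D, (Φ d).toReal *
      ((m.choose d : ℝ)⁻¹ * if S ∈ Finset.powersetCard d Finset.univ then 1 else 0) := by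
  have h0 : ∀ d ∉ Finset.Icc 1 D, Φ d = 0 := by
    intro d hd
    by_contra h
    have := hΦ ((PMF.mem_support_iff _ _).2 h)
    simp only [Set.mem_Icc] at this
    exact hd (Finset.mem_Icc.2 this)
  rw [labelsLaw, dif_neg hj.not_gt, PMF.bind_apply, tsum_eq_sum (s := Finset.Icc 1 D),
    ENNReal.toReal_sum fun a _ => ENNReal.mul_ne_top (Φ.apply_ne_top a) (PMF.apply_ne_top _ _)]
  · refine Finset.sum_congr rfl fun d hd => ?_
    rw [ENNReal.toReal_mul]
    congr 1
    have hne : (Finset.powersetCard d (Finset.univ : Finset (Fin m))).Nonempty := by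
      rw [Finset.powersetCard_nonempty]
      simpa using (Finset.mem_Icc.1 hd).2.trans hD
    rw [uniformSubset, dif_pos hne, PMF.uniformOfFinset_apply]
    split_ifs <;> simp
  · intro d hd
    simp [h0 d hd]

/-- All later queries draw a degree from `Φ` and then a uniformly random label set. -/
theorem sum_weight_mul_of_le (hΦ : Φ.support ⊆ Set.Icc 1 D) (hD : D ≤ m) (j : Fin n)
    (hj : m ≤ (j : ℕ)) (f : Query m w × Bool → ℝ) :
    ∑ x, weight m w n Φ ε j x * f x =
      ∑ d ∈ Finset.Icc 1 D, (Φ d).toReal * ((m.choose d : ℝ)⁻¹ *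
        ∑ S ∈ Finset.powersetCard d Finset.univ, (w : ℝ)⁻¹ * ∑ k : Fin w,
          ((1 - (ε k d : ℝ)) * f (⟨S, k⟩, false) + ε k d * f (⟨S, k⟩, true))) := by
  rw [sum_weight_mul]
  simp only [labelsLaw_toReal hΦ hD j hj, Finset.sum_mul]
  rw [Finset.sum_comm]
  refine Finset.sum_congr rfl fun d _ => ?_
  simp only [mul_assoc]
  rw [← Finset.mul_sum, ← Finset.mul_sum]
  congr 2
  rw [← Finset.sum_subset (Finset.subset_univ (Finset.powersetCard d Finset.univ))]
  · refine Finset.sum_congr rfl fun S hS => ?_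
    rw [if_pos hS, one_mul, (Finset.mem_powersetCard.1 hS).2]
  · intro S _ hS
    rw [if_neg hS, zero_mul]

theorem sum_degree (hΦ : Φ.support ⊆ Set.Icc 1 D) :
    ∑ d ∈ Finset.Icc 1 D, (Φ d).toReal = 1 := by
  rw [← ENNReal.toReal_sum fun x _ => Φ.apply_ne_top x, ← tsum_eq_sum (L := .unconditional ℕ),
    Φ.tsum_coe, ENNReal.toReal_one]
  intro d hd
  by_contra h
  have := hΦ ((PMF.mem_support_iff _ _).2 h)
  simp only [Set.mem_Icc] at this
  exact hd (Finset.mem_Icc.2 this)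

theorem labels_of_weight_ne_zero (j : Fin n) (hj : (j : ℕ) < m) (x : Query m w × Bool)
    (hx : weight m w n Φ ε j x ≠ 0) : x.1.labels = {⟨j, hj⟩} := by
  classical
  by_contra h
  have h1 := sum_weight_mul_of_lt (Φ := Φ) (ε := ε) j hj
    (fun y : Query m w × Bool => if y.1.labels = {⟨j, hj⟩} then 0 else 1)
  simp only [if_true, mul_zero, add_zero, Finset.sum_const_zero] at h1
  have h2 := (Finset.sum_eq_zero_iff_of_nonneg (fun y _ => mul_nonneg (weight_nonneg j y)
    (by split_ifs <;> simp))).1 h1 x (Finset.mem_univ _)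
  rw [if_neg h, mul_one] at h2
  exact hx h2

theorem degree_of_weight_ne_zero (hΦ : Φ.support ⊆ Set.Icc 1 D) (hD : D ≤ m) (j : Fin n)
    (hj : m ≤ (j : ℕ)) (x : Query m w × Bool) (hx : weight m w n Φ ε j x ≠ 0) :
    x.1.degree ∈ Finset.Icc 1 D ∧ Φ x.1.degree ≠ 0 := by
  classical
  by_contra h
  have h1 := sum_weight_mul_of_le (ε := ε) hΦ hD j hj
    (fun y : Query m w × Bool =>
      if y.1.degree ∈ Finset.Icc 1 D ∧ Φ y.1.degree ≠ 0 then 0 else 1)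
  have h3 : ∑ x, weight m w n Φ ε j x *
      (if x.1.degree ∈ Finset.Icc 1 D ∧ Φ x.1.degree ≠ 0 then (0 : ℝ) else 1) = 0 := by
    rw [h1]
    refine Finset.sum_eq_zero fun d hd => ?_
    by_cases hd0 : Φ d = 0
    · simp [hd0]
    · rw [Finset.sum_eq_zero, mul_zero, mul_zero]
      intro S hS
      have : S.card = d := (Finset.mem_powersetCard.1 hS).2
      have h4 : ∀ (k : Fin w) (b : Bool),
          (if ((⟨S, k⟩, b) : Query m w × Bool).1.degree ∈ Finset.Icc 1 D ∧
            Φ ((⟨S, k⟩, b) : Query m w × Bool).1.degree ≠ 0 then (0 : ℝ) else 1) = 0 :=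
        fun k b => if_pos (by rw [Query.degree, this]; exact ⟨hd, hd0⟩)
      simp only [h4]
      simp
  have h2 := (Finset.sum_eq_zero_iff_of_nonneg (fun y _ => mul_nonneg (weight_nonneg j y)
    (by split_ifs <;> simp))).1 h3 x (Finset.mem_univ _)
  rw [if_neg h, mul_one] at h2
  exact hx h2

/-- The coins play no role in a bound for an event that is contained in one about the queries and
the noise. -/
theorem law_le_pr (F : Set (Sample m w n)) (E : Set (Fin n → Query m w × Bool))
    (h : ∀ ω ∈ F, ω.1 ∈ E) :
    law m w n Φ ε F ≤ ENNReal.ofReal (pr (weight m w n Φ ε) E) := by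
  have : IsProbabilityMeasure coin := PMF.toMeasure.isProbabilityMeasure _
  have h1 : F ⊆ E ×ˢ Set.univ := fun ω hω => ⟨h ω hω, trivial⟩
  refine (measure_mono h1).trans ?_
  rw [law, Measure.prod_prod, measure_univ, mul_one, pi_toMeasure_eq_pr]
  rfl

end QueryLaw

section Excess

/-! ### The excess of a set of queries, and Phase 0 -/

variable {m w n : ℕ}

theorem mem_A4 {j : Fin n} : j ∈ A4 m w n ↔ m + size2 m + size3 m w ≤ (j : ℕ) := by
  simp [A4]

theorem mem_A3 {j : Fin n} :
    j ∈ A3 m w n ↔ m + size2 m ≤ (j : ℕ) ∧ (j : ℕ) < m + size2 m + size3 m w := by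
  simp [A3]

theorem mem_A2 {j : Fin n} : j ∈ A2 m n ↔ m ≤ (j : ℕ) ∧ (j : ℕ) < m + size2 m := by
  simp [A2]

/-- The labels of the queries of `T`, together with the root. -/
def seen (G : Design m w n) (i : Fin m) (T : Finset (Fin n)) : Finset (Fin m) :=
  insert i (T.biUnion fun j => (G j).labels)

/-- The cost of a query in the count of the excess: a query that is not in the third set has to
share a label with the rest of the graph in order to belong to it, while a third-set query is
connected through its worker. -/
def cost (w : ℕ) (m : ℕ) (j : Fin n) : ℕ := if j ∈ A3 m w n then 0 else 1

/-- The excess of a set of queries in the inference graph of `i`: the number of coincidences of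
labels beyond those that connect the queries. It is the number of independent loops if every
query is connected to the root. -/
def excess (G : Design m w n) (i : Fin m) (T : Finset (Fin n)) : ℤ :=
  1 + ∑ j ∈ T, (((G j).labels.card : ℤ) - cost w m j) - (seen G i T).card

/-- The inference graph of `i` contains a bounded number of queries with two loops. Every third-set
query among them has to share its worker with another of them outside the third set. A loop takes at
most four queries (`Costly`), two loops at most eight, and the workers of these are connected to the
root by at most eight further ones, hence the bound sixteen. -/
def Crowded (G : Design m w n) (i : Fin m) : Prop :=
  ∃ T : Finset (Fin n), T.card ≤ 16 ∧ (∀ j ∈ T, m ≤ (j : ℕ)) ∧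
    (∀ j ∈ T, j ∈ A3 m w n → ∃ r ∈ T, r ∉ A3 m w n ∧ (G r).worker = (G j).worker) ∧
    2 ≤ excess G i T

theorem seen_insert (G : Design m w n) (i : Fin m) (T : Finset (Fin n)) (j : Fin n) :
    seen G i (insert j T) = (G j).labels ∪ seen G i T := by
  simp [seen, Finset.biUnion_insert]

theorem seen_mono (G : Design m w n) (i : Fin m) {T T' : Finset (Fin n)} (h : T ⊆ T') :
    seen G i T ⊆ seen G i T' :=
  Finset.insert_subset_insert _ (Finset.biUnion_subset_biUnion_of_subset_left _ h)

theorem labels_subset_seen (G : Design m w n) (i : Fin m) {T : Finset (Fin n)} {j : Fin n}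
    (hj : j ∈ T) : (G j).labels ⊆ seen G i T := fun _ ha =>
  Finset.mem_insert_of_mem (Finset.mem_biUnion.2 ⟨j, hj, ha⟩)

theorem excess_empty (G : Design m w n) (i : Fin m) : excess G i ∅ = 0 := by
  simp [excess, seen]

theorem excess_insert (G : Design m w n) (i : Fin m) {T : Finset (Fin n)} {j : Fin n}
    (hj : j ∉ T) :
    excess G i (insert j T) =
      excess G i T + ((G j).labels ∩ seen G i T).card - cost w m j := by
  have h := Finset.card_union_add_card_inter (G j).labels (seen G i T)
  rw [excess, excess, Finset.sum_insert hj, seen_insert]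
  omega

/-- The set `C` of third- and fourth-set queries belongs to the graph of `i`. -/
def Rooted (G : Design m w n) (i : Fin m) (C : Finset (Fin n)) : Prop :=
  ∀ j ∈ C, (j ∈ A4 m w n ∧ i ∈ (G j).labels) ∨
    (j ∈ A3 m w n ∧ ∃ r ∈ C, r ∈ A4 m w n ∧ (G r).worker = (G j).worker)

/-- Together with few other queries `K` of the graph, the query `j` forms a loop: the excess grows if
`K` is added to any set without `j`. Since this set is arbitrary, the loops of two queries that are
removed one after the other add up. -/
def Costly (G : Design m w n) (i : Fin m) (C : Finset (Fin n)) (j : Fin n) : Prop :=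
  ∃ K ⊆ C ∪ A2 m n, K.card ≤ 4 ∧ ∀ T : Finset (Fin n), j ∉ T →
    excess G i T + 1 ≤ excess G i (K ∪ T)

theorem cost_le_one (j : Fin n) : cost w m j ≤ 1 := by
  unfold cost
  split_ifs <;> simp

theorem disjoint_A3_A4 {j : Fin n} (h : j ∈ A3 m w n) : j ∉ A4 m w n := by
  rw [mem_A3] at h
  rw [mem_A4]
  omega

theorem not_mem_A2_of_mem_A3 {j : Fin n} (h : j ∈ A3 m w n) : j ∉ A2 m n := by
  rw [mem_A3] at h
  rw [mem_A2]
  omega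

theorem not_mem_A2_of_mem_A4 {j : Fin n} (h : j ∈ A4 m w n) : j ∉ A2 m n := by
  rw [mem_A4] at h
  rw [mem_A2]
  omega

section Moves

variable {G : Design m w n} {i : Fin m} {C T : Finset (Fin n)} {j q : Fin n} {a b : Fin m}

theorem Rooted.not_mem_A2 (hC : Rooted G i C) (hj : j ∈ C) : j ∉ A2 m n := by
  rcases hC j hj with h | h
  · exact not_mem_A2_of_mem_A4 h.1
  · exact not_mem_A2_of_mem_A3 h.1

theorem kids_subset (j : Fin n) : kids G i j ⊆ (G j).labels := by
  unfold kids
  split_ifs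
  · exact Finset.erase_subset _ _
  · exact subset_rfl

/-- Adding a query of the second set that shares a label does not lower the excess. -/
theorem excess_le_insert (ha : a ∈ (G q).labels) (ha' : a ∈ seen G i T) :
    excess G i T ≤ excess G i (insert q T) := by
  by_cases hq : q ∈ T
  · rw [Finset.insert_eq_of_mem hq]
  · rw [excess_insert G i hq]
    have h1 : 0 < ((G q).labels ∩ seen G i T).card :=
      Finset.card_pos.2 ⟨a, Finset.mem_inter.2 ⟨ha, ha'⟩⟩
    have := cost_le_one (w := w) (m := m) q
    omega

/-- Adding a query of the second set that shares two labels closes a loop. -/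
theorem excess_lt_insert (hq : q ∉ T) (hab : a ≠ b) (ha : a ∈ (G q).labels)
    (ha' : a ∈ seen G i T) (hb : b ∈ (G q).labels) (hb' : b ∈ seen G i T) :
    excess G i T + 1 ≤ excess G i (insert q T) := by
  rw [excess_insert G i hq]
  have h1 : 1 < ((G q).labels ∩ seen G i T).card :=
    Finset.one_lt_card.2 ⟨a, Finset.mem_inter.2 ⟨ha, ha'⟩, b, Finset.mem_inter.2 ⟨hb, hb'⟩, hab⟩
  have := cost_le_one (w := w) (m := m) q
  omega

theorem Rooted.excess_le_insert (hC : Rooted G i C) (hj : j ∈ C) :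
    excess G i T ≤ excess G i (insert j T) := by
  rcases hC j hj with h | h
  · exact XorQuery.excess_le_insert h.2 (Finset.mem_insert_self _ _)
  · by_cases hq : j ∈ T
    · rw [Finset.insert_eq_of_mem hq]
    · rw [excess_insert G i hq, cost, if_pos h.1]
      omega

/-- Adding a third- or fourth-set query one of whose lower labels is present closes a loop. -/
theorem Rooted.excess_lt_insert (hC : Rooted G i C) (hj : j ∈ C) (hT : j ∉ T)
    (ha : a ∈ kids G i j) (ha' : a ∈ seen G i T) :
    excess G i T + 1 ≤ excess G i (insert j T) := by
  rcases hC j hj with h | h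
  · have hai : a ≠ i := by
      rw [kids, if_pos h.1] at ha
      exact Finset.ne_of_mem_erase ha
    exact XorQuery.excess_lt_insert hT hai (kids_subset j ha) ha' h.2
      (Finset.mem_insert_self _ _)
  · rw [excess_insert G i hT, cost, if_pos h.1]
    have h1 : 0 < ((G j).labels ∩ seen G i T).card :=
      Finset.card_pos.2 ⟨a, Finset.mem_inter.2 ⟨kids_subset j ha, ha'⟩⟩
    omega

theorem seen_insert_of_mem (ha : a ∈ (G q).labels) : a ∈ seen G i (insert q T) :=
  labels_subset_seen G i (Finset.mem_insert_self _ _) ha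

theorem seen_insert_of_kids (ha : a ∈ kids G i j) : a ∈ seen G i (insert j T) :=
  seen_insert_of_mem (kids_subset j ha)

theorem seen_insert_of_seen (ha : a ∈ seen G i T) : a ∈ seen G i (insert q T) :=
  seen_mono G i (Finset.subset_insert _ _) ha

theorem mem_lower {S : Finset (Fin n)} : a ∈ lower G i S ↔ ∃ j ∈ S, a ∈ kids G i j := by
  simp [lower]

/-- The two queries of a bad pair and their common label form a loop with the root. -/
theorem costly_of_badPair (hC : Rooted G i C) (hj : j ∈ C) {j' : Fin n} (hj' : j' ∈ C)
    (h : BadPair G i j j') : Costly G i C j := by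
  obtain ⟨hne, hd⟩ := h
  obtain ⟨a, ha, ha'⟩ := Finset.not_disjoint_iff.1 hd
  refine ⟨{j, j'}, ?_, (Finset.card_le_two).trans (by norm_num), fun T hT => ?_⟩
  · simp [Finset.insert_subset_iff, hj, hj']
  · have h1 := hC.excess_le_insert (T := T) hj'
    have h2 := hC.excess_lt_insert (T := insert j' T) hj (by simp [hne, hT]) ha
      (seen_insert_of_kids ha')
    have h3 : ({j, j'} : Finset (Fin n)) ∪ T = insert j (insert j' T) := by ext; simp
    rw [h3]
    omega

/-- A second-set query with two connections closes a loop through the queries above its labels. -/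
theorem costly_of_aboveOneOfTwo (hC : Rooted G i C) (hj : j ∈ C) (hq : q ∈ A2 m n)
    (h : AboveOneOfTwo G i (lower G i C) j q) : Costly G i C j := by
  obtain ⟨a, ha, b, hb, hab⟩ := h
  rw [Finset.mem_inter] at ha hb
  obtain ⟨j', hj', hbj'⟩ := mem_lower.1 hb.2
  have hqj : j ≠ q := fun h => hC.not_mem_A2 hj (h ▸ hq)
  by_cases hjj : j' = j
  · subst hjj
    refine ⟨{j', q}, ?_, (Finset.card_le_two).trans (by norm_num), fun T hT => ?_⟩
    · simp [Finset.insert_subset_iff, hj, hq]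
    · by_cases hqT : q ∈ T
      · have h2 := hC.excess_lt_insert (T := T) hj hT ha.1 (labels_subset_seen G i hqT ha.2)
        have h3 : ({j', q} : Finset (Fin n)) ∪ T = insert j' T := by
          ext x
          simp only [Finset.mem_union, Finset.mem_insert, Finset.mem_singleton]
          grind
        rw [h3]
        exact h2
      · have h1 := hC.excess_le_insert (T := T) hj
        have h2 := excess_lt_insert (i := i) (T := insert j' T) (q := q)
          (by simp [hqT, Ne.symm hqj]) hab ha.2 (seen_insert_of_kids ha.1) hb.1
          (seen_insert_of_kids hbj')
        have h3 : ({j', q} : Finset (Fin n)) ∪ T = insert q (insert j' T) := by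
          ext x
          simp only [Finset.mem_union, Finset.mem_insert, Finset.mem_singleton]
          tauto
        rw [h3]
        omega
  · refine ⟨{j, q, j'}, ?_, (Finset.card_le_three).trans (by norm_num), fun T hT => ?_⟩
    · simp [Finset.insert_subset_iff, hj, hq, hj']
    · have h1 := hC.excess_le_insert (T := T) hj'
      have h2 := excess_le_insert (i := i) (T := insert j' T) hb.1 (seen_insert_of_kids hbj')
      have h3 := hC.excess_lt_insert (T := insert q (insert j' T)) hj
        (by simp [hqj, hT, Ne.symm hjj]) ha.1 (seen_insert_of_mem ha.2)
      have h4 : ({j, q, j'} : Finset (Fin n)) ∪ T = insert j (insert q (insert j' T)) := by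
        ext x
        simp
      rw [h4]
      omega

/-- A query above one of two second-set queries `q`, `q'` that share a label below them lies on a
loop: it closes through `q`, the shared label, `q'` and the parent of the label that connects `q'`
to the graph, unless `q` has two connections itself. -/
theorem costly_of_badPair2 (hC : Rooted G i C) (hj : j ∈ C) {q' : Fin n} (hq : q ∈ A2 m n)
    (hq' : q' ∈ A2 m n) (h : BadPair2 G (lower G i C) q q' ∨ BadPair2 G (lower G i C) q' q)
    (hab : Above G i j q) : Costly G i C j := by
  have h' : BadPair2 G (lower G i C) q q' := by
    rcases h with h | h
    · exact h
    · exact ⟨h.1.symm, fun hd => h.2 hd.symm⟩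
  obtain ⟨hne, hd⟩ := h'
  obtain ⟨c, hc, hc'⟩ := Finset.not_disjoint_iff.1 hd
  obtain ⟨a, ha, ha'⟩ := Finset.not_disjoint_iff.1 hab
  simp only [kids2, Finset.mem_filter, Finset.mem_inter] at hc hc'
  obtain ⟨hcq, b, ⟨hb, hbL⟩, hbc⟩ := hc
  obtain ⟨hcq', b', ⟨hb', hbL'⟩, hbc'⟩ := hc'
  by_cases hac : a = c
  · subst hac
    exact costly_of_aboveOneOfTwo hC hj hq
      ⟨a, Finset.mem_inter.2 ⟨ha, ha'⟩, b, Finset.mem_inter.2 ⟨hb, hbL⟩, hbc.symm⟩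
  have hqj : j ≠ q := fun h => hC.not_mem_A2 hj (h ▸ hq)
  have hqj' : j ≠ q' := fun h => hC.not_mem_A2 hj (h ▸ hq')
  obtain ⟨l, hl, hbl⟩ := mem_lower.1 hbL'
  by_cases hlj : l = j
  · subst hlj
    refine ⟨{l, q, q'}, ?_, (Finset.card_le_three).trans (by norm_num), fun T hT => ?_⟩
    · simp [Finset.insert_subset_iff, hj, hq, hq']
    by_cases hqT : q ∈ T
    · have h1 := excess_le_insert (i := i) (T := T) hcq' (labels_subset_seen G i hqT hcq)
      have h2 := hC.excess_lt_insert (T := insert q' T) hj (by simp [hT, hqj']) ha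
        (seen_insert_of_seen (labels_subset_seen G i hqT ha'))
      have h4 : ({l, q, q'} : Finset (Fin n)) ∪ T = insert l (insert q' T) := by
        ext x
        simp only [Finset.mem_union, Finset.mem_insert, Finset.mem_singleton]
        grind
      rw [h4]
      omega
    by_cases hqT' : q' ∈ T
    · have h1 := excess_le_insert (i := i) (T := T) hcq (labels_subset_seen G i hqT' hcq')
      have h2 := hC.excess_lt_insert (T := insert q T) hj (by simp [hT, hqj]) ha
        (seen_insert_of_mem ha')
      have h4 : ({l, q, q'} : Finset (Fin n)) ∪ T = insert l (insert q T) := by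
        ext x
        simp only [Finset.mem_union, Finset.mem_insert, Finset.mem_singleton]
        grind
      rw [h4]
      omega
    · have h1 := hC.excess_le_insert (T := T) hj
      have h2 := excess_le_insert (i := i) (T := insert l T) ha' (seen_insert_of_kids ha)
      have h3 := excess_lt_insert (i := i) (T := insert q (insert l T)) (q := q')
        (by simp [hqT', Ne.symm hqj', Ne.symm hne]) hbc' hb'
        (seen_insert_of_seen (seen_insert_of_kids hbl)) hcq' (seen_insert_of_mem hcq)
      have h4 : ({l, q, q'} : Finset (Fin n)) ∪ T = insert q' (insert q (insert l T)) := by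
        ext x
        simp only [Finset.mem_union, Finset.mem_insert, Finset.mem_singleton]
        tauto
      rw [h4]
      omega
  · refine ⟨{j, q, q', l}, ?_, Finset.card_le_four, fun T hT => ?_⟩
    · simp [Finset.insert_subset_iff, hj, hq, hq', hl]
    have h1 := hC.excess_le_insert (T := T) hl
    have h2 := excess_le_insert (i := i) (T := insert l T) hb' (seen_insert_of_kids hbl)
    have h3 := excess_le_insert (i := i) (T := insert q' (insert l T)) hcq
      (seen_insert_of_mem hcq')
    have h4 := hC.excess_lt_insert (T := insert q (insert q' (insert l T))) hj
      (by simp [hT, hqj, hqj', Ne.symm hlj]) ha (seen_insert_of_mem ha')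
    have h5 : ({j, q, q', l} : Finset (Fin n)) ∪ T =
        insert j (insert q (insert q' (insert l T))) := by
      ext x
      simp
    rw [h5]
    omega

/-- The workers' roots may be added to a set of large excess. -/
theorem crowded_of_excess (hC : Rooted G i C) {K : Finset (Fin n)} (hK : K ⊆ C ∪ A2 m n)
    (hcard : K.card ≤ 8) (h : 2 ≤ excess G i K) : Crowded G i := by
  classical
  have hr : ∀ j, ∃ r, j ∈ K → (j ∈ A3 m w n → r ∈ C ∧ r ∈ A4 m w n ∧
      (G r).worker = (G j).worker) ∧ (j ∉ A3 m w n → r = j) := by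
    intro j
    by_cases hj : j ∈ K ∧ j ∈ A3 m w n
    · rcases Finset.mem_union.1 (hK hj.1) with hc | hc
      · rcases hC j hc with h4 | ⟨-, r, hr⟩
        · exact absurd h4.1 (disjoint_A3_A4 hj.2)
        · exact ⟨r, fun _ => ⟨fun _ => hr, fun h => absurd hj.2 h⟩⟩
      · exact absurd hc (not_mem_A2_of_mem_A3 hj.2)
    · exact ⟨j, fun hjK => ⟨fun h => absurd ⟨hjK, h⟩ hj, fun _ => rfl⟩⟩
  choose r hr using hr
  have hmem : ∀ j ∈ K ∪ K.image r, j ∈ C ∪ A2 m n ∧ (j ∉ K → j ∈ C ∧ j ∈ A4 m w n) := by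
    intro j hj
    rcases Finset.mem_union.1 hj with h1 | h1
    · exact ⟨hK h1, fun h => absurd h1 h⟩
    · obtain ⟨l, hl, rfl⟩ := Finset.mem_image.1 h1
      by_cases h3 : l ∈ A3 m w n
      · have := (hr l hl).1 h3
        exact ⟨Finset.mem_union_left _ this.1, fun _ => ⟨this.1, this.2.1⟩⟩
      · rw [(hr l hl).2 h3]
        exact ⟨hK hl, fun h => absurd hl h⟩
  refine ⟨K ∪ K.image r, ?_, ?_, ?_, ?_⟩
  · have := Finset.card_union_le K (K.image r)
    have := Finset.card_image_le (s := K) (f := r)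
    omega
  · intro j hj
    rcases Finset.mem_union.1 (hmem j hj).1 with h1 | h1
    · rcases hC j h1 with h2 | h2
      · have := mem_A4.1 h2.1
        omega
      · have := mem_A3.1 h2.1
        omega
    · exact (mem_A2.1 h1).1
  · intro j hj h3
    have hjK : j ∈ K := by
      by_contra hjK
      exact disjoint_A3_A4 h3 ((hmem j hj).2 hjK).2
    have := (hr j hjK).1 h3
    exact ⟨r j, Finset.mem_union_right _ (Finset.mem_image_of_mem _ hjK),
      fun h => disjoint_A3_A4 h this.2.1, this.2.2⟩
  · have key : ∀ R : Finset (Fin n), (∀ l ∈ R, l ∈ K ∨ l ∈ C) →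
        excess G i K ≤ excess G i (K ∪ R) := by
      intro R
      induction R using Finset.induction_on with
      | empty => simp
      | insert l R _ ih =>
        intro hR
        have h1 := ih fun x hx => hR x (Finset.mem_insert_of_mem hx)
        rw [Finset.union_insert]
        rcases hR l (Finset.mem_insert_self _ _) with h2 | h2
        · rwa [Finset.insert_eq_of_mem (Finset.mem_union_left _ h2)]
        · exact h1.trans (hC.excess_le_insert h2)
    refine h.trans (key _ fun l hl => ?_)
    by_cases hlK : l ∈ K
    · exact .inl hlK
    · exact .inr ((hmem l (Finset.mem_union_right _ hl)).2 hlK).1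

/-- No query of `C`, or of what is left of it, lies on a loop. -/
def Clean (G : Design m w n) (i : Fin m) (C : Finset (Fin n)) : Prop :=
  ∀ C' ⊆ C, Rooted G i C' → ∀ j ∈ C', ¬ Costly G i C' j

/-- If there are no two loops, then the removal of any query on a loop leaves none. -/
theorem clean_erase (hG : ¬ Crowded G i) (hC : Rooted G i C) (hj : j ∈ C)
    (h : Costly G i C j) : Clean G i (C.erase j) := by
  rintro C' hC' hR j' hj' ⟨K', hK', hc', hT'⟩
  obtain ⟨K, hK, hc, hT⟩ := h
  refine hG (crowded_of_excess hC (K := K ∪ K') (Finset.union_subset hK (hK'.trans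
    (Finset.union_subset_union_left (hC'.trans (Finset.erase_subset _ _)))))
    ((Finset.card_union_le _ _).trans (by omega)) ?_)
  have h1 := hT' ∅ (by simp)
  rw [Finset.union_empty, excess_empty] at h1
  have h2 := hT K' fun hjK => by
    rcases Finset.mem_union.1 (hK' hjK) with h3 | h3
    · simpa using hC' h3
    · exact hC.not_mem_A2 hj h3
  omega

/-- A second-set query with three connections would close two loops. -/
theorem badness_le_two (hG : ¬ Crowded G i) (hC : Rooted G i C) {S : Finset (Fin n)}
    (hS : S ⊆ C) (hq : q ∈ A2 m n) : badness G (lower G i S) q ≤ 2 := by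
  by_contra hb
  obtain ⟨a, ha, b, hb, c, hc, hab, hac, hbc⟩ := Finset.two_lt_card.1 (not_le.1 hb)
  rw [Finset.mem_inter] at ha hb hc
  obtain ⟨j, hj, haj⟩ := mem_lower.1 ha.2
  obtain ⟨k, hk, hbk⟩ := mem_lower.1 hb.2
  obtain ⟨l, hl, hcl⟩ := mem_lower.1 hc.2
  have hqC : ∀ x ∈ S, q ≠ x := fun x hx h => hC.not_mem_A2 (hS hx) (h ▸ hq)
  refine hG (crowded_of_excess hC (K := {q, j, k, l}) ?_ (Finset.card_le_four.trans (by norm_num))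
    ?_)
  · simp [Finset.insert_subset_iff, hq, hS hj, hS hk, hS hl]
  · have h1 := hC.excess_le_insert (T := ∅) (hS hl)
    have h2 := hC.excess_le_insert (T := insert l ∅) (hS hk)
    have h3 := hC.excess_le_insert (T := insert k (insert l ∅)) (hS hj)
    rw [excess_empty] at h1
    have h4 := excess_insert G i (T := {j, k, l}) (j := q)
      (by simp [hqC _ hj, hqC _ hk, hqC _ hl])
    have h5 : 2 < ((G q).labels ∩ seen G i {j, k, l}).card :=
      Finset.two_lt_card.2 ⟨a, Finset.mem_inter.2 ⟨ha.1, seen_insert_of_kids haj⟩,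
        b, Finset.mem_inter.2 ⟨hb.1, seen_insert_of_seen (seen_insert_of_kids hbk)⟩,
        c, Finset.mem_inter.2 ⟨hc.1, seen_insert_of_seen (seen_insert_of_seen
          (labels_subset_seen G i (Finset.mem_singleton_self _) (kids_subset l hcl)))⟩,
        hab, hac, hbc⟩
    have := cost_le_one (w := w) (m := m) q
    simp only [insert_empty_eq] at h1 h2 h3
    omega

end Moves

end Excess

section Pruning

/-! ### Phase 0 succeeds if there are no two loops -/

variable {m w n : ℕ} {G : Design m w n} {i : Fin m}

theorem Prunes.subset {ι : Type} [DecidableEq ι] {cand : Finset ι → ι → Prop} {S T : Finset ι}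
    (h : Prunes cand S T) : T ⊆ S := by
  induction h with
  | done => exact subset_rfl
  | remove S T j _ _ _ ih => exact ih.trans (Finset.erase_subset _ _)

theorem Prunes.not_cand {ι : Type} [DecidableEq ι] {cand : Finset ι → ι → Prop} {S T : Finset ι}
    (h : Prunes cand S T) : ∀ j ∈ T, ¬ cand T j := by
  induction h with
  | done S h => exact h
  | remove S T j _ _ _ ih => exact ih

/-- At most one query has been removed from `S`, and if one has, then no loop is left. -/
def Lost (G : Design m w n) (i : Fin m) (B S S' : Finset (Fin n)) : Prop :=
  S' = S ∨ ∃ j ∈ S, S' = S.erase j ∧ Clean G i (B ∪ S')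

theorem Lost.card_le {B S S' : Finset (Fin n)} (h : Lost G i B S S') : (S \ S').card ≤ 1 := by
  rcases h with rfl | ⟨j, hj, rfl, -⟩
  · simp
  · have : S \ S.erase j ⊆ {j} := by
      intro x hx
      simp only [Finset.mem_sdiff, Finset.mem_erase, not_and, Finset.mem_singleton] at hx ⊢
      by_contra h
      exact hx.2 h hx.1
    simpa using Finset.card_le_card this

/-- A pruning step whose candidates lie on loops removes at most one query in total. -/
theorem Lost.step (hG : ¬ Crowded G i) {B S S' T : Finset (Fin n)}
    {cand : Finset (Fin n) → Fin n → Prop} (hS' : S' ⊆ S)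
    (hR : ∀ R ⊆ S, Rooted G i (B ∪ R)) (hB : Disjoint B S)
    (hc : ∀ R ⊆ S, ∀ j ∈ R, cand R j → Costly G i (B ∪ R) j)
    (h : Lost G i B S S') (hP : Prunes cand S' T) : Lost G i B S T := by
  have clean : ∀ R T, R ⊆ S → Clean G i (B ∪ R) → Prunes cand R T → T = R := by
    intro R T hRS hcl hP
    cases hP with
    | done => rfl
    | remove _ _ j hj hjc _ =>
      exact absurd (hc R hRS j hj hjc)
        (hcl _ subset_rfl (hR R hRS) j (Finset.mem_union_right _ hj))
  rcases h with rfl | ⟨j, hj, rfl, hcl⟩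
  · cases hP with
    | done => exact .inl rfl
    | remove _ _ j hj hjc hP =>
      have hcl : Clean G i (B ∪ S'.erase j) := by
        have : B ∪ S'.erase j = (B ∪ S').erase j := by
          rw [Finset.erase_union_distrib,
            Finset.erase_eq_of_notMem (Finset.disjoint_right.1 hB hj)]
        rw [this]
        exact clean_erase hG (hR _ subset_rfl) (Finset.mem_union_right _ hj)
          (hc _ subset_rfl j hj hjc)
      have := clean _ _ (Finset.erase_subset _ _) hcl hP
      subst this
      exact .inr ⟨j, hj, rfl, hcl⟩
  · have := clean _ _ hS' hcl hP
    subst this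
    exact .inr ⟨j, hj, rfl, hcl⟩

theorem lower_mono {S S' : Finset (Fin n)} (h : S ⊆ S') : lower G i S ⊆ lower G i S' :=
  Finset.biUnion_subset_biUnion_of_subset_left _ h

theorem AboveOneOfTwo.mono {L L' : Finset (Fin m)} (hL : L ⊆ L') {j q : Fin n}
    (h : AboveOneOfTwo G i L j q) : AboveOneOfTwo G i L' j q := by
  obtain ⟨a, ha, b, hb, hab⟩ := h
  exact ⟨a, ha, b, Finset.inter_subset_inter_left hL hb, hab⟩

theorem kids2_mono {L L' : Finset (Fin m)} (hL : L ⊆ L') (q : Fin n) :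
    kids2 G L q ⊆ kids2 G L' q := by
  intro a ha
  simp only [kids2, Finset.mem_filter] at ha ⊢
  obtain ⟨ha, b, hb, hab⟩ := ha
  exact ⟨ha, b, Finset.inter_subset_inter_left hL hb, hab⟩

theorem BadPair2.mono {L L' : Finset (Fin m)} (hL : L ⊆ L') {q q' : Fin n}
    (h : BadPair2 G L q q') : BadPair2 G L' q q' :=
  ⟨h.1, fun hd => h.2 (hd.mono (kids2_mono hL q) (kids2_mono hL q'))⟩

theorem mem_touching {L : Finset (Fin m)} {q : Fin n} :
    q ∈ touching G L ↔ q ∈ A2 m n ∧ ∃ a ∈ (G q).labels, a ∈ L := by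
  simp [touching, Finset.not_disjoint_iff]

/-- What is left when no step has anything to remove contains no loop. -/
theorem loopFree_of_not_cand {S₄ S₃ : Finset (Fin n)}
    (h1 : ∀ j ∈ S₄, ¬ candPair G i S₄ j) (h2 : ∀ j ∈ S₄, ¬ candBad G i S₄ j)
    (h3 : ∀ j ∈ S₄, ¬ candPair2 G i S₄ j) (h4 : ∀ j ∈ S₃, ¬ candMixedPair G i S₄ S₃ j)
    (h5 : ∀ j ∈ S₃, ¬ candMixedBad G i S₄ S₃ j) (h6 : ∀ j ∈ S₃, ¬ candPair G i S₃ j)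
    (h7 : ∀ j ∈ S₃, ¬ candMixedPair2 G i S₄ S₃ j) (h8 : ∀ j ∈ S₃, ¬ candBad G i S₃ j)
    (h9 : ∀ j ∈ S₃, ¬ candPair2 G i S₃ j) : LoopFree G i (S₄ ∪ S₃) := by
  have hlow : ∀ a, a ∈ lower G i (S₄ ∪ S₃) ↔ a ∈ lower G i S₄ ∨ a ∈ lower G i S₃ := by
    intro a
    simp only [mem_lower, Finset.mem_union, or_and_right, exists_or]
  have touch : ∀ (S : Finset (Fin n)) q a, q ∈ A2 m n → a ∈ (G q).labels → a ∈ lower G i S →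
      q ∈ touching G (lower G i S) := fun S q a hq ha hl => mem_touching.2 ⟨hq, a, ha, hl⟩
  have comm : ∀ {j j'}, BadPair G i j j' → BadPair G i j' j :=
    fun h => ⟨h.1.symm, fun hd => h.2 hd.symm⟩
  -- no second-set query has two connections
  have single : ∀ q ∈ A2 m n, ∀ a ∈ (G q).labels, ∀ b ∈ (G q).labels,
      a ∈ lower G i (S₄ ∪ S₃) → b ∈ lower G i (S₄ ∪ S₃) → a = b := by
    intro q hq a ha b hb ha' hb'
    by_contra hab
    rcases (hlow a).1 ha' with ha' | ha' <;> rcases (hlow b).1 hb' with hb' | hb'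
    · obtain ⟨j, hj, hja⟩ := mem_lower.1 ha'
      exact h2 j hj ⟨q, touch _ q a hq ha ha', a, Finset.mem_inter.2 ⟨hja, ha⟩, b,
        Finset.mem_inter.2 ⟨hb, hb'⟩, hab⟩
    · obtain ⟨j, hj, hjb⟩ := mem_lower.1 hb'
      exact h5 j hj ⟨q, touch _ q a hq ha ha', b, Finset.mem_inter.2 ⟨hjb, hb⟩, a,
        Finset.mem_inter.2 ⟨ha, ha'⟩, Ne.symm hab⟩
    · obtain ⟨j, hj, hja⟩ := mem_lower.1 ha'
      exact h5 j hj ⟨q, touch _ q b hq hb hb', a, Finset.mem_inter.2 ⟨hja, ha⟩, b,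
        Finset.mem_inter.2 ⟨hb, hb'⟩, hab⟩
    · obtain ⟨j, hj, hja⟩ := mem_lower.1 ha'
      exact h8 j hj ⟨q, touch _ q a hq ha ha', a, Finset.mem_inter.2 ⟨hja, ha⟩, b,
        Finset.mem_inter.2 ⟨hb, hb'⟩, hab⟩
  -- hence the labels below it may be computed in the graph of the set to which it is connected
  have kidsEq : ∀ S ⊆ S₄ ∪ S₃, ∀ q ∈ A2 m n, ∀ a ∈ (G q).labels, a ∈ lower G i S →
      kids2 G (lower G i (S₄ ∪ S₃)) q ⊆ kids2 G (lower G i S) q := by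
    intro S hS q hq a ha haS c hc
    simp only [kids2, Finset.mem_filter, Finset.mem_inter] at hc ⊢
    obtain ⟨hc, b, ⟨hb, hbL⟩, hbc⟩ := hc
    have := single q hq a ha b hb (lower_mono hS haS) hbL
    subst this
    exact ⟨hc, a, ⟨ha, haS⟩, hbc⟩
  have above : ∀ (S : Finset (Fin n)) (q : Fin n) (a : Fin m), a ∈ (G q).labels →
      a ∈ lower G i S → ∃ j ∈ S, Above G i j q := by
    intro S q a ha hl
    obtain ⟨j, hj, hja⟩ := mem_lower.1 hl
    exact ⟨j, hj, Finset.not_disjoint_iff.2 ⟨a, hja, ha⟩⟩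
  refine ⟨?_, ?_, ?_⟩
  · intro j hj j' hj' hb
    rcases Finset.mem_union.1 hj with h | h <;> rcases Finset.mem_union.1 hj' with h' | h'
    · exact h1 j h ⟨j', h', hb⟩
    · exact h4 j' h' ⟨j, h, comm hb⟩
    · exact h4 j h ⟨j', h', hb⟩
    · exact h6 j h ⟨j', h', hb⟩
  · intro q hq
    refine Finset.card_le_one.2 fun a ha b hb => ?_
    rw [Finset.mem_inter] at ha hb
    exact single q hq a ha.1 b hb.1 ha.2 hb.2
  · have main : ∀ q ∈ A2 m n, ∀ q' ∈ A2 m n, ∀ a ∈ (G q).labels, ∀ a' ∈ (G q').labels,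
        BadPair2 G (lower G i (S₄ ∪ S₃)) q q' →
        (a ∈ lower G i S₄ → a' ∈ lower G i S₄ → False) ∧
        (a ∈ lower G i S₄ → a' ∈ lower G i S₃ → False) ∧
        (a ∈ lower G i S₃ → a' ∈ lower G i S₃ → False) := by
      intro q hq q' hq' a ha a' ha' hb
      refine ⟨fun hl hl' => ?_, fun hl hl' => ?_, fun hl hl' => ?_⟩
      · obtain ⟨j, hj, hab⟩ := above S₄ q a ha hl
        exact h3 j hj ⟨q, touch _ q a hq ha hl, q', touch _ q' a' hq' ha' hl',
          ⟨hb.1, fun hd => hb.2 (hd.mono (kidsEq _ Finset.subset_union_left q hq a ha hl)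
            (kidsEq _ Finset.subset_union_left q' hq' a' ha' hl'))⟩, hab⟩
      · obtain ⟨j, hj, hab⟩ := above S₃ q' a' ha' hl'
        exact h7 j hj ⟨q, touch _ q a hq ha hl, q', touch _ q' a' hq' ha' hl', hb, hab⟩
      · obtain ⟨j, hj, hab⟩ := above S₃ q a ha hl
        exact h9 j hj ⟨q, touch _ q a hq ha hl, q', touch _ q' a' hq' ha' hl',
          ⟨hb.1, fun hd => hb.2 (hd.mono (kidsEq _ Finset.subset_union_right q hq a ha hl)
            (kidsEq _ Finset.subset_union_right q' hq' a' ha' hl'))⟩, hab⟩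
    intro q hq q' hq' hb
    obtain ⟨hq2, a, ha, hal⟩ := mem_touching.1 hq
    obtain ⟨hq2', a', ha', hal'⟩ := mem_touching.1 hq'
    have hb' : BadPair2 G (lower G i (S₄ ∪ S₃)) q' q := ⟨hb.1.symm, fun hd => hb.2 hd.symm⟩
    have m1 := main q hq2 q' hq2' a ha a' ha' hb
    have m2 := main q' hq2' q hq2 a' ha' a ha hb'
    rcases (hlow a).1 hal with h | h <;> rcases (hlow a').1 hal' with h' | h'
    · exact m1.1 h h'
    · exact m1.2.1 h h'
    · exact m2.2.1 h' h
    · exact m1.2.2 h h'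

theorem costly_of_candPair {C S : Finset (Fin n)} (hC : Rooted G i C) (hS : S ⊆ C) {j : Fin n}
    (hj : j ∈ C) (h : candPair G i S j) : Costly G i C j := by
  obtain ⟨j', hj', hb⟩ := h
  exact costly_of_badPair hC hj (hS hj') hb

theorem costly_of_candBad {C S : Finset (Fin n)} (hC : Rooted G i C) (hS : S ⊆ C) {j : Fin n}
    (hj : j ∈ C) (h : candBad G i S j) : Costly G i C j := by
  obtain ⟨q, hq, hb⟩ := h
  exact costly_of_aboveOneOfTwo hC hj (mem_touching.1 hq).1 (hb.mono (lower_mono hS))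

theorem costly_of_candPair2 {C S : Finset (Fin n)} (hC : Rooted G i C) (hS : S ⊆ C) {j : Fin n}
    (hj : j ∈ C) (h : candPair2 G i S j) : Costly G i C j := by
  obtain ⟨q, hq, q', hq', hb, hab⟩ := h
  exact costly_of_badPair2 hC hj (mem_touching.1 hq).1 (mem_touching.1 hq').1
    (.inl (hb.mono (lower_mono hS))) hab

/-- If the graph of `i` has no two loops, then Phase 0 succeeds, whatever choices are made, and
leaves a graph without loops. -/
theorem Phase0.eq_some (hG : ¬ Crowded G i) {r : Option (Finset (Fin n) × Finset (Fin n))}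
    (h : Phase0 G i r) : ∃ S₄ S₃, r = some (S₄, S₃) ∧ S₄ ⊆ queries4 G i ∧ S₃ ⊆ queries3 G S₄ ∧
      (queries4 G i \ S₄).card ≤ 3 ∧ (queries3 G S₄ \ S₃).card ≤ 5 ∧
      ∀ j ∈ S₄ ∪ S₃, ∀ j' ∈ S₄ ∪ S₃, ¬ BadPair G i j j' := by
  obtain ⟨S₁, S₂, S₄, T₁, T₂, T₃, T₄, T₅, S₃, p1, p2, p3, p4, p5, p6, p7, p8, p9⟩ := h
  have hq4 : ∀ j ∈ queries4 G i, j ∈ A4 m w n ∧ i ∈ (G j).labels := fun j hj =>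
    Finset.mem_filter.1 hj
  have s1 := p1.subset
  have s2 := p2.subset.trans s1
  have s3 := p3.subset.trans s2
  have t1 := p4.subset
  have t2 := p5.subset.trans t1
  have t3 := p6.subset.trans t2
  have t4 := p7.subset.trans t3
  have t5 := p8.subset.trans t4
  have t6 := p9.subset.trans t5
  have R4 : ∀ R ⊆ queries4 G i, Rooted G i (∅ ∪ R) := by
    intro R hR j hj
    rw [Finset.empty_union] at hj
    exact .inl (hq4 j (hR hj))
  have R3 : ∀ R ⊆ queries3 G S₄, Rooted G i (S₄ ∪ R) := by
    intro R hR j hj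
    rcases Finset.mem_union.1 hj with h | h
    · exact .inl (hq4 j (s3 h))
    · right
      obtain ⟨h3, hn⟩ := Finset.mem_filter.1 (hR h)
      obtain ⟨r, hr, hrj⟩ := Finset.mem_image.1 hn
      exact ⟨h3, r, Finset.mem_union_left _ hr, (hq4 r (s3 hr)).1, congrArg Prod.fst hrj⟩
  have hdis : Disjoint S₄ (queries3 G S₄) := Finset.disjoint_left.2 fun j hj hj3 =>
    disjoint_A3_A4 (Finset.mem_filter.1 hj3).1 (hq4 j (s3 hj)).1
  have sub : ∀ {B R : Finset (Fin n)}, R ⊆ B ∪ R := fun {_ _} => Finset.subset_union_right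
  have l1 : Lost G i ∅ (queries4 G i) S₁ := Lost.step hG subset_rfl R4 (Finset.disjoint_empty_left _)
    (fun R hR j hj hc => costly_of_candPair (R4 R hR) sub (sub hj) hc) (.inl rfl) p1
  have l2 := Lost.step hG s1 R4 (Finset.disjoint_empty_left _)
    (fun R hR j hj hc => costly_of_candBad (R4 R hR) sub (sub hj) hc) l1 p2
  have l3 := Lost.step hG s2 R4 (Finset.disjoint_empty_left _)
    (fun R hR j hj hc => costly_of_candPair2 (R4 R hR) sub (sub hj) hc) l2 p3
  have k1 : Lost G i S₄ (queries3 G S₄) T₁ := by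
    refine Lost.step hG subset_rfl R3 hdis (fun R hR j hj hc => ?_) (.inl rfl) p4
    obtain ⟨j', hj', hb⟩ := hc
    exact costly_of_badPair (R3 R hR) (sub hj) (Finset.mem_union_left _ hj') hb
  have k2 : Lost G i S₄ (queries3 G S₄) T₂ := by
    refine Lost.step hG t1 R3 hdis (fun R hR j hj hc => ?_) k1 p5
    obtain ⟨q, hq, hb⟩ := hc
    exact costly_of_aboveOneOfTwo (R3 R hR) (sub hj) (mem_touching.1 hq).1
      (hb.mono (lower_mono Finset.subset_union_left))
  have k3 := Lost.step hG t2 R3 hdis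
    (fun R hR j hj hc => costly_of_candPair (R3 R hR) sub (sub hj) hc) k2 p6
  have k4 : Lost G i S₄ (queries3 G S₄) T₄ := by
    refine Lost.step hG t3 R3 hdis (fun R hR j hj hc => ?_) k3 p7
    obtain ⟨q, hq, q', hq', hb, hab⟩ := hc
    exact costly_of_badPair2 (R3 R hR) (sub hj) (mem_touching.1 hq').1 (mem_touching.1 hq).1
      (.inr hb) hab
  have k5 := Lost.step hG t4 R3 hdis
    (fun R hR j hj hc => costly_of_candBad (R3 R hR) sub (sub hj) hc) k4 p8
  have k6 := Lost.step hG t5 R3 hdis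
    (fun R hR j hj hc => costly_of_candPair2 (R3 R hR) sub (sub hj) hc) k5 p9
  have c1 : (queries4 G i \ S₄).card ≤ 3 := l3.card_le.trans (by norm_num)
  have c2 : (queries3 G S₄ \ S₃).card ≤ 5 := k6.card_le.trans (by norm_num)
  -- the candidates of each step only become fewer in the later steps
  have mono : ∀ {R R' : Finset (Fin n)}, R ⊆ R' → (∀ j ∈ R', ¬ candPair G i R' j) →
      ∀ j ∈ R, ¬ candPair G i R j := fun {R R'} hR h j hj ⟨j', hj', hb⟩ =>
    h j (hR hj) ⟨j', hR hj', hb⟩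
  have tmono : ∀ {R R' : Finset (Fin n)}, R ⊆ R' →
      touching G (lower G i R) ⊆ touching G (lower G i R') := fun {R R'} hR q hq => by
    obtain ⟨h2, a, ha, hl⟩ := mem_touching.1 hq
    exact mem_touching.2 ⟨h2, a, ha, lower_mono hR hl⟩
  have bmono : ∀ {R R' : Finset (Fin n)}, R ⊆ R' → (∀ j ∈ R', ¬ candBad G i R' j) →
      ∀ j ∈ R, ¬ candBad G i R j := fun {R R'} hR h j hj ⟨q, hq, hb⟩ =>
    h j (hR hj) ⟨q, tmono hR hq, hb.mono (lower_mono hR)⟩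
  have hloop : LoopFree G i (S₄ ∪ S₃) := loopFree_of_not_cand
    (mono (p3.subset.trans p2.subset) p1.not_cand) (bmono p3.subset p2.not_cand) p3.not_cand
    (fun j hj => p4.not_cand j (p5.subset (p6.subset (p7.subset (p8.subset (p9.subset hj))))))
    (fun j hj => p5.not_cand j (p6.subset (p7.subset (p8.subset (p9.subset hj)))))
    (mono (p9.subset.trans (p8.subset.trans p7.subset)) p6.not_cand)
    (fun j hj ⟨q, hq, q', hq', hb, hab⟩ => p7.not_cand j (p8.subset (p9.subset hj))
      ⟨q, hq, q', tmono (p9.subset.trans p8.subset) hq',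
        hb.mono (lower_mono (Finset.union_subset_union_right (p9.subset.trans p8.subset))), hab⟩)
    (bmono p9.subset p8.not_cand) p9.not_cand
  have b1 : ∀ q ∈ touching G (lower G i S₁), badness G (lower G i S₁) q ≤ 2 := fun q hq =>
    badness_le_two hG (R4 S₁ s1) sub (mem_touching.1 hq).1
  have b2 : ∀ q ∈ touching G (lower G i T₄), badness G (lower G i T₄) q ≤ 2 := fun q hq =>
    badness_le_two hG (R3 T₄ t4) sub (mem_touching.1 hq).1
  exact ⟨S₄, S₃, if_pos ⟨b1, b2, c1, c2, hloop⟩, s3, t6, c1, c2, hloop.1⟩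

end Pruning

section LabelSets

/-! ### The probability of two loops -/

/-- The design that is part of an outcome, apart from the coins. -/
def designOf {m w n : ℕ} (ω : Fin n → Query m w × Bool) : Design m w n := fun j => (ω j).1

/-- The probability that a random `d`-element set contains `a` given elements is at most
`(d / m) ^ a`. -/
theorem choose_sub_mul_pow_le {m d : ℕ} (hd : d ≤ m) (a : ℕ) (ha : a ≤ d) :
    (m - a).choose (d - a) * m ^ a ≤ m.choose d * d ^ a := by
  induction a with
  | zero => simp
  | succ a ih =>
    have ih := ih (by omega)
    have h1 : (m - a) * (m - (a + 1)).choose (d - (a + 1)) = (m - a).choose (d - a) * (d - a) := by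
      have := Nat.add_one_mul_choose_eq (m - (a + 1)) (d - (a + 1))
      have e1 : m - (a + 1) + 1 = m - a := by omega
      have e2 : d - (a + 1) + 1 = d - a := by omega
      rwa [e1, e2] at this
    have h2 : m * (d - a) ≤ d * (m - a) := by
      rw [Nat.mul_sub, Nat.mul_sub, Nat.mul_comm d m]
      have := Nat.mul_le_mul_right a hd
      omega
    refine Nat.le_of_mul_le_mul_left ?_ (show 0 < m - a by omega)
    calc (m - a) * ((m - (a + 1)).choose (d - (a + 1)) * m ^ (a + 1))
        = ((m - a) * (m - (a + 1)).choose (d - (a + 1))) * (m * m ^ a) := by ring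
      _ = ((m - a).choose (d - a) * m ^ a) * (m * (d - a)) := by rw [h1]; ring
      _ ≤ (m.choose d * d ^ a) * (d * (m - a)) := Nat.mul_le_mul ih h2
      _ = (m - a) * (m.choose d * d ^ (a + 1)) := by ring

theorem card_superset_mul_pow_le {m d : ℕ} (hd : d ≤ m) (A : Finset (Fin m)) :
    ((Finset.powersetCard d Finset.univ).filter (A ⊆ ·)).card * m ^ A.card ≤
      m.choose d * d ^ A.card := by
  by_cases ha : A.card ≤ d
  · refine le_trans (Nat.mul_le_mul_right _ ?_) (choose_sub_mul_pow_le hd A.card ha)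
    have : (m - A.card).choose (d - A.card) =
        (Finset.powersetCard (d - A.card) (Finset.univ \ A)).card := by
      rw [Finset.card_powersetCard, Finset.card_sdiff_of_subset (Finset.subset_univ _),
        Finset.card_univ, Fintype.card_fin]
    rw [this]
    refine Finset.card_le_card_of_injOn (· \ A) ?_ ?_
    · intro S hS
      simp only [Finset.coe_filter, Set.mem_ofPred_eq, Finset.mem_powersetCard] at hS
      simp only [Finset.mem_coe, Finset.mem_powersetCard]
      exact ⟨Finset.sdiff_subset_sdiff (Finset.subset_univ _) subset_rfl,
        by rw [Finset.card_sdiff_of_subset hS.2, hS.1.2]⟩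
    · intro S hS S' hS' h
      simp only [Finset.coe_filter, Set.mem_ofPred_eq] at hS hS'
      have h' : S \ A = S' \ A := h
      rw [← Finset.sdiff_union_of_subset hS.2, ← Finset.sdiff_union_of_subset hS'.2, h']
  · have : (Finset.powersetCard d Finset.univ).filter (A ⊆ ·) = ∅ := by
      refine Finset.filter_eq_empty_iff.2 fun S hS h => ha ?_
      rw [← (Finset.mem_powersetCard.1 hS).2]
      exact Finset.card_le_card h
    simp [this]

/-- The number of labels of `U` in a random set has a bounded exponential moment even on the
scale `log m`. -/
theorem sum_pow_card_inter_le {m d : ℕ} (hd : d ≤ m) (U : Finset (Fin m)) :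
    ∑ S ∈ Finset.powersetCard d Finset.univ, (m : ℝ) ^ (S ∩ U).card ≤
      m.choose d * (1 + d : ℝ) ^ U.card := by
  have h1 : ∀ S : Finset (Fin m), (m : ℝ) ^ (S ∩ U).card ≤
      ∑ A ∈ U.powerset, if A ⊆ S then (m : ℝ) ^ A.card else 0 := by
    intro S
    refine le_trans ?_ (Finset.single_le_sum (fun A _ => by split_ifs <;> positivity)
      (Finset.mem_powerset.2 (Finset.inter_subset_right : S ∩ U ⊆ U)))
    rw [if_pos Finset.inter_subset_left]
  refine (Finset.sum_le_sum fun S _ => h1 S).trans ?_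
  rw [Finset.sum_comm]
  have h2 := Finset.sum_pow_mul_eq_add_pow (d : ℝ) 1 U
  rw [add_comm, ← h2, Finset.mul_sum]
  refine Finset.sum_le_sum fun A _ => ?_
  rw [← Finset.sum_filter, Finset.sum_const, nsmul_eq_mul, one_pow, mul_one]
  exact_mod_cast card_superset_mul_pow_le hd A

variable {m w n D : ℕ} [NeZero w] {Φ : PMF ℕ} {ε : Fin w → ℕ → unitInterval}

/-- One query contributes a bounded factor to the count of coincidences: a factor `m` for each of its
labels that lies in a given small set is compensated by the improbability of that. -/
theorem sum_weight_labels_worker_le (hΦ : Φ.support ⊆ Set.Icc 1 D) (hD : D ≤ m) (j : Fin n)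
    (hj : m ≤ (j : ℕ)) (U : Finset (Fin m)) (φ : Fin w → ℝ) (φ0 : ∀ k, 0 ≤ φ k) :
    ∑ x, weight m w n Φ ε j x * ((m : ℝ) ^ (x.1.labels ∩ U).card * φ x.1.worker) ≤
      (1 + D : ℝ) ^ U.card * ((w : ℝ)⁻¹ * ∑ k, φ k) := by
  rw [sum_weight_mul_of_le hΦ hD j hj]
  have hφ : 0 ≤ (w : ℝ)⁻¹ * ∑ k, φ k :=
    mul_nonneg (by positivity) (Finset.sum_nonneg fun k _ => φ0 k)
  have key : ∀ d ∈ Finset.Icc 1 D, ((m.choose d : ℝ)⁻¹ *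
        ∑ S ∈ Finset.powersetCard d (Finset.univ : Finset (Fin m)), (w : ℝ)⁻¹ * ∑ k : Fin w,
          ((1 - (ε k d : ℝ)) * ((m : ℝ) ^ (S ∩ U).card * φ k) +
            ε k d * ((m : ℝ) ^ (S ∩ U).card * φ k))) ≤
      (1 + D : ℝ) ^ U.card * ((w : ℝ)⁻¹ * ∑ k, φ k) := by
    intro d hd
    obtain ⟨-, hd⟩ := Finset.mem_Icc.1 hd
    have e1 : ∀ (S : Finset (Fin m)) k, (1 - (ε k d : ℝ)) * ((m : ℝ) ^ (S ∩ U).card * φ k) +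
        ε k d * ((m : ℝ) ^ (S ∩ U).card * φ k) = (m : ℝ) ^ (S ∩ U).card * φ k := fun S k => by
      ring
    simp only [e1, ← Finset.mul_sum, ← Finset.sum_mul, mul_left_comm ((w : ℝ)⁻¹)]
    rw [← mul_assoc]
    refine mul_le_mul_of_nonneg_right ?_ hφ
    have hc : (0 : ℝ) < m.choose d := by exact_mod_cast Nat.choose_pos (hd.trans hD)
    rw [inv_mul_le_iff₀ hc]
    refine (sum_pow_card_inter_le (hd.trans hD) U).trans ?_
    gcongr
  refine (Finset.sum_le_sum fun d hd =>
    mul_le_mul_of_nonneg_left (key d hd) ENNReal.toReal_nonneg).trans ?_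
  rw [← Finset.sum_mul, sum_degree hΦ, one_mul]

end LabelSets

section TwoLoops

/-- The number of coincidences of labels among the queries of `T`. -/
def overlaps {m w n : ℕ} (G : Design m w n) (i : Fin m) (T : Finset (Fin n)) : ℕ :=
  1 + ∑ j ∈ T, (G j).labels.card - (seen G i T).card

theorem card_seen_le {m w n : ℕ} (G : Design m w n) (i : Fin m) (T : Finset (Fin n)) :
    (seen G i T).card ≤ 1 + ∑ j ∈ T, (G j).labels.card := by
  have h1 := Finset.card_insert_le i (T.biUnion fun j => (G j).labels)
  have h2 := Finset.card_biUnion_le (s := T) (t := fun j => (G j).labels)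
  unfold seen
  omega

theorem overlaps_empty {m w n : ℕ} (G : Design m w n) (i : Fin m) : overlaps G i ∅ = 0 := by
  simp [overlaps, seen]

theorem overlaps_insert {m w n : ℕ} (G : Design m w n) (i : Fin m) {T : Finset (Fin n)}
    {j : Fin n} (hj : j ∉ T) :
    overlaps G i (insert j T) = overlaps G i T + ((G j).labels ∩ seen G i T).card := by
  have h := Finset.card_union_add_card_inter (G j).labels (seen G i T)
  have h2 := card_seen_le G i T
  have h3 := card_seen_le G i (insert j T)
  rw [Finset.sum_insert hj] at h3
  rw [overlaps, overlaps, Finset.sum_insert hj]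
  rw [seen_insert] at h3 ⊢
  omega

/-- All queries but those of the third set need one coincidence of labels for their connection. -/
theorem excess_eq {m w n : ℕ} (G : Design m w n) (i : Fin m) (T : Finset (Fin n)) :
    excess G i T = overlaps G i T - ((T.filter (· ∉ A3 m w n)).card : ℤ) := by
  have h2 := card_seen_le G i T
  have h3 : ∑ j ∈ T, (cost w m j : ℤ) = ((T.filter (· ∉ A3 m w n)).card : ℤ) := by
    rw [Finset.card_filter, Nat.cast_sum]
    refine Finset.sum_congr rfl fun j _ => ?_
    unfold cost
    split_ifs <;> simp
  rw [excess, overlaps, Finset.sum_sub_distrib, h3]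
  push_cast [h2]
  omega

theorem seen_congr {m w n : ℕ} {G G' : Design m w n} (i : Fin m) {T : Finset (Fin n)}
    (h : ∀ j ∈ T, G j = G' j) : seen G i T = seen G' i T := by
  unfold seen
  rw [Finset.biUnion_congr rfl fun j hj => by rw [h j hj]]

theorem overlaps_congr {m w n : ℕ} {G G' : Design m w n} (i : Fin m) {T : Finset (Fin n)}
    (h : ∀ j ∈ T, G j = G' j) : overlaps G i T = overlaps G' i T := by
  unfold overlaps
  rw [seen_congr i h, Finset.sum_congr rfl fun j hj => by rw [h j hj]]

theorem designOf_update {m w n : ℕ} (ω : Fin n → Query m w × Bool) {j l : Fin n} (h : l ≠ j)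
    (x : Query m w × Bool) : designOf (Function.update ω j x) l = designOf ω l := by
  rw [designOf, designOf, Function.update_of_ne h]

open Classical in
/-- The weight by which the coincidences of labels among the queries of `T` are counted; the cap on
the degrees makes it bounded. -/
def overlapWeight {m w n : ℕ} (D : ℕ) (i : Fin m) (T : Finset (Fin n))
    (ω : Fin n → Query m w × Bool) : ℝ :=
  if ∀ j ∈ T, (designOf ω j).labels.card ≤ D then (m : ℝ) ^ overlaps (designOf ω) i T else 0

/-- The weight by which it is counted that the query `j` shares its worker with a query of `T`. -/
def workerWeight {m w n : ℕ} (T : Finset (Fin n)) (ω : Fin n → Query m w × Bool)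
    (k : Fin w) : ℝ :=
  ∑ r ∈ T, if (designOf ω r).worker = k then (w : ℝ) else 0

theorem overlapWeight_nonneg {m w n : ℕ} (D : ℕ) (i : Fin m) (T : Finset (Fin n))
    (ω : Fin n → Query m w × Bool) : 0 ≤ overlapWeight D i T ω := by
  unfold overlapWeight
  split_ifs <;> positivity

theorem workerWeight_nonneg {m w n : ℕ} (T : Finset (Fin n)) (ω : Fin n → Query m w × Bool)
    (k : Fin w) : 0 ≤ workerWeight T ω k :=
  Finset.sum_nonneg fun r _ => by split_ifs <;> simp

theorem overlapWeight_insert_le {m w n : ℕ} (D : ℕ) (i : Fin m) {T : Finset (Fin n)} {j : Fin n}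
    (hj : j ∉ T) (ω : Fin n → Query m w × Bool) :
    overlapWeight D i (insert j T) ω ≤ overlapWeight D i T ω *
      (m : ℝ) ^ ((ω j).1.labels ∩ seen (designOf ω) i T).card := by
  by_cases h : ∀ l ∈ insert j T, (designOf ω l).labels.card ≤ D
  · have h' : ∀ l ∈ T, (designOf ω l).labels.card ≤ D := fun l hl =>
      h l (Finset.mem_insert_of_mem hl)
    rw [overlapWeight, if_pos h, overlapWeight, if_pos h', overlaps_insert _ _ hj, pow_add]
    rfl
  · rw [overlapWeight, if_neg h]
    exact mul_nonneg (overlapWeight_nonneg _ _ _ _) (by positivity)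

/-- The factor that each query contributes to the count of crowded sets. -/
def queryFactor (D : ℕ) : ℝ := 16 * (1 + D : ℝ) ^ (1 + 16 * D)

theorem one_le_queryFactor (D : ℕ) : 1 ≤ queryFactor D := by
  have : (1 : ℝ) ≤ (1 + D : ℝ) ^ (1 + 16 * D) := one_le_pow₀ (by simp)
  unfold queryFactor
  linarith

theorem card_seen_le_of_overlapWeight_ne_zero {m w n D : ℕ} {i : Fin m} {T : Finset (Fin n)}
    {ω : Fin n → Query m w × Bool} (h : overlapWeight D i T ω ≠ 0) (hT : T.card ≤ 16) :
    (seen (designOf ω) i T).card ≤ 1 + 16 * D := by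
  unfold overlapWeight at h
  split_ifs at h with h'
  · have h1 := card_seen_le (designOf ω) i T
    have h2 := Finset.sum_le_card_nsmul T _ _ h'
    rw [smul_eq_mul] at h2
    have h3 := Nat.mul_le_mul_right D hT
    omega
  · exact absurd rfl h

theorem card_A3_le {m w n : ℕ} : (A3 m w n).card ≤ size3 m w := by
  have : size3 m w = ((Finset.Ico (m + size2 m) (m + size2 m + size3 m w))).card := by simp
  rw [this]
  refine Finset.card_le_card_of_injOn (fun j : Fin n => (j : ℕ)) ?_ ?_
  · intro j hj
    have := mem_A3.1 hj
    simpa using this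
  · exact fun a _ b _ h => Fin.ext h

variable {m w n D : ℕ} [NeZero w] {Φ : PMF ℕ} {ε : Fin w → ℕ → unitInterval}

theorem sum_workerWeight (T : Finset (Fin n)) (ω : Fin n → Query m w × Bool) :
    (w : ℝ)⁻¹ * ∑ k, workerWeight T ω k = T.card := by
  have hw : (w : ℝ) ≠ 0 := Nat.cast_ne_zero.2 (NeZero.ne w)
  simp only [workerWeight]
  rw [Finset.sum_comm]
  simp [mul_comm (w : ℝ)⁻¹, hw]

/-- The exponential moment of the number of coincidences on the scale `log m`; the queries of `T` are
added one after the other. -/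
theorem expect_overlapWeight_le (hΦ : Φ.support ⊆ Set.Icc 1 D) (hD : D ≤ m) (i : Fin m)
    (T : Finset (Fin n)) (hT : ∀ j ∈ T, m ≤ (j : ℕ)) (hc : T.card ≤ 16) :
    expect (weight m w n Φ ε) (overlapWeight D i T) ≤ queryFactor D ^ T.card := by
  induction T using Finset.induction_on with
  | empty =>
    have : overlapWeight (w := w) (n := n) D i ∅ = fun _ => 1 := by
      funext ω
      simp [overlapWeight, overlaps_empty]
    rw [this, expect_one sum_weight]
    simp
  | insert j T hj ih =>
    rw [Finset.card_insert_of_notMem hj] at hc ⊢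
    have ih := ih (fun l hl => hT l (Finset.mem_insert_of_mem hl)) (by omega)
    have h0 := one_le_queryFactor D
    refine (expect_mono weight_nonneg fun ω _ => overlapWeight_insert_le D i hj ω).trans ?_
    have h1 := expect_mul_prod_le (p := weight m w n Φ ε) weight_nonneg sum_weight {j}
      (overlapWeight D i T)
      (fun _ ω x => (m : ℝ) ^ (x.1.labels ∩ seen (designOf ω) i T).card) (fun _ => queryFactor D)
      (overlapWeight_nonneg D i T) (fun _ _ _ => by positivity) (fun _ => by positivity)
      ?_ ?_ ?_
    · simp only [Finset.prod_singleton] at h1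
      refine h1.trans ?_
      rw [pow_succ]
      exact mul_le_mul_of_nonneg_right ih (by positivity)
    · intro l hl ω x
      rw [Finset.mem_singleton] at hl
      subst hl
      have he : ∀ r ∈ T, designOf (Function.update ω l x) r = designOf ω r := fun r hr =>
        designOf_update ω (ne_of_mem_of_not_mem hr hj) x
      unfold overlapWeight
      rw [overlaps_congr i he]
      refine if_congr (forall₂_congr fun r hr => by rw [he r hr]) rfl rfl
    · intro q _ l hl ω x
      rw [Finset.mem_singleton] at hl
      subst hl
      have he : ∀ r ∈ T, designOf (Function.update ω l x) r = designOf ω r := fun r hr =>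
        designOf_update ω (ne_of_mem_of_not_mem hr hj) x
      rw [seen_congr i he]
    · intro q hq ω hω
      rw [Finset.mem_singleton] at hq
      subst hq
      have h2 := sum_weight_labels_worker_le (ε := ε) hΦ hD q (hT q (Finset.mem_insert_self _ _))
        (seen (designOf ω) i T) (fun _ => 1) (fun _ => zero_le_one)
      have hw : (w : ℝ) ≠ 0 := Nat.cast_ne_zero.2 (NeZero.ne w)
      simp only [mul_one, Finset.sum_const, Finset.card_univ, Fintype.card_fin, nsmul_eq_mul,
        inv_mul_cancel₀ hw] at h2
      refine h2.trans ?_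
      have h3 : (1 + D : ℝ) ^ (seen (designOf ω) i T).card ≤ (1 + D : ℝ) ^ (1 + 16 * D) :=
        pow_le_pow_right₀ (by simp) (card_seen_le_of_overlapWeight_ne_zero hω (by omega))
      have h4 : (0 : ℝ) ≤ (1 + D : ℝ) ^ (1 + 16 * D) := by positivity
      unfold queryFactor
      linarith

/-- The third-set queries of a crowded set are connected by their workers to its other queries
`T`. -/
theorem expect_overlapWeight_mul_le (hΦ : Φ.support ⊆ Set.Icc 1 D) (hD : D ≤ m) (i : Fin m)
    (T R : Finset (Fin n)) (hT : ∀ j ∈ T, m ≤ (j : ℕ)) (hR : ∀ j ∈ R, m ≤ (j : ℕ))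
    (hTR : Disjoint T R) (hc : T.card + R.card ≤ 16) :
    expect (weight m w n Φ ε)
      (fun ω => overlapWeight D i (R ∪ T) ω * ∏ j ∈ R, workerWeight T ω (ω j).1.worker) ≤
      queryFactor D ^ (T.card + R.card) := by
  induction R using Finset.induction_on with
  | empty => simpa using expect_overlapWeight_le hΦ hD i T hT (by simpa using hc)
  | insert j R hj ih =>
    rw [Finset.card_insert_of_notMem hj] at hc ⊢
    rw [Finset.disjoint_insert_right] at hTR
    have ih := ih (fun l hl => hR l (Finset.mem_insert_of_mem hl)) hTR.2 (by omega)
    have h0 := one_le_queryFactor D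
    have hj' : j ∉ R ∪ T := by simp [hj, hTR.1]
    have hcard : (R ∪ T).card ≤ 16 := (Finset.card_union_le _ _).trans (by omega)
    set F : (Fin n → Query m w × Bool) → ℝ := fun ω =>
      overlapWeight D i (R ∪ T) ω * ∏ j ∈ R, workerWeight T ω (ω j).1.worker with hF
    have hP : ∀ ω : Fin n → Query m w × Bool, 0 ≤ ∏ j ∈ R, workerWeight T ω (ω j).1.worker :=
      fun ω => Finset.prod_nonneg fun _ _ => workerWeight_nonneg _ _ _
    have hF0 : ∀ ω, 0 ≤ F ω := fun ω => mul_nonneg (overlapWeight_nonneg _ _ _ _) (hP ω)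
    have hW : ∀ (ω : Fin n → Query m w × Bool) x,
        workerWeight T (Function.update ω j x) = workerWeight T ω := by
      intro ω x
      funext k
      unfold workerWeight
      refine Finset.sum_congr rfl fun r hr => ?_
      rw [designOf_update ω (ne_of_mem_of_not_mem hr hTR.1)]
    have h1 := expect_mul_prod_le (p := weight m w n Φ ε) weight_nonneg sum_weight {j} F
      (fun _ ω x => (m : ℝ) ^ (x.1.labels ∩ seen (designOf ω) i (R ∪ T)).card *
        workerWeight T ω x.1.worker) (fun _ => queryFactor D)
      hF0 (fun _ _ _ => mul_nonneg (by positivity) (workerWeight_nonneg _ _ _))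
      (fun _ => by positivity) ?_ ?_ ?_
    · simp only [Finset.prod_singleton] at h1
      rw [← add_assoc, pow_succ]
      refine le_trans ?_ (h1.trans (mul_le_mul_of_nonneg_right ih (by positivity)))
      refine expect_mono weight_nonneg fun ω _ => ?_
      rw [Finset.prod_insert hj, Finset.insert_union]
      have h2 := mul_le_mul_of_nonneg_right (overlapWeight_insert_le D i hj' ω)
        (mul_nonneg (workerWeight_nonneg T ω (ω j).1.worker) (hP ω))
      refine h2.trans (le_of_eq ?_)
      rw [hF]
      ring
    · intro l hl ω x
      rw [Finset.mem_singleton] at hl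
      subst hl
      have he : ∀ r ∈ R ∪ T, designOf (Function.update ω l x) r = designOf ω r := fun r hr =>
        designOf_update ω (ne_of_mem_of_not_mem hr hj') x
      simp only [hF]
      congr 1
      · unfold overlapWeight
        rw [overlaps_congr i he]
        exact if_congr (forall₂_congr fun r hr => by rw [he r hr]) rfl rfl
      · refine Finset.prod_congr rfl fun r hr => ?_
        rw [hW, Function.update_of_ne (ne_of_mem_of_not_mem hr hj)]
    · intro q _ l hl ω x
      rw [Finset.mem_singleton] at hl
      subst hl
      have he : ∀ r ∈ R ∪ T, designOf (Function.update ω l x) r = designOf ω r := fun r hr =>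
        designOf_update ω (ne_of_mem_of_not_mem hr hj') x
      rw [seen_congr i he, hW]
    · intro q hq ω hω
      rw [Finset.mem_singleton] at hq
      subst hq
      have h2 := sum_weight_labels_worker_le (ε := ε) hΦ hD q (hR q (Finset.mem_insert_self _ _))
        (seen (designOf ω) i (R ∪ T)) (workerWeight T ω) (workerWeight_nonneg T ω)
      rw [sum_workerWeight] at h2
      refine h2.trans ?_
      have h3 : (1 + D : ℝ) ^ (seen (designOf ω) i (R ∪ T)).card ≤ (1 + D : ℝ) ^ (1 + 16 * D) :=
        pow_le_pow_right₀ (by simp)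
          (card_seen_le_of_overlapWeight_ne_zero (left_ne_zero_of_mul hω) hcard)
      have h5 : (T.card : ℝ) ≤ 16 := by exact_mod_cast (by omega : T.card ≤ 16)
      unfold queryFactor
      rw [mul_comm (16 : ℝ)]
      exact mul_le_mul h3 h5 (by positivity) (by positivity)

/-- First-moment bound: two loops in the graph of `i` are improbable. For a crowded set of `a` queries
outside the third set and `b` inside it, the labels coincide `a + 2` times and the workers `b` times;
the factors `17` are the numbers of values of `a` and `b`. -/
theorem pr_crowded_le (hΦ : Φ.support ⊆ Set.Icc 1 D) (hD : D ≤ m) (i : Fin m) :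
    pr (weight m w n Φ ε) {ω | Crowded (designOf ω) i} ≤
      17 * (17 * (queryFactor D ^ 16 * ((m : ℝ) ^ 2)⁻¹ * (1 + n / m : ℝ) ^ 16 *
        (1 + size3 m w / w : ℝ) ^ 16)) := by
  classical
  have hm0 : 0 < m := i.pos
  have hm : (0 : ℝ) < m := by exact_mod_cast hm0
  have hw : (0 : ℝ) < w := by exact_mod_cast Nat.pos_of_ne_zero (NeZero.ne w)
  set late : Finset (Fin n) := Finset.univ.filter fun j => m ≤ (j : ℕ) with hlate
  let E : Finset (Fin n) → Finset (Fin n) → Set (Fin n → Query m w × Bool) := fun T R =>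
    {ω | (m : ℝ) ^ (T.card + 2) * (w : ℝ) ^ R.card ≤
      overlapWeight D i (R ∪ T) ω * ∏ j ∈ R, workerWeight T ω (ω j).1.worker}
  have hE : ∀ T R : Finset (Fin n), T ⊆ late → R ⊆ late → Disjoint T R →
      T.card + R.card ≤ 16 → pr (weight m w n Φ ε) (E T R) ≤
        queryFactor D ^ 16 * ((m : ℝ) ^ (T.card + 2) * (w : ℝ) ^ R.card)⁻¹ := by
    intro T R hT hR hd hc
    have h1 := expect_overlapWeight_mul_le (ε := ε) hΦ hD i T R
      (fun j hj => (Finset.mem_filter.1 (hT hj)).2) (fun j hj => (Finset.mem_filter.1 (hR hj)).2)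
      hd hc
    have hpos : 0 < (m : ℝ) ^ (T.card + 2) * (w : ℝ) ^ R.card := by positivity
    have h2 : pr (weight m w n Φ ε) (E T R) ≤ expect (weight m w n Φ ε) (fun ω =>
        (overlapWeight D i (R ∪ T) ω * ∏ j ∈ R, workerWeight T ω (ω j).1.worker) *
        ((m : ℝ) ^ (T.card + 2) * (w : ℝ) ^ R.card)⁻¹) := by
      refine pr_le_expect weight_nonneg (fun ω => mul_nonneg (mul_nonneg
        (overlapWeight_nonneg _ _ _ _) (Finset.prod_nonneg fun _ _ => workerWeight_nonneg _ _ _))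
        (by positivity)) fun ω _ hω => ?_
      rw [← div_eq_mul_inv, one_le_div hpos]
      exact hω
    refine h2.trans ?_
    rw [expect_mul_const]
    refine mul_le_mul_of_nonneg_right (h1.trans ?_) (by positivity)
    exact pow_le_pow_right₀ (one_le_queryFactor D) hc
  have hsub : pr (weight m w n Φ ε) {ω | Crowded (designOf ω) i} ≤
      pr (weight m w n Φ ε) {ω | ∃ a ∈ Finset.range 17, ω ∈ {ω | ∃ b ∈ Finset.range 17,
        ω ∈ {ω | ∃ T ∈ Finset.powersetCard a late, ω ∈ {ω | ∃ R ∈ Finset.powersetCard b (A3 m w n),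
          ω ∈ {ω | T.card + R.card ≤ 16 ∧ Disjoint T R ∧ ω ∈ E T R}}}}} := by
    refine pr_mono weight_nonneg fun ω hω ⟨T, hc, hT, hroot, hex⟩ => ?_
    have hsplit := Finset.card_filter_add_card_filter_not (s := T) (· ∈ A3 m w n)
    refine ⟨(T.filter (· ∉ A3 m w n)).card, Finset.mem_range.2 (by omega),
      (T.filter (· ∈ A3 m w n)).card, Finset.mem_range.2 (by omega), T.filter (· ∉ A3 m w n),
      Finset.mem_powersetCard.2 ⟨fun j hj => Finset.mem_filter.2 ⟨Finset.mem_univ _,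
        hT j (Finset.mem_filter.1 hj).1⟩, rfl⟩, T.filter (· ∈ A3 m w n),
      Finset.mem_powersetCard.2 ⟨fun j hj => (Finset.mem_filter.1 hj).2, rfl⟩, by omega,
      (Finset.disjoint_filter_filter_not T T (· ∈ A3 m w n)).symm, ?_⟩
    have hU : T.filter (· ∈ A3 m w n) ∪ T.filter (· ∉ A3 m w n) = T :=
      Finset.filter_union_filter_not_eq _ _
    refine (?_ : (m : ℝ) ^ (_ + 2) * (w : ℝ) ^ _ ≤ overlapWeight D i (_ ∪ _) ω *
      ∏ j ∈ _, workerWeight _ ω (ω j).1.worker)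
    rw [hU]
    have hdeg : ∀ j ∈ T, (designOf ω j).labels.card ≤ D := fun j hj =>
      (Finset.mem_Icc.1 (degree_of_weight_ne_zero hΦ hD j (hT j hj) (ω j) (hω j)).1).2
    rw [overlapWeight, if_pos hdeg]
    rw [excess_eq] at hex
    have h1 : (m : ℝ) ^ ((T.filter (· ∉ A3 m w n)).card + 2) ≤
        (m : ℝ) ^ overlaps (designOf ω) i T :=
      pow_le_pow_right₀ (by exact_mod_cast hm0) (by omega)
    refine mul_le_mul h1 ?_ (by positivity) (by positivity)
    rw [← Finset.prod_const]
    refine Finset.prod_le_prod (fun _ _ => hw.le) fun j hj => ?_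
    obtain ⟨hjT, hj3⟩ := Finset.mem_filter.1 hj
    obtain ⟨r, hr, hr3, hrj⟩ := hroot j hjT hj3
    refine le_trans ?_ (Finset.single_le_sum (fun r _ => by split_ifs <;> simp)
      (Finset.mem_filter.2 ⟨hr, hr3⟩))
    exact (if_pos hrj).ge
  have hB : (0 : ℝ) ≤ queryFactor D := zero_le_one.trans (one_le_queryFactor D)
  set B : ℝ := queryFactor D ^ 16 * ((m : ℝ) ^ 2)⁻¹ * (1 + n / m : ℝ) ^ 16 *
    (1 + size3 m w / w : ℝ) ^ 16 with hBdef
  have hinner : ∀ a ∈ Finset.range 17, ∀ b ∈ Finset.range 17, pr (weight m w n Φ ε)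
      {ω | ∃ T ∈ Finset.powersetCard a late, ω ∈ {ω | ∃ R ∈ Finset.powersetCard b (A3 m w n),
          ω ∈ {ω | T.card + R.card ≤ 16 ∧ Disjoint T R ∧ ω ∈ E T R}}} ≤ B := by
    intro a ha b hb
    rw [Finset.mem_range] at ha hb
    refine (pr_exists_le weight_nonneg _ _).trans ?_
    have h1 : ∀ T ∈ Finset.powersetCard a late, pr (weight m w n Φ ε)
        {ω | ∃ R ∈ Finset.powersetCard b (A3 m w n),
          ω ∈ {ω | T.card + R.card ≤ 16 ∧ Disjoint T R ∧ ω ∈ E T R}} ≤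
        (size3 m w : ℝ) ^ b * (queryFactor D ^ 16 * ((m : ℝ) ^ (a + 2) * (w : ℝ) ^ b)⁻¹) := by
      intro T hT
      obtain ⟨hT, hTa⟩ := Finset.mem_powersetCard.1 hT
      refine (pr_exists_le weight_nonneg _ _).trans ?_
      have h2 : ∀ R ∈ Finset.powersetCard b (A3 m w n), pr (weight m w n Φ ε)
          {ω | T.card + R.card ≤ 16 ∧ Disjoint T R ∧ ω ∈ E T R} ≤
          queryFactor D ^ 16 * ((m : ℝ) ^ (a + 2) * (w : ℝ) ^ b)⁻¹ := by
        intro R hR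
        obtain ⟨hR, hRb⟩ := Finset.mem_powersetCard.1 hR
        by_cases hc : T.card + R.card ≤ 16 ∧ Disjoint T R
        · have hR' : R ⊆ late := fun j hj => Finset.mem_filter.2 ⟨Finset.mem_univ _, by
            have := mem_A3.1 (hR hj)
            omega⟩
          rw [← hTa, ← hRb]
          exact (pr_mono weight_nonneg fun ω _ h => h.2.2).trans (hE T R hT hR' hc.2 hc.1)
        · have : {ω | T.card + R.card ≤ 16 ∧ Disjoint T R ∧ ω ∈ E T R} = ∅ :=
            Set.eq_empty_of_forall_notMem fun ω h => hc ⟨h.1, h.2.1⟩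
          rw [this]
          simp only [pr, Set.indicator_empty, expect, mul_zero, Finset.sum_const_zero]
          positivity
      refine (Finset.sum_le_card_nsmul _ _ _ h2).trans ?_
      rw [nsmul_eq_mul]
      refine mul_le_mul_of_nonneg_right ?_ (by positivity)
      rw [Finset.card_powersetCard]
      have h3 : (A3 m w n).card.choose b ≤ size3 m w ^ b :=
        (Nat.choose_le_pow _ _).trans (Nat.pow_le_pow_left card_A3_le _)
      exact_mod_cast h3
    refine (Finset.sum_le_card_nsmul _ _ _ h1).trans ?_
    rw [nsmul_eq_mul, Finset.card_powersetCard]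
    have h4 : late.card.choose a ≤ n ^ a := by
      refine (Nat.choose_le_pow _ _).trans (Nat.pow_le_pow_left ?_ _)
      simpa using Finset.card_le_univ late
    have h4' : ((late.card.choose a : ℕ) : ℝ) ≤ (n : ℝ) ^ a := by exact_mod_cast h4
    refine (mul_le_mul_of_nonneg_right h4' (by positivity)).trans ?_
    have e : (n : ℝ) ^ a * ((size3 m w : ℝ) ^ b * (queryFactor D ^ 16 *
        ((m : ℝ) ^ (a + 2) * (w : ℝ) ^ b)⁻¹)) =
        queryFactor D ^ 16 * ((m : ℝ) ^ 2)⁻¹ * (n / m : ℝ) ^ a * (size3 m w / w : ℝ) ^ b := by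
      rw [div_pow, div_pow, pow_add]
      field_simp
    rw [e, hBdef]
    have p1 : (n / m : ℝ) ^ a ≤ (1 + n / m : ℝ) ^ 16 :=
      (pow_le_pow_left₀ (by positivity) (by linarith) _).trans
        (pow_le_pow_right₀ (le_add_of_nonneg_right (by positivity)) (by omega))
    have p2 : (size3 m w / w : ℝ) ^ b ≤ (1 + size3 m w / w : ℝ) ^ 16 :=
      (pow_le_pow_left₀ (by positivity) (by linarith) _).trans
        (pow_le_pow_right₀ (le_add_of_nonneg_right (by positivity)) (by omega))
    gcongr
  refine hsub.trans ((pr_exists_le weight_nonneg _ _).trans ?_)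
  refine (Finset.sum_le_card_nsmul _ _ (17 * B) fun a ha => ?_).trans (by simp)
  refine (pr_exists_le weight_nonneg _ _).trans ?_
  refine (Finset.sum_le_card_nsmul _ _ B fun b hb => hinner a ha b hb).trans (by simp)

end TwoLoops

/-! ### Products of signs over random label sets -/

/-- Choosing a set and then one of its elements amounts to choosing the element first. -/
theorem sum_powersetCard_succ_sum {α : Type*} [DecidableEq α] (V : Finset α) (k : ℕ)
    (f : α → Finset α → ℝ) :
    ∑ L ∈ Finset.powersetCard (k + 1) V, ∑ b ∈ L, f b (L.erase b) =
      ∑ b ∈ V, ∑ L ∈ Finset.powersetCard k (V.erase b), f b L := by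
  rw [Finset.sum_sigma', Finset.sum_sigma']
  refine Finset.sum_bij' (fun z _ => ⟨z.2, z.1.erase z.2⟩) (fun z _ => ⟨insert z.1 z.2, z.1⟩)
    ?_ ?_ ?_ ?_ ?_
  · rintro ⟨L, b⟩ h
    simp only [Finset.mem_sigma, Finset.mem_powersetCard] at h ⊢
    exact ⟨h.1.1 h.2, Finset.erase_subset_erase _ h.1.1, by
      rw [Finset.card_erase_of_mem h.2, h.1.2]
      rfl⟩
  · rintro ⟨b, L⟩ h
    simp only [Finset.mem_sigma, Finset.mem_powersetCard] at h ⊢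
    have hb : b ∉ L := fun hb => by simpa using h.2.1 hb
    exact ⟨⟨Finset.insert_subset h.1 (h.2.1.trans (Finset.erase_subset _ _)), by
      rw [Finset.card_insert_of_notMem hb, h.2.2]⟩, Finset.mem_insert_self _ _⟩
  · rintro ⟨L, b⟩ h
    simp only [Finset.mem_sigma, Finset.mem_powersetCard] at h
    simp [Finset.insert_erase h.2]
  · rintro ⟨b, L⟩ h
    simp only [Finset.mem_sigma, Finset.mem_powersetCard] at h
    have hb : b ∉ L := fun hb => by simpa using h.2.1 hb
    simp [Finset.erase_insert hb]
  · rintro ⟨L, b⟩ h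
    rfl

/-- The sum of the products of `e` over the `k`-element subsets of `V` is close to the value for
products over independent choices. -/
theorem abs_sum_prod_sub_pow_le {α : Type*} [DecidableEq α] (e : α → ℝ) (he : ∀ b, |e b| ≤ 1)
    (N : ℝ) (k : ℕ) (V : Finset α) (hV : (V.card : ℝ) ≤ N) :
    |(k.factorial : ℝ) * ∑ L ∈ Finset.powersetCard k V, ∏ b ∈ L, e b - (∑ b ∈ V, e b) ^ k| * N ≤
      (k : ℝ) ^ 2 * N ^ k := by
  induction k generalizing V with
  | zero => simp
  | succ k ih =>
    have hN : 0 ≤ N := (Nat.cast_nonneg _).trans hV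
    have h1 : ((k + 1).factorial : ℝ) * ∑ L ∈ Finset.powersetCard (k + 1) V, ∏ b ∈ L, e b =
        ∑ b ∈ V, e b * ((k.factorial : ℝ) *
          ∑ L ∈ Finset.powersetCard k (V.erase b), ∏ b ∈ L, e b) := by
      have h2 := sum_powersetCard_succ_sum V k (fun b L => e b * ∏ c ∈ L, e c)
      have h3 : ∑ L ∈ Finset.powersetCard (k + 1) V, ∑ b ∈ L, e b * ∏ c ∈ L.erase b, e c =
          (k + 1 : ℝ) * ∑ L ∈ Finset.powersetCard (k + 1) V, ∏ b ∈ L, e b := by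
        rw [Finset.mul_sum]
        refine Finset.sum_congr rfl fun L hL => ?_
        rw [Finset.sum_congr rfl fun b hb => Finset.mul_prod_erase L e hb, Finset.sum_const,
          (Finset.mem_powersetCard.1 hL).2, nsmul_eq_mul]
        push_cast
        ring
      rw [h3] at h2
      rw [Nat.factorial_succ]
      push_cast
      rw [mul_comm (k + 1 : ℝ), mul_assoc, h2, Finset.mul_sum]
      refine Finset.sum_congr rfl fun b _ => ?_
      rw [← Finset.mul_sum]
      ring
    have hS : ∀ W : Finset α, |∑ b ∈ W, e b| ≤ W.card := fun W =>
      (Finset.abs_sum_le_sum_abs _ _).trans ((Finset.sum_le_card_nsmul _ _ 1 fun b _ => he b).trans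
        (by simp))
    have hterm : ∀ b ∈ V, |(k.factorial : ℝ) * ∑ L ∈ Finset.powersetCard k (V.erase b),
        ∏ b ∈ L, e b - (∑ b ∈ V, e b) ^ k| * N ≤ ((k : ℝ) ^ 2 + k) * N ^ k := by
      intro b hb
      have hle : ((V.erase b).card : ℝ) ≤ N :=
        le_trans (by exact_mod_cast Finset.card_erase_le) hV
      have h4 := ih (V.erase b) hle
      have h5 : |(∑ c ∈ V.erase b, e c) ^ k - (∑ c ∈ V, e c) ^ k| * N ≤ k * N ^ k := by
        have h6 := abs_pow_sub_pow_le (∑ c ∈ V.erase b, e c) (∑ c ∈ V, e c) k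
        have h7 : |∑ c ∈ V.erase b, e c - ∑ c ∈ V, e c| ≤ 1 := by
          rw [← Finset.add_sum_erase V e hb, abs_sub_comm]
          simpa using he b
        have h8 : max |∑ c ∈ V.erase b, e c| |∑ c ∈ V, e c| ≤ N :=
          max_le ((hS _).trans hle) ((hS _).trans hV)
        rcases Nat.eq_zero_or_pos k with rfl | hk
        · simp
        calc |(∑ c ∈ V.erase b, e c) ^ k - (∑ c ∈ V, e c) ^ k| * N
            ≤ (1 * k * N ^ (k - 1)) * N := by
              refine mul_le_mul_of_nonneg_right (h6.trans ?_) hN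
              gcongr
          _ = k * N ^ k := by
              obtain ⟨l, rfl⟩ := Nat.exists_eq_succ_of_ne_zero hk.ne'
              simp only [Nat.succ_eq_add_one, Nat.add_sub_cancel, pow_succ]
              ring
      have h9 := mul_le_mul_of_nonneg_right (abs_sub_le
        ((k.factorial : ℝ) * ∑ L ∈ Finset.powersetCard k (V.erase b), ∏ b ∈ L, e b)
        ((∑ c ∈ V.erase b, e c) ^ k) ((∑ c ∈ V, e c) ^ k)) hN
      linarith
    have h10 : |((k + 1).factorial : ℝ) * ∑ L ∈ Finset.powersetCard (k + 1) V, ∏ b ∈ L, e b -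
        (∑ b ∈ V, e b) ^ (k + 1)| * N ≤ ∑ b ∈ V, |(k.factorial : ℝ) *
          ∑ L ∈ Finset.powersetCard k (V.erase b), ∏ b ∈ L, e b - (∑ b ∈ V, e b) ^ k| * N := by
      rw [h1, pow_succ', ← Finset.sum_mul, Finset.sum_mul V e, ← Finset.sum_sub_distrib]
      refine mul_le_mul_of_nonneg_right ((Finset.abs_sum_le_sum_abs _ _).trans ?_) hN
      refine Finset.sum_le_sum fun b _ => ?_
      rw [← mul_sub, abs_mul]
      exact mul_le_of_le_one_left (abs_nonneg _) (he b)
    refine h10.trans ((Finset.sum_le_card_nsmul _ _ _ hterm).trans ?_)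
    rw [nsmul_eq_mul]
    have h11 : (0 : ℝ) ≤ ((k : ℝ) ^ 2 + k) * N ^ k := by positivity
    calc (V.card : ℝ) * (((k : ℝ) ^ 2 + k) * N ^ k) ≤ N * (((k : ℝ) ^ 2 + k) * N ^ k) :=
          mul_le_mul_of_nonneg_right hV h11
      _ = ((k : ℝ) ^ 2 + k) * N ^ (k + 1) := by ring
      _ ≤ ((k + 1 : ℕ) : ℝ) ^ 2 * N ^ (k + 1) := by
          refine mul_le_mul_of_nonneg_right ?_ (by positivity)
          push_cast
          nlinarith [(Nat.cast_nonneg k : (0 : ℝ) ≤ k)]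

/-- A condition that holds for all large `m`: the corrections by which random label sets differ from
independent labels are small. -/
def LargeFor (D : ℕ) (ρ : ℝ) (m : ℕ) : Prop :=
  1 / (m : ℝ) ≤ ρ ∧ ∀ k ≤ D, (ρ / 2) ^ k ≤ (ρ - 1 / m) ^ k - (k : ℝ) ^ 2 / m

/-- If the mean of the signs `e` is at least `ρ`, then so is, up to constants, their mean product
over the other labels of a random label set that contains `a`. -/
theorem inv_choose_mul_sum_prod_ge {m D d : ℕ} {ρ : ℝ} (hm : LargeFor D ρ m) (hρ : 0 < ρ)
    (hd1 : 1 ≤ d) (hdD : d ≤ D) (hD : D ≤ m) (e : Fin m → ℝ) (he : ∀ b, |e b| ≤ 1)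
    (hmean : ρ * m ≤ ∑ b, e b) (a : Fin m) :
    (d : ℝ) / m * (ρ / 2) ^ (d - 1) ≤ (m.choose d : ℝ)⁻¹ *
      ∑ L ∈ Finset.powersetCard (d - 1) (Finset.univ.erase a), ∏ b ∈ L, e b := by
  have hm0 : (0 : ℝ) < m := by exact_mod_cast a.pos
  obtain ⟨hm1, hm2⟩ := hm
  set E := ∑ L ∈ Finset.powersetCard (d - 1) (Finset.univ.erase a), ∏ b ∈ L, e b with hE
  set S := ∑ b ∈ Finset.univ.erase a, e b with hS
  have h1 := abs_sum_prod_sub_pow_le e he m (d - 1) (Finset.univ.erase a) (by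
    exact_mod_cast (Finset.card_erase_le.trans (by simp)))
  have h2 : ρ * m - 1 ≤ S := by
    have h3 := Finset.add_sum_erase Finset.univ e (Finset.mem_univ a)
    have h4 := (abs_le.1 (he a)).2
    linarith
  have h5 : (ρ - 1 / m) * m ≤ S := by
    rw [sub_mul, div_mul_cancel₀ _ hm0.ne']
    exact h2
  have h6 : ((ρ - 1 / m) * m) ^ (d - 1) ≤ S ^ (d - 1) :=
    pow_le_pow_left₀ (mul_nonneg (by linarith) hm0.le) h5 _
  have h7 := (abs_le.1 ((le_div_iff₀ hm0).2 h1)).1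
  have h8 := hm2 (d - 1) (by omega)
  have h9 : (ρ / 2) ^ (d - 1) * (m : ℝ) ^ (d - 1) ≤ ((d - 1).factorial : ℝ) * E := by
    have h10 := mul_le_mul_of_nonneg_right h8 (show (0 : ℝ) ≤ (m : ℝ) ^ (d - 1) by positivity)
    rw [mul_pow] at h6
    have h11 : ((d - 1 : ℕ) : ℝ) ^ 2 / m * (m : ℝ) ^ (d - 1) =
        ((d - 1 : ℕ) : ℝ) ^ 2 * (m : ℝ) ^ (d - 1) / m := by ring
    linarith
  have hc : (0 : ℝ) < m.choose d := by exact_mod_cast Nat.choose_pos (hdD.trans hD)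
  have h12 : (m.choose d : ℝ) ≤ (m : ℝ) ^ d / d.factorial := Nat.choose_le_pow_div d m
  rw [le_inv_mul_iff₀ hc]
  obtain ⟨k, rfl⟩ : ∃ k, d = k + 1 := ⟨d - 1, by omega⟩
  simp only [Nat.add_sub_cancel] at h9 ⊢
  have hfac : (0 : ℝ) < (k.factorial : ℝ) := by exact_mod_cast k.factorial_pos
  calc (m.choose (k + 1) : ℝ) * (((k + 1 : ℕ) : ℝ) / m * (ρ / 2) ^ k)
      ≤ (m : ℝ) ^ (k + 1) / (k + 1).factorial * (((k + 1 : ℕ) : ℝ) / m * (ρ / 2) ^ k) :=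
        mul_le_mul_of_nonneg_right h12 (by positivity)
    _ = (ρ / 2) ^ k * (m : ℝ) ^ k / k.factorial := by
        rw [Nat.factorial_succ, pow_succ]
        push_cast
        field_simp
    _ ≤ E := by
        rw [div_le_iff₀ hfac, mul_comm E]
        exact h9

section SecondEstimates

/-! ### The second estimates -/

/-- The sign by which the noise multiplies an answer. -/
def noiseSign (b : Bool) : ℝ := if b then -1 else 1

theorem abs_noiseSign (b : Bool) : |noiseSign b| = 1 := by
  cases b <;> simp [noiseSign]

section Vote

variable {m w n : ℕ}

/-- The first estimate of the label `b`, relative to its true value. The value `1` for `b ≥ n` does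
not matter, as there are at least `m` queries. -/
def firstSign (ω : Fin n → Query m w × Bool) (b : Fin m) : ℝ :=
  if h : (b : ℕ) < n then noiseSign (ω ⟨b, h⟩).2 else 1

/-- The sum of the messages of the second-set queries to the label `a`, relative to its true
value. -/
def vote (ω : Fin n → Query m w × Bool) (a : Fin m) : ℝ :=
  ∑ q ∈ (A2 m n).filter fun q => a ∈ (ω q).1.labels,
    noiseSign (ω q).2 * ∏ b ∈ (ω q).1.labels.erase a, firstSign ω b

/-- The sum of the messages of one query to the labels in `A`, if `e` are the first estimates
relative to the true values. -/
def relay (e : Fin m → ℝ) (A : Finset (Fin m)) (x : Query m w × Bool) : ℝ :=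
  noiseSign x.2 * ∑ a ∈ A.filter (· ∈ x.1.labels), ∏ b ∈ x.1.labels.erase a, e b

theorem abs_firstSign (ω : Fin n → Query m w × Bool) (b : Fin m) : |firstSign ω b| ≤ 1 := by
  unfold firstSign
  split_ifs
  · rw [abs_noiseSign]
  · simp

theorem sum_vote (ω : Fin n → Query m w × Bool) (A : Finset (Fin m)) :
    ∑ a ∈ A, vote ω a = ∑ q ∈ A2 m n, relay (firstSign ω) A (ω q) := by
  simp only [vote, relay, Finset.sum_filter, Finset.mul_sum]
  rw [Finset.sum_comm]
  refine Finset.sum_congr rfl fun q _ => Finset.sum_congr rfl fun a _ => ?_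
  split_ifs <;> simp

theorem abs_relay_le {e : Fin m → ℝ} (he : ∀ b, |e b| ≤ 1) (A : Finset (Fin m))
    (x : Query m w × Bool) : |relay e A x| ≤ (A.filter (· ∈ x.1.labels)).card := by
  rw [relay, abs_mul, abs_noiseSign, one_mul]
  refine (Finset.abs_sum_le_sum_abs _ _).trans
    ((Finset.sum_le_card_nsmul _ _ 1 fun a _ => ?_).trans (by simp))
  rw [Finset.abs_prod]
  exact Finset.prod_le_one (fun b _ => abs_nonneg _) fun b _ => he b

theorem firstSign_update (ω : Fin n → Query m w × Bool) {j : Fin n} (hj : m ≤ (j : ℕ))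
    (x : Query m w × Bool) : firstSign (Function.update ω j x) = firstSign ω := by
  funext b
  unfold firstSign
  split_ifs with h
  · rw [Function.update_of_ne]
    intro hb
    have := congrArg Fin.val hb
    have := b.2
    simp only at *
    omega
  · rfl

theorem card_filter_mem_le (A : Finset (Fin m)) (S : Finset (Fin m)) :
    (A.filter (· ∈ S)).card ≤ S.card :=
  Finset.card_le_card fun _ h => (Finset.mem_filter.1 h).2

theorem inv_choose_mul_sum_card_inter {d : ℕ} (hd1 : 1 ≤ d) (hd : d ≤ m) (A : Finset (Fin m)) :
    (m.choose d : ℝ)⁻¹ * ∑ S ∈ Finset.powersetCard d (Finset.univ : Finset (Fin m)),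
      ((A.filter (· ∈ S)).card : ℝ) = A.card * d / m := by
  obtain ⟨k, rfl⟩ : ∃ k, d = k + 1 := ⟨d - 1, by omega⟩
  have h1 := sum_powersetCard_succ_sum (Finset.univ : Finset (Fin m)) k
    (fun b _ => if b ∈ A then 1 else 0)
  have h2 : ∀ S : Finset (Fin m), ((A.filter (· ∈ S)).card : ℝ) =
      ∑ b ∈ S, if b ∈ A then 1 else 0 := by
    intro S
    rw [← Finset.sum_filter, Finset.sum_const, nsmul_eq_mul, mul_one]
    congr 2
    ext
    simp [and_comm]
  simp only [h2, h1, Finset.sum_const, nsmul_eq_mul, Finset.card_powersetCard,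
    Finset.card_erase_of_mem (Finset.mem_univ _), Finset.card_univ, Fintype.card_fin]
  rw [← Finset.mul_sum, ← Finset.sum_filter, Finset.sum_const, nsmul_eq_mul, mul_one]
  have h3 : (m : ℝ) * (m - 1).choose k = m.choose (k + 1) * (k + 1 : ℕ) := by
    have := Nat.add_one_mul_choose_eq (m - 1) k
    rw [show m - 1 + 1 = m by omega] at this
    exact_mod_cast this
  have hc : (m.choose (k + 1) : ℝ) ≠ 0 := by exact_mod_cast (Nat.choose_pos hd).ne'
  have hm : (m : ℝ) ≠ 0 := by
    have : m ≠ 0 := by omega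
    exact_mod_cast this
  have h4 : (Finset.univ.filter (· ∈ A)) = A := by ext; simp
  rw [h4]
  field_simp
  linear_combination (A.card : ℝ) * h3

end Vote

variable {m w n D : ℕ} [NeZero w] {Φ : PMF ℕ} {ε : Fin w → ℕ → unitInterval}

/-- The mean number of labels of a query, each weighted by the advantage of its message over a
fair coin. -/
def advantage (w D : ℕ) (Φ : PMF ℕ) (ε : Fin w → ℕ → unitInterval) : ℝ :=
  ∑ d ∈ Finset.Icc 1 D, (d : ℝ) * (Φ d).toReal * ((w : ℝ)⁻¹ * ∑ k, (1 - 2 * (ε k d : ℝ)))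

/-- The mean of the messages of a random query to the labels in `A`. -/
theorem sum_weight_relay_ge (hΦ : Φ.support ⊆ Set.Icc 1 D) (hD : D ≤ m) {ρ : ℝ}
    (hm : LargeFor D ρ m) (hρ : 0 < ρ) (hρ2 : ρ ≤ 2) (hε : ∀ k, ∀ d ∈ Finset.Icc 1 D,
      (ε k d : ℝ) < 1 / 2) (j : Fin n) (hj : m ≤ (j : ℕ))
    {e : Fin m → ℝ} (he : ∀ b, |e b| ≤ 1) (hmean : ρ * m ≤ ∑ b, e b) (A : Finset (Fin m)) :
    (A.card : ℝ) / m * ((ρ / 2) ^ D * advantage w D Φ ε) ≤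
      ∑ x, weight m w n Φ ε j x * relay e A x := by
  rw [sum_weight_mul_of_le hΦ hD j hj, advantage, ← mul_assoc, Finset.mul_sum]
  refine Finset.sum_le_sum fun d hd => ?_
  obtain ⟨hd1, hdD⟩ := Finset.mem_Icc.1 hd
  have h1 : ∀ S ∈ Finset.powersetCard d (Finset.univ : Finset (Fin m)),
      (w : ℝ)⁻¹ * ∑ k : Fin w, ((1 - (ε k d : ℝ)) * relay e A (⟨S, k⟩, false) +
        ε k d * relay e A (⟨S, k⟩, true)) =
      ((w : ℝ)⁻¹ * ∑ k, (1 - 2 * (ε k d : ℝ))) *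
        ∑ b ∈ S, if b ∈ A then ∏ c ∈ S.erase b, e c else 0 := by
    intro S _
    have h2 : ∑ a ∈ A.filter (· ∈ S), ∏ b ∈ S.erase a, e b =
        ∑ b ∈ S, if b ∈ A then ∏ c ∈ S.erase b, e c else 0 := by
      rw [← Finset.sum_filter]
      refine Finset.sum_congr ?_ fun _ _ => rfl
      ext
      simp [and_comm]
    rw [mul_assoc, Finset.sum_mul, ← h2]
    congr 1
    refine Finset.sum_congr rfl fun k _ => ?_
    simp only [relay, noiseSign]
    simp
    ring
  rw [Finset.sum_congr rfl h1, ← Finset.mul_sum]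
  have h3 := sum_powersetCard_succ_sum (Finset.univ : Finset (Fin m)) (d - 1)
    (fun b L => if b ∈ A then ∏ c ∈ L, e c else 0)
  rw [Nat.sub_add_cancel hd1] at h3
  have h4 : ∑ b, ∑ L ∈ Finset.powersetCard (d - 1) (Finset.univ.erase b),
      (if b ∈ A then ∏ c ∈ L, e c else 0) =
      ∑ a ∈ A, ∑ L ∈ Finset.powersetCard (d - 1) (Finset.univ.erase a), ∏ c ∈ L, e c := by
    rw [← Finset.sum_subset (Finset.subset_univ A)]
    · exact Finset.sum_congr rfl fun a ha => by simp [ha]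
    · intro b _ hb
      simp [hb]
  rw [h3, h4, mul_left_comm (m.choose d : ℝ)⁻¹, Finset.mul_sum A]
  have hadv : 0 ≤ (w : ℝ)⁻¹ * ∑ k, (1 - 2 * (ε k d : ℝ)) :=
    mul_nonneg (by positivity) (Finset.sum_nonneg fun k _ => by linarith [hε k d hd])
  have h5 : (A.card : ℝ) * ((d : ℝ) / m * (ρ / 2) ^ (d - 1)) ≤ ∑ a ∈ A, (m.choose d : ℝ)⁻¹ *
      ∑ L ∈ Finset.powersetCard (d - 1) (Finset.univ.erase a), ∏ c ∈ L, e c := by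
    rw [← nsmul_eq_mul]
    exact Finset.card_nsmul_le_sum _ _ _ fun a _ =>
      inv_choose_mul_sum_prod_ge hm hρ hd1 hdD hD e he hmean a
  have h6 : (ρ / 2) ^ D ≤ (ρ / 2) ^ (d - 1) :=
    pow_le_pow_of_le_one (by positivity) (by linarith) (by omega)
  have hP : 0 ≤ (Φ d).toReal := ENNReal.toReal_nonneg
  calc (A.card : ℝ) / m * (ρ / 2) ^ D *
        ((d : ℝ) * (Φ d).toReal * ((w : ℝ)⁻¹ * ∑ k, (1 - 2 * (ε k d : ℝ))))
      = (Φ d).toReal * (((w : ℝ)⁻¹ * ∑ k, (1 - 2 * (ε k d : ℝ))) *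
          ((A.card : ℝ) * ((d : ℝ) / m * (ρ / 2) ^ D))) := by ring
    _ ≤ (Φ d).toReal * (((w : ℝ)⁻¹ * ∑ k, (1 - 2 * (ε k d : ℝ))) *
          ((A.card : ℝ) * ((d : ℝ) / m * (ρ / 2) ^ (d - 1)))) := by gcongr
    _ ≤ _ := by gcongr

theorem sum_weight_card_inter_le (hΦ : Φ.support ⊆ Set.Icc 1 D) (hD : D ≤ m) (j : Fin n)
    (hj : m ≤ (j : ℕ)) (A : Finset (Fin m)) :
    ∑ x, weight m w n Φ ε j x * ((A.filter (· ∈ x.1.labels)).card : ℝ) ≤ A.card / m * D := by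
  have hw : (w : ℝ) ≠ 0 := Nat.cast_ne_zero.2 (NeZero.ne w)
  rw [sum_weight_mul_of_le hΦ hD j hj]
  have h1 : ∀ d ∈ Finset.Icc 1 D, (Φ d).toReal * ((m.choose d : ℝ)⁻¹ *
      ∑ S ∈ Finset.powersetCard d (Finset.univ : Finset (Fin m)), (w : ℝ)⁻¹ * ∑ k : Fin w,
        ((1 - (ε k d : ℝ)) * ((A.filter (· ∈ S)).card : ℝ) +
          ε k d * ((A.filter (· ∈ S)).card : ℝ))) ≤ (Φ d).toReal * (A.card / m * D) := by
    intro d hd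
    obtain ⟨hd1, hdD⟩ := Finset.mem_Icc.1 hd
    refine mul_le_mul_of_nonneg_left ?_ ENNReal.toReal_nonneg
    have h2 : ∀ S : Finset (Fin m), (w : ℝ)⁻¹ * ∑ k : Fin w,
        ((1 - (ε k d : ℝ)) * ((A.filter (· ∈ S)).card : ℝ) +
          ε k d * ((A.filter (· ∈ S)).card : ℝ)) = ((A.filter (· ∈ S)).card : ℝ) := by
      intro S
      have : ∀ k : Fin w, (1 - (ε k d : ℝ)) * ((A.filter (· ∈ S)).card : ℝ) +
          ε k d * ((A.filter (· ∈ S)).card : ℝ) = ((A.filter (· ∈ S)).card : ℝ) := fun k => by ring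
      simp only [this, Finset.sum_const, Finset.card_univ, Fintype.card_fin, nsmul_eq_mul]
      rw [inv_mul_cancel_left₀ hw]
    simp only [h2]
    rw [inv_choose_mul_sum_card_inter hd1 (hdD.trans hD), mul_div_right_comm]
    have : (d : ℝ) ≤ D := by exact_mod_cast hdD
    gcongr
  refine (Finset.sum_le_sum h1).trans ?_
  rw [← Finset.sum_mul, sum_degree hΦ, one_mul]

/-- Given first estimates that are right on average, a random query gives each label of `A` a
positive drift. -/
theorem sum_weight_exp_relay_le (hΦ : Φ.support ⊆ Set.Icc 1 D) (hD : D ≤ m) {ρ v t : ℝ}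
    (hm : LargeFor D ρ m) (hρ : 0 < ρ) (hρ2 : ρ ≤ 2) (hε : ∀ k, ∀ d ∈ Finset.Icc 1 D,
      (ε k d : ℝ) < 1 / 2) (hv : v ≤ advantage w D Φ ε) (ht : 0 ≤ t) (ht1 : t * D ≤ 1) (j : Fin n)
    (hj : m ≤ (j : ℕ)) {e : Fin m → ℝ} (he : ∀ b, |e b| ≤ 1) (hmean : ρ * m ≤ ∑ b, e b)
    (A : Finset (Fin m)) :
    ∑ x, weight m w n Φ ε j x * Real.exp (-t * relay e A x) ≤
      Real.exp (-(A.card / m * (t * (ρ / 2) ^ D * v - t ^ 2 * D ^ 2))) := by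
  have h1 : ∑ x, weight m w n Φ ε j x * Real.exp (-t * relay e A x) ≤
      ∑ x, weight m w n Φ ε j x * (1 - t * relay e A x +
        t ^ 2 * D * (A.filter (· ∈ x.1.labels)).card) := by
    refine Finset.sum_le_sum fun x _ => ?_
    by_cases hx : weight m w n Φ ε j x = 0
    · simp [hx]
    refine mul_le_mul_of_nonneg_left ?_ (weight_nonneg j x)
    have hdeg := (Finset.mem_Icc.1 (degree_of_weight_ne_zero hΦ hD j hj x hx).1).2
    have h2 := abs_relay_le he A x
    have h3 : ((A.filter (· ∈ x.1.labels)).card : ℝ) ≤ D := by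
      exact_mod_cast (card_filter_mem_le A x.1.labels).trans hdeg
    have h4 : |-t * relay e A x| ≤ 1 := by
      rw [abs_mul, abs_neg, abs_of_nonneg ht]
      exact (mul_le_mul_of_nonneg_left (h2.trans h3) ht).trans ht1
    have h5 := (abs_le.1 (Real.abs_exp_sub_one_sub_id_le h4)).2
    have h6 : relay e A x ^ 2 ≤ D * (A.filter (· ∈ x.1.labels)).card := by
      rw [← sq_abs, sq]
      exact mul_le_mul (h2.trans h3) h2 (abs_nonneg _) (by positivity)
    have h7 := mul_le_mul_of_nonneg_left h6 (sq_nonneg t)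
    nlinarith
  have h2 : ∑ x, weight m w n Φ ε j x * (1 - t * relay e A x +
        t ^ 2 * D * (A.filter (· ∈ x.1.labels)).card) =
      ∑ x, weight m w n Φ ε j x - t * ∑ x, weight m w n Φ ε j x * relay e A x +
        t ^ 2 * D * ∑ x, weight m w n Φ ε j x * (A.filter (· ∈ x.1.labels)).card := by
    rw [Finset.mul_sum, Finset.mul_sum, ← Finset.sum_sub_distrib, ← Finset.sum_add_distrib]
    exact Finset.sum_congr rfl fun x _ => by ring
  have h3 := sum_weight_relay_ge (w := w) (ε := ε) hΦ hD hm hρ hρ2 hε j hj he hmean A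
  have h4 := sum_weight_card_inter_le (ε := ε) hΦ hD j hj A
  have h5 : (A.card : ℝ) / m * ((ρ / 2) ^ D * v) ≤
      ∑ x, weight m w n Φ ε j x * relay e A x := by
    refine le_trans ?_ h3
    gcongr
  rw [h2, sum_weight] at h1
  have h6 := Real.add_one_le_exp (-(A.card / m * (t * (ρ / 2) ^ D * v - t ^ 2 * D ^ 2)))
  have h7 := mul_le_mul_of_nonneg_left h5 ht
  have h8 := mul_le_mul_of_nonneg_left h4 (show 0 ≤ t ^ 2 * D by positivity)
  nlinarith

/-- Many wrong second estimates among the labels of a set that is independent of the second set of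
queries are improbable. The bound is a union bound over the sets of wrong labels; for a fixed set
the votes of all its labels are added, given the first estimates. -/
theorem pr_many_wrong_le (hΦ : Φ.support ⊆ Set.Icc 1 D) (hD : D ≤ m) {ρ v t : ℝ}
    (hm : LargeFor D ρ m) (hρ : 0 < ρ) (hρ2 : ρ ≤ 2) (hε : ∀ k, ∀ d ∈ Finset.Icc 1 D,
      (ε k d : ℝ) < 1 / 2) (hv : v ≤ advantage w D Φ ε) (ht : 0 ≤ t) (ht1 : t * D ≤ 1)
    (Λ : (Fin n → Query m w × Bool) → Finset (Fin m))
    (hΛ : ∀ j ∈ A2 m n, ∀ ω x, Λ (Function.update ω j x) = Λ ω) (K : ℕ) :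
    pr (weight m w n Φ ε) {ω | ρ * m ≤ ∑ b, firstSign ω b ∧
      K ≤ ((Λ ω).filter fun a => vote ω a ≤ 0).card} ≤
    expect (weight m w n Φ ε) (fun ω => 2 ^ (Λ ω).card) *
      Real.exp (-(K / m * (t * (ρ / 2) ^ D * v - t ^ 2 * D ^ 2))) ^ (A2 m n).card := by
  classical
  set β := Real.exp (-(K / m * (t * (ρ / 2) ^ D * v - t ^ 2 * D ^ 2))) with hβ
  let h : Finset (Fin m) → (Fin n → Query m w × Bool) → ℝ := fun A ω =>
    if A ⊆ Λ ω ∧ ρ * m ≤ ∑ b, firstSign ω b then 1 else 0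
  have h0 : ∀ A ω, 0 ≤ h A ω := fun A ω => by simp only [h]; split_ifs <;> simp
  have hA : ∀ A ∈ Finset.powersetCard K (Finset.univ : Finset (Fin m)),
      pr (weight m w n Φ ε) {ω | A ⊆ Λ ω ∧ ρ * m ≤ ∑ b, firstSign ω b ∧ ∀ a ∈ A, vote ω a ≤ 0} ≤
        expect (weight m w n Φ ε) (h A) * β ^ (A2 m n).card := by
    intro A hAK
    have hAK : A.card = K := (Finset.mem_powersetCard.1 hAK).2
    have h1 := expect_mul_prod_le (p := weight m w n Φ ε) weight_nonneg sum_weight (A2 m n) (h A)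
      (fun _ ω x => Real.exp (-t * relay (firstSign ω) A x)) (fun _ => β) (h0 A)
      (fun _ _ _ => (Real.exp_pos _).le) (fun _ => (Real.exp_pos _).le) ?_ ?_ ?_
    · rw [Finset.prod_const] at h1
      refine le_trans (pr_le_expect weight_nonneg (fun ω => mul_nonneg (h0 A ω)
        (Finset.prod_nonneg fun _ _ => (Real.exp_pos _).le)) ?_) h1
      rintro ω - ⟨hω1, hω2, hω3⟩
      simp only [h]
      rw [if_pos ⟨hω1, hω2⟩, one_mul, ← Real.exp_sum, ← Finset.mul_sum, ← sum_vote]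
      refine Real.one_le_exp ?_
      rw [neg_mul, neg_nonneg]
      exact mul_nonpos_of_nonneg_of_nonpos ht (Finset.sum_nonpos hω3)
    · intro j hj ω x
      simp only [h]
      rw [hΛ j hj, firstSign_update ω (mem_A2.1 hj).1]
    · intro q _ j hj ω x
      rw [firstSign_update ω (mem_A2.1 hj).1]
    · intro q hq ω hω
      have hω' : A ⊆ Λ ω ∧ ρ * m ≤ ∑ b, firstSign ω b := by
        by_contra hc
        exact hω (if_neg hc)
      rw [hβ, ← hAK]
      exact sum_weight_exp_relay_le hΦ hD hm hρ hρ2 hε hv ht ht1 q (mem_A2.1 hq).1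
        (abs_firstSign ω) hω'.2 A
  have h1 : pr (weight m w n Φ ε) {ω | ρ * m ≤ ∑ b, firstSign ω b ∧
      K ≤ ((Λ ω).filter fun a => vote ω a ≤ 0).card} ≤
      pr (weight m w n Φ ε) {ω | ∃ A ∈ Finset.powersetCard K (Finset.univ : Finset (Fin m)),
        ω ∈ {ω | A ⊆ Λ ω ∧ ρ * m ≤ ∑ b, firstSign ω b ∧ ∀ a ∈ A, vote ω a ≤ 0}} := by
    refine pr_mono weight_nonneg ?_
    rintro ω - ⟨hω1, hω2⟩
    obtain ⟨A, hA1, hA2⟩ := Finset.exists_subset_card_eq hω2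
    exact ⟨A, Finset.mem_powersetCard.2 ⟨Finset.subset_univ _, hA2⟩,
      hA1.trans (Finset.filter_subset _ _), hω1, fun a ha => (Finset.mem_filter.1 (hA1 ha)).2⟩
  refine h1.trans ((pr_exists_le weight_nonneg _ _).trans ((Finset.sum_le_sum hA).trans ?_))
  rw [← Finset.sum_mul, ← expect_sum]
  refine mul_le_mul_of_nonneg_right (expect_mono weight_nonneg fun ω _ => ?_) (by positivity)
  have h2 : ∑ A ∈ Finset.powersetCard K (Finset.univ : Finset (Fin m)), h A ω ≤
      ∑ A : Finset (Fin m), if A ∈ (Λ ω).powerset then (1 : ℝ) else 0 := by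
    refine (Finset.sum_le_sum_of_subset_of_nonneg (Finset.subset_univ _)
      fun A _ _ => h0 A ω).trans (Finset.sum_le_sum fun A _ => ?_)
    simp only [h, Finset.mem_powerset]
    split_ifs with h3 h4 h4
    · exact le_rfl
    · exact absurd h3.1 h4
    · exact zero_le_one
    · exact le_rfl
  refine h2.trans ?_
  rw [Finset.sum_ite_mem, Finset.univ_inter, Finset.sum_const, Finset.card_powerset, nsmul_eq_mul,
    mul_one]
  push_cast
  exact le_rfl

/-- The first estimates are right on average. -/
theorem pr_firstSign_le {p₁ ρ s : ℝ} (hmn : m ≤ n) (hp : (∑ k, (ε k 1 : ℝ)) / w ≤ p₁)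
    (hρ : 2 * ρ ≤ 1 - 2 * p₁) (hs : 0 ≤ s) (hs1 : s ≤ 1) :
    pr (weight m w n Φ ε) {ω | ¬ ρ * m ≤ ∑ b, firstSign ω b} ≤
      Real.exp (-(m * (s * ρ - s ^ 2))) := by
  have hw : (w : ℝ) ≠ 0 := Nat.cast_ne_zero.2 (NeZero.ne w)
  set T : Finset (Fin n) := (Finset.univ : Finset (Fin m)).map (Fin.castLEEmb hmn) with hT
  have hcard : T.card = m := by simp [hT]
  have hsum : ∀ ω : Fin n → Query m w × Bool,
      ∑ b, firstSign ω b = ∑ q ∈ T, noiseSign (ω q).2 := by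
    intro ω
    rw [hT, Finset.sum_map]
    refine Finset.sum_congr rfl fun b _ => ?_
    rw [firstSign, dif_pos (b.2.trans_le hmn)]
    rfl
  have h1 := pr_sum_ge_le (p := weight m w n Φ ε) weight_nonneg sum_weight T
    (fun _ x => -s * noiseSign x.2) (-(s * (ρ * m))) (Real.exp (-(2 * (s * ρ)) + s ^ 2))
    (Real.exp_pos _).le ?_
  · refine (pr_mono weight_nonneg ?_).trans (h1.trans (le_of_eq ?_))
    · intro ω _ hω
      have hω : ∑ b, firstSign ω b < ρ * m := not_le.1 hω
      change _ ≤ ∑ q ∈ T, -s * noiseSign (ω q).2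
      rw [← Finset.mul_sum, ← hsum]
      nlinarith
    · rw [hcard, ← Real.exp_nat_mul, ← Real.exp_add]
      congr 1
      ring
  · intro q hq
    obtain ⟨b, -, rfl⟩ := Finset.mem_map.1 hq
    rw [sum_weight_mul_of_lt _ (by simp)]
    have h2 : ∀ u : ℝ, |u| ≤ 1 → Real.exp u ≤ 1 + u + u ^ 2 := fun u hu => by
      linarith [(abs_le.1 (Real.abs_exp_sub_one_sub_id_le hu)).2]
    have h3 := h2 s (by rw [abs_of_nonneg hs]; exact hs1)
    have h4 := h2 (-s) (by rw [abs_neg, abs_of_nonneg hs]; exact hs1)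
    have h5 : (w : ℝ)⁻¹ * ∑ k : Fin w, ((1 - (ε k 1 : ℝ)) * Real.exp (-s * noiseSign false) +
        ε k 1 * Real.exp (-s * noiseSign true)) ≤
        (w : ℝ)⁻¹ * ∑ k : Fin w, (1 - s + s ^ 2 + 2 * s * (ε k 1 : ℝ)) := by
      refine mul_le_mul_of_nonneg_left (Finset.sum_le_sum fun k _ => ?_) (by positivity)
      have e0 : (0 : ℝ) ≤ ε k 1 := (ε k 1).2.1
      have e1 : (0 : ℝ) ≤ 1 - ε k 1 := sub_nonneg.2 (ε k 1).2.2
      simp only [noiseSign]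
      simp only [Bool.false_eq_true, if_false, if_true, mul_one, mul_neg, neg_neg]
      nlinarith [mul_le_mul_of_nonneg_left h3 e0, mul_le_mul_of_nonneg_left h4 e1]
    refine h5.trans ?_
    rw [Finset.sum_add_distrib, ← Finset.mul_sum, Finset.sum_const, Finset.card_univ,
      Fintype.card_fin, nsmul_eq_mul, mul_add, inv_mul_cancel_left₀ hw]
    have h6 : (w : ℝ)⁻¹ * (2 * s * ∑ k, (ε k 1 : ℝ)) = 2 * s * ((∑ k, (ε k 1 : ℝ)) / w) := by
      rw [div_eq_inv_mul]
      ring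
    rw [h6]
    have h7 := mul_le_mul_of_nonneg_left hp (show 0 ≤ 2 * s by linarith)
    have h8 := mul_le_mul_of_nonneg_left hρ hs
    have h9 := Real.add_one_le_exp (-(2 * (s * ρ)) + s ^ 2)
    nlinarith

end SecondEstimates

section LargeDeviations

/-! ### Large deviations of the third- and fourth-set queries -/

/-- The queries of the third set that belong to the worker node `(k, d)`. -/
def nodeQueries {m w n : ℕ} (ω : Fin n → Query m w × Bool) (k : Fin w) (d : ℕ) :
    Finset (Fin n) :=
  (A3 m w n).filter fun j => (ω j).1.worker = k ∧ (ω j).1.degree = d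

theorem exp_le_one_add_add_sq {u : ℝ} (hu : |u| ≤ 1) : Real.exp u ≤ 1 + u + u ^ 2 := by
  linarith [(abs_le.1 (Real.abs_exp_sub_one_sub_id_le hu)).2]

/-- The exponential moment of a centred biased bit. -/
theorem bernoulli_exp_le {p s δ : ℝ} (hp : 0 ≤ p) (hp1 : p ≤ 1) (hs : |s| ≤ 1) :
    (1 - p) * Real.exp (s * (0 - p) - δ) + p * Real.exp (s * (1 - p) - δ) ≤
      Real.exp (s ^ 2 - δ) := by
  have h1 : |s * (0 - p)| ≤ 1 := by
    rw [abs_mul]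
    refine mul_le_one₀ hs (abs_nonneg _) (abs_le.2 ⟨by linarith, by linarith⟩)
  have h2 : |s * (1 - p)| ≤ 1 := by
    rw [abs_mul]
    refine mul_le_one₀ hs (abs_nonneg _) (abs_le.2 ⟨by linarith, by linarith⟩)
  have h3 := mul_le_mul_of_nonneg_left (exp_le_one_add_add_sq h1) (sub_nonneg.2 hp1)
  have h4 := mul_le_mul_of_nonneg_left (exp_le_one_add_add_sq h2) hp
  rw [sub_eq_add_neg (s * (0 - p)), sub_eq_add_neg (s * (1 - p)), sub_eq_add_neg (s ^ 2),
    Real.exp_add, Real.exp_add, Real.exp_add]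
  have h5 : (1 - p) * (1 + s * (0 - p) + (s * (0 - p)) ^ 2) +
      p * (1 + s * (1 - p) + (s * (1 - p)) ^ 2) ≤ 1 + s ^ 2 := by
    have : p * (1 - p) ≤ 1 := by nlinarith
    nlinarith [mul_le_mul_of_nonneg_left this (sq_nonneg s)]
  have h6 := Real.add_one_le_exp (s ^ 2)
  have h7 : (1 - p) * Real.exp (s * (0 - p)) + p * Real.exp (s * (1 - p)) ≤ Real.exp (s ^ 2) := by
    linarith
  have := mul_le_mul_of_nonneg_right h7 (Real.exp_pos (-δ)).le
  calc _ = ((1 - p) * Real.exp (s * (0 - p)) + p * Real.exp (s * (1 - p))) * Real.exp (-δ) := by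
        ring
    _ ≤ _ := this

variable {m w n D : ℕ} [NeZero w] {Φ : PMF ℕ} {ε : Fin w → ℕ → unitInterval}

/-- The expectation of a function that differs from `1` on the queries of one worker node only. -/
theorem sum_weight_node (hΦ : Φ.support ⊆ Set.Icc 1 D) (hD : D ≤ m) (j : Fin n)
    (hj : m ≤ (j : ℕ)) (k : Fin w) {d : ℕ} (hd : d ∈ Finset.Icc 1 D) (g : Bool → ℝ) :
    ∑ x, weight m w n Φ ε j x * (if x.1.worker = k ∧ x.1.degree = d then g x.2 else 1) =
      1 + (Φ d).toReal * ((w : ℝ)⁻¹ * ((1 - (ε k d : ℝ)) * g false + ε k d * g true - 1)) := by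
  have h1 : ∑ x, weight m w n Φ ε j x * (if x.1.worker = k ∧ x.1.degree = d then g x.2 else 1) =
      ∑ x, weight m w n Φ ε j x + ∑ x, weight m w n Φ ε j x *
        (if x.1.worker = k ∧ x.1.degree = d then g x.2 - 1 else 0) := by
    rw [← Finset.sum_add_distrib]
    refine Finset.sum_congr rfl fun x _ => ?_
    split_ifs <;> ring
  rw [h1, sum_weight, sum_weight_mul_of_le hΦ hD j hj]
  congr 1
  rw [Finset.sum_eq_single d]
  · congr 1
    have h2 : ∀ S ∈ Finset.powersetCard d (Finset.univ : Finset (Fin m)),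
        (w : ℝ)⁻¹ * ∑ l : Fin w, ((1 - (ε l d : ℝ)) *
          (if l = k ∧ (⟨S, l⟩ : Query m w).degree = d then g false - 1 else 0) +
          ε l d * (if l = k ∧ (⟨S, l⟩ : Query m w).degree = d then g true - 1 else 0)) =
        (w : ℝ)⁻¹ * ((1 - (ε k d : ℝ)) * g false + ε k d * g true - 1) := by
      intro S hS
      have hS' : ∀ l : Fin w, (⟨S, l⟩ : Query m w).degree = d := fun l =>
        (Finset.mem_powersetCard.1 hS).2
      simp only [hS', and_true]
      rw [Finset.sum_eq_single k]
      · rw [if_pos rfl, if_pos rfl]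
        ring
      · intro l _ hl
        simp [hl]
      · simp
    rw [Finset.sum_congr rfl h2, Finset.sum_const, Finset.card_powersetCard, Finset.card_univ,
      Fintype.card_fin, nsmul_eq_mul, inv_mul_cancel_left₀]
    exact_mod_cast (Nat.choose_pos ((Finset.mem_Icc.1 hd).2.trans hD)).ne'
  · intro d' _ hd'
    rw [Finset.sum_eq_zero, mul_zero, mul_zero]
    intro S hS
    have hS' : ∀ l : Fin w, (⟨S, l⟩ : Query m w).degree ≠ d := fun l h =>
      hd' ((Finset.mem_powersetCard.1 hS).2.symm.trans h)
    simp [hS']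
  · exact fun h => absurd hd h

/-- The expectation of a function that differs from `1` on the queries with a given label only. -/
theorem sum_weight_label (hΦ : Φ.support ⊆ Set.Icc 1 D) (hD : D ≤ m) (j : Fin n)
    (hj : m ≤ (j : ℕ)) (i : Fin m) (g : Fin w → ℕ → Bool → ℝ) :
    ∑ x, weight m w n Φ ε j x *
        (if i ∈ x.1.labels then g x.1.worker x.1.degree x.2 else 1) =
      1 + ∑ d ∈ Finset.Icc 1 D, (Φ d).toReal * (d / m * ((w : ℝ)⁻¹ * ∑ k,
        ((1 - (ε k d : ℝ)) * g k d false + ε k d * g k d true - 1))) := by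
  have h1 : ∑ x, weight m w n Φ ε j x *
        (if i ∈ x.1.labels then g x.1.worker x.1.degree x.2 else 1) =
      ∑ x, weight m w n Φ ε j x + ∑ x, weight m w n Φ ε j x *
        (if i ∈ x.1.labels then g x.1.worker x.1.degree x.2 - 1 else 0) := by
    rw [← Finset.sum_add_distrib]
    refine Finset.sum_congr rfl fun x _ => ?_
    split_ifs <;> ring
  rw [h1, sum_weight, sum_weight_mul_of_le hΦ hD j hj]
  congr 1
  refine Finset.sum_congr rfl fun d hd => ?_
  obtain ⟨hd1, hdD⟩ := Finset.mem_Icc.1 hd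
  congr 1
  have h2 : ∀ S ∈ Finset.powersetCard d (Finset.univ : Finset (Fin m)),
      (w : ℝ)⁻¹ * ∑ k : Fin w, ((1 - (ε k d : ℝ)) *
        (if i ∈ S then g k (⟨S, k⟩ : Query m w).degree false - 1 else 0) +
        ε k d * (if i ∈ S then g k (⟨S, k⟩ : Query m w).degree true - 1 else 0)) =
      ((({i} : Finset (Fin m)).filter (· ∈ S)).card : ℝ) * ((w : ℝ)⁻¹ * ∑ k,
        ((1 - (ε k d : ℝ)) * g k d false + ε k d * g k d true - 1)) := by
    intro S hS
    have hS' : ∀ l : Fin w, (⟨S, l⟩ : Query m w).degree = d := fun l =>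
      (Finset.mem_powersetCard.1 hS).2
    simp only [hS']
    by_cases hi : i ∈ S
    · rw [Finset.filter_true_of_mem (by simpa using hi), Finset.card_singleton]
      simp only [hi, if_true, Nat.cast_one, one_mul]
      congr 1
      refine Finset.sum_congr rfl fun k _ => ?_
      ring
    · rw [Finset.filter_false_of_mem (by simpa using hi)]
      simp [hi]
  rw [Finset.sum_congr rfl h2, ← Finset.sum_mul, ← mul_assoc,
    inv_choose_mul_sum_card_inter hd1 (hdD.trans hD), Finset.card_singleton, Nat.cast_one, one_mul]

/-- The exponential moment of the number of labels of the third-set queries of a worker node. -/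
theorem expect_two_pow_node_le (hΦ : Φ.support ⊆ Set.Icc 1 D) (hD : D ≤ m) (k : Fin w) {d : ℕ}
    (hd : d ∈ Finset.Icc 1 D) :
    expect (weight m w n Φ ε) (fun ω =>
      2 ^ ((nodeQueries ω k d).biUnion fun j => (ω j).1.labels).card) ≤
      Real.exp (2 ^ D * (size3 m w / w)) := by
  have h1 := expect_prod_le (p := weight m w n Φ ε) weight_nonneg sum_weight (A3 m w n)
    (fun _ x => if x.1.worker = k ∧ x.1.degree = d then 2 ^ D else 1)
    (fun _ => Real.exp (2 ^ D / w)) (fun _ _ => by split_ifs <;> positivity)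
    (fun _ => (Real.exp_pos _).le) ?_
  · refine le_trans (expect_mono weight_nonneg fun ω hω => ?_) (h1.trans ?_)
    · rw [← Finset.prod_filter, Finset.prod_const, ← pow_mul]
      refine pow_le_pow_right₀ one_le_two ?_
      refine (Finset.card_biUnion_le).trans ?_
      refine (Finset.sum_le_card_nsmul _ _ D fun j hj => ?_).trans_eq (by
        rw [smul_eq_mul, mul_comm]; rfl)
      rw [nodeQueries, Finset.mem_filter] at hj
      exact hj.2.2.trans_le (Finset.mem_Icc.1 hd).2
    · rw [Finset.prod_const, ← Real.exp_nat_mul]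
      refine Real.exp_le_exp.2 ?_
      have : ((A3 m w n).card : ℝ) ≤ size3 m w := by exact_mod_cast card_A3_le
      calc ((A3 m w n).card : ℝ) * (2 ^ D / w) ≤ size3 m w * (2 ^ D / w) := by gcongr
        _ = _ := by ring
  · intro q hq
    have hq' : m ≤ (q : ℕ) := by
      have := mem_A3.1 hq
      omega
    rw [sum_weight_node hΦ hD q hq' k hd (fun _ => 2 ^ D)]
    have h2 : (Φ d).toReal ≤ 1 := by
      simpa using ENNReal.toReal_mono ENNReal.one_ne_top (Φ.coe_le_one d)
    have h3 := Real.add_one_le_exp ((2 : ℝ) ^ D / w)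
    have h4 : (1 - (ε k d : ℝ)) * 2 ^ D + ε k d * 2 ^ D - 1 ≤ 2 ^ D := by linarith
    have h5 : (1 - (ε k d : ℝ)) * 2 ^ D + ε k d * 2 ^ D - 1 ≥ 0 := by
      have : (1 : ℝ) ≤ 2 ^ D := one_le_pow₀ one_le_two
      linarith
    have h6 : (w : ℝ)⁻¹ * ((1 - (ε k d : ℝ)) * 2 ^ D + ε k d * 2 ^ D - 1) ≤ 2 ^ D / w := by
      rw [div_eq_inv_mul]
      gcongr
    have h7 : (0 : ℝ) ≤ (w : ℝ)⁻¹ * ((1 - (ε k d : ℝ)) * 2 ^ D + ε k d * 2 ^ D - 1) := by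
      positivity
    have h8 := mul_le_of_le_one_left h7 h2
    linarith

/-- The exponential moment of the number of labels of the fourth-set queries of a label. -/
theorem expect_two_pow_label_le (hΦ : Φ.support ⊆ Set.Icc 1 D) (hD : D ≤ m) (i : Fin m) :
    expect (weight m w n Φ ε) (fun ω =>
      2 ^ ((queries4 (designOf ω) i).biUnion fun j => (ω j).1.labels).card) ≤
      Real.exp (2 ^ D * D * (n / m)) := by
  have hm : (0 : ℝ) < m := by exact_mod_cast i.pos
  have h1 := expect_prod_le (p := weight m w n Φ ε) weight_nonneg sum_weight (A4 m w n)
    (fun _ x => if i ∈ x.1.labels then 2 ^ D else 1)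
    (fun _ => Real.exp (2 ^ D * D / m)) (fun _ _ => by split_ifs <;> positivity)
    (fun _ => (Real.exp_pos _).le) ?_
  · refine le_trans (expect_mono weight_nonneg fun ω hω => ?_) (h1.trans ?_)
    · rw [← Finset.prod_filter, Finset.prod_const, ← pow_mul]
      refine pow_le_pow_right₀ one_le_two ?_
      refine (Finset.card_biUnion_le).trans ?_
      refine (Finset.sum_le_card_nsmul _ _ D fun j hj => ?_).trans_eq (by
        rw [smul_eq_mul, mul_comm]; rfl)
      rw [queries4, Finset.mem_filter, mem_A4] at hj
      exact (Finset.mem_Icc.1 (degree_of_weight_ne_zero hΦ hD j (by omega) (ω j) (hω j)).1).2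
    · rw [Finset.prod_const, ← Real.exp_nat_mul]
      refine Real.exp_le_exp.2 ?_
      have : ((A4 m w n).card : ℝ) ≤ n := by
        exact_mod_cast (Finset.card_le_univ _).trans (by simp)
      calc ((A4 m w n).card : ℝ) * (2 ^ D * D / m) ≤ n * (2 ^ D * D / m) := by gcongr
        _ = _ := by ring
  · intro q hq
    have hq' : m ≤ (q : ℕ) := by
      have := mem_A4.1 hq
      omega
    have h2 := sum_weight_card_inter_le (ε := ε) hΦ hD q hq' {i}
    have h3 : ∑ x, weight m w n Φ ε q x * (if i ∈ x.1.labels then (2 : ℝ) ^ D else 1) ≤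
        ∑ x, weight m w n Φ ε q x * (1 + 2 ^ D * ((({i} : Finset (Fin m)).filter
          (· ∈ x.1.labels)).card : ℝ)) := by
      refine Finset.sum_le_sum fun x _ => mul_le_mul_of_nonneg_left ?_ (weight_nonneg q x)
      split_ifs with hi
      · rw [Finset.filter_true_of_mem (by simpa using hi), Finset.card_singleton]
        simp
      · exact le_add_of_nonneg_right (by positivity)
    have h4 : ∑ x, weight m w n Φ ε q x * (1 + 2 ^ D * ((({i} : Finset (Fin m)).filter
          (· ∈ x.1.labels)).card : ℝ)) = ∑ x, weight m w n Φ ε q x + 2 ^ D *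
        ∑ x, weight m w n Φ ε q x * ((({i} : Finset (Fin m)).filter
          (· ∈ x.1.labels)).card : ℝ) := by
      rw [Finset.mul_sum, ← Finset.sum_add_distrib]
      exact Finset.sum_congr rfl fun x _ => by ring
    refine h3.trans ?_
    rw [h4, sum_weight]
    rw [Finset.card_singleton, Nat.cast_one] at h2
    have h5 := Real.add_one_le_exp ((2 : ℝ) ^ D * D / m)
    have h6 := mul_le_mul_of_nonneg_left h2 (show (0 : ℝ) ≤ 2 ^ D by positivity)
    have h7 : (2 : ℝ) ^ D * (1 / m * D) = 2 ^ D * D / m := by ring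
    linarith

/-- The number of wrong answers of a worker node does not deviate from its mean. -/
theorem pr_node_noise_le (hΦ : Φ.support ⊆ Set.Icc 1 D) (hD : D ≤ m) (k : Fin w) {d : ℕ}
    (hd : d ∈ Finset.Icc 1 D) {δ σ : ℝ} (hδ : 0 < δ) (hδ2 : δ ≤ 2) (hσ : |σ| = 1) :
    pr (weight m w n Φ ε) {ω | 0 ≤ ∑ j ∈ nodeQueries ω k d,
      (σ * ((if (ω j).2 then 1 else 0) - (ε k d : ℝ)) - δ)} ≤
      Real.exp (-((1 - Real.exp (-(δ ^ 2 / 4))) * (Φ d).toReal / w)) ^ (A3 m w n).card := by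
  have h1 := pr_sum_ge_le (p := weight m w n Φ ε) weight_nonneg sum_weight (A3 m w n)
    (fun _ x => if x.1.worker = k ∧ x.1.degree = d then
      δ / 2 * (σ * ((if x.2 then 1 else 0) - (ε k d : ℝ)) - δ) else 0) 0
    (Real.exp (-((1 - Real.exp (-(δ ^ 2 / 4))) * (Φ d).toReal / w))) (Real.exp_pos _).le ?_
  · rw [neg_zero, Real.exp_zero, one_mul] at h1
    refine (pr_mono weight_nonneg fun ω _ hω => ?_).trans h1
    change (0 : ℝ) ≤ ∑ q ∈ A3 m w n, if (ω q).1.worker = k ∧ (ω q).1.degree = d then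
      δ / 2 * (σ * ((if (ω q).2 then 1 else 0) - (ε k d : ℝ)) - δ) else 0
    rw [← Finset.sum_filter, ← Finset.mul_sum]
    exact mul_nonneg (by positivity) hω
  · intro q hq
    have hq' : m ≤ (q : ℕ) := by
      have := mem_A3.1 hq
      omega
    have e0 : (0 : ℝ) ≤ ε k d := (ε k d).2.1
    have e1 : (ε k d : ℝ) ≤ 1 := (ε k d).2.2
    have h2 : ∀ x : Query m w × Bool, Real.exp (if x.1.worker = k ∧ x.1.degree = d then
        δ / 2 * (σ * ((if x.2 then 1 else 0) - (ε k d : ℝ)) - δ) else 0) =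
        if x.1.worker = k ∧ x.1.degree = d then
          (fun b : Bool => Real.exp (δ / 2 * (σ * ((if b then 1 else 0) - (ε k d : ℝ)) - δ))) x.2
          else 1 := by
      intro x
      by_cases hx : x.1.worker = k ∧ x.1.degree = d
      · rw [if_pos hx, if_pos hx]
      · rw [if_neg hx, if_neg hx, Real.exp_zero]
    simp only [h2]
    rw [sum_weight_node hΦ hD q hq' k hd
      (fun b : Bool => Real.exp (δ / 2 * (σ * ((if b then 1 else 0) - (ε k d : ℝ)) - δ)))]
    have h3 := bernoulli_exp_le (p := ε k d) (s := δ / 2 * σ) (δ := δ / 2 * δ) e0 e1 (by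
      rw [abs_mul, hσ, mul_one, abs_of_pos (by positivity)]
      linarith)
    have hσ2 : σ ^ 2 = 1 := by rw [← sq_abs, hσ, one_pow]
    have h4 : (δ / 2 * σ) ^ 2 - δ / 2 * δ = -(δ ^ 2 / 4) := by
      rw [mul_pow, hσ2]
      ring
    rw [h4] at h3
    have h5 : ∀ c : ℝ, δ / 2 * (σ * (c - (ε k d : ℝ)) - δ) =
        δ / 2 * σ * (c - ε k d) - δ / 2 * δ := fun c => by ring
    simp only [h5, Bool.false_eq_true, if_false, if_true]
    have h6 := Real.add_one_le_exp (-((1 - Real.exp (-(δ ^ 2 / 4))) * (Φ d).toReal / w))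
    have h7 : (Φ d).toReal * ((w : ℝ)⁻¹ * ((1 - (ε k d : ℝ)) *
        Real.exp (δ / 2 * σ * (0 - ε k d) - δ / 2 * δ) +
        ε k d * Real.exp (δ / 2 * σ * (1 - ε k d) - δ / 2 * δ) - 1)) ≤
        (Φ d).toReal * ((w : ℝ)⁻¹ * (Real.exp (-(δ ^ 2 / 4)) - 1)) :=
      mul_le_mul_of_nonneg_left (mul_le_mul_of_nonneg_left (by linarith) (by positivity))
        ENNReal.toReal_nonneg
    have h8 : (Φ d).toReal * ((w : ℝ)⁻¹ * (Real.exp (-(δ ^ 2 / 4)) - 1)) =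
        -((1 - Real.exp (-(δ ^ 2 / 4))) * (Φ d).toReal / w) := by
      rw [div_eq_mul_inv]
      ring
    linarith

/-- A worker node has many third-set queries. -/
theorem pr_node_card_le (hΦ : Φ.support ⊆ Set.Icc 1 D) (hD : D ≤ m) (k : Fin w) {d : ℕ}
    (hd : d ∈ Finset.Icc 1 D) (θ : ℝ) :
    pr (weight m w n Φ ε) {ω | ((nodeQueries ω k d).card : ℝ) ≤ θ} ≤
      Real.exp θ * Real.exp (-((Φ d).toReal / (2 * w))) ^ (A3 m w n).card := by
  have h1 := pr_sum_ge_le (p := weight m w n Φ ε) weight_nonneg sum_weight (A3 m w n)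
    (fun _ x => if x.1.worker = k ∧ x.1.degree = d then -1 else 0) (-θ)
    (Real.exp (-((Φ d).toReal / (2 * w)))) (Real.exp_pos _).le ?_
  · rw [neg_neg] at h1
    refine (pr_mono weight_nonneg fun ω _ hω => ?_).trans h1
    change -θ ≤ ∑ q ∈ A3 m w n, if (ω q).1.worker = k ∧ (ω q).1.degree = d then (-1 : ℝ) else 0
    rw [← Finset.sum_filter, Finset.sum_const, nsmul_eq_mul, mul_neg, mul_one, neg_le_neg_iff]
    exact hω
  · intro q hq
    have hq' : m ≤ (q : ℕ) := by
      have := mem_A3.1 hq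
      omega
    have h2 : ∀ x : Query m w × Bool,
        Real.exp (if x.1.worker = k ∧ x.1.degree = d then -1 else 0) =
        if x.1.worker = k ∧ x.1.degree = d then (fun _ : Bool => Real.exp (-1)) x.2 else 1 := by
      intro x
      split_ifs <;> simp
    simp only [h2]
    rw [sum_weight_node hΦ hD q hq' k hd (fun _ : Bool => Real.exp (-1))]
    have h3 : Real.exp (-1) ≤ 1 / 2 := by
      rw [Real.exp_neg, ← one_div]
      refine one_div_le_one_div_of_le (by norm_num) ?_
      linarith [Real.add_one_le_exp (1 : ℝ)]
    have h6 := Real.add_one_le_exp (-((Φ d).toReal / (2 * w)))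
    have h7 : (Φ d).toReal * ((w : ℝ)⁻¹ * ((1 - (ε k d : ℝ)) * Real.exp (-1) +
        ε k d * Real.exp (-1) - 1)) ≤ (Φ d).toReal * ((w : ℝ)⁻¹ * (-(1 / 2))) :=
      mul_le_mul_of_nonneg_left (mul_le_mul_of_nonneg_left (by linarith) (by positivity))
        ENNReal.toReal_nonneg
    have h8 : (Φ d).toReal * ((w : ℝ)⁻¹ * (-(1 / 2))) = -((Φ d).toReal / (2 * w)) := by
      ring
    linarith

/-- The rate at which a query of the fourth set reduces the error probability of a label, times
the number of labels. -/
def capacity (w D : ℕ) (Φ : PMF ℕ) (ε : Fin w → ℕ → unitInterval) : ℝ :=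
  ∑ d ∈ Finset.Icc 1 D, ∑ k : Fin w, (d : ℝ) * (Φ d).toReal / (w : ℝ) *
    (Real.sqrt (1 - (ε k d : ℝ)) - Real.sqrt (ε k d : ℝ)) ^ 2

/-- The log-likelihood ratio of a correct answer. -/
def llr (p : ℝ) : ℝ := Real.log ((1 - p) / p)

/-- The exponential moment of order one half of the log-likelihood ratio of an answer. -/
theorem exp_half_llr {p γ : ℝ} (hp : 0 < p) (hp1 : p < 1) :
    (1 - p) * Real.exp (-(llr p * 1 - γ) / 2) + p * Real.exp (-(llr p * -1 - γ) / 2) =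
      Real.exp (γ / 2) * (1 - (Real.sqrt (1 - p) - Real.sqrt p) ^ 2) := by
  have hq : 0 < 1 - p := by linarith
  have h1 : Real.exp (llr p / 2) = Real.sqrt (1 - p) / Real.sqrt p := by
    rw [Real.exp_half, llr, Real.exp_log (by positivity), Real.sqrt_div hq.le]
  have h2 : Real.exp (-(llr p) / 2) = Real.sqrt p / Real.sqrt (1 - p) := by
    rw [neg_div, Real.exp_neg, h1, inv_div]
  have e1 : -(llr p * 1 - γ) / 2 = -(llr p) / 2 + γ / 2 := by ring
  have e2 : -(llr p * -1 - γ) / 2 = llr p / 2 + γ / 2 := by ring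
  rw [e1, e2, Real.exp_add, Real.exp_add, h1, h2]
  have s1 : 0 < Real.sqrt p := Real.sqrt_pos.2 hp
  have s2 : 0 < Real.sqrt (1 - p) := Real.sqrt_pos.2 hq
  have q1 : Real.sqrt p ^ 2 = p := Real.sq_sqrt hp.le
  have q2 : Real.sqrt (1 - p) ^ 2 = 1 - p := Real.sq_sqrt hq.le
  have h3 : (1 - p) * (Real.sqrt p / Real.sqrt (1 - p)) = Real.sqrt p * Real.sqrt (1 - p) := by
    rw [mul_div_assoc', div_eq_iff s2.ne', mul_assoc, ← sq, q2]
    ring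
  have h4 : p * (Real.sqrt (1 - p) / Real.sqrt p) = Real.sqrt p * Real.sqrt (1 - p) := by
    rw [mul_div_assoc', div_eq_iff s1.ne', mul_right_comm, ← sq, q1]
  have h5 : 1 - (Real.sqrt (1 - p) - Real.sqrt p) ^ 2 =
      2 * (Real.sqrt p * Real.sqrt (1 - p)) := by
    linear_combination -q1 - q2
  rw [h5, ← mul_assoc, ← mul_assoc, h3, h4]
  ring

/-- The weighted vote for the label `i` with the true weights and noise alone, lowered by `γ` for
each query, is large: this is Chernoff's bound with the optimal exponent one half. -/
theorem pr_final_vote_le (hΦ : Φ.support ⊆ Set.Icc 1 D) (hD : D ≤ m) (i : Fin m)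
    (hε0 : ∀ k, ∀ d ∈ Finset.Icc 1 D, 0 < (ε k d : ℝ))
    (hε1 : ∀ k, ∀ d ∈ Finset.Icc 1 D, (ε k d : ℝ) < 1) {γ : ℝ} (hγ : 0 ≤ γ) (θ : ℝ) :
    pr (weight m w n Φ ε) {ω | ∑ j ∈ queries4 (designOf ω) i,
      (llr (ε (ω j).1.worker (ω j).1.degree) * noiseSign (ω j).2 - γ) ≤ θ} ≤
      Real.exp (θ / 2) * Real.exp (-((capacity w D Φ ε - D * (Real.exp (γ / 2) - 1)) / m)) ^
        (A4 m w n).card := by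
  have hm : (0 : ℝ) < m := by exact_mod_cast i.pos
  have hw : (w : ℝ) ≠ 0 := Nat.cast_ne_zero.2 (NeZero.ne w)
  have h1 := pr_sum_ge_le (p := weight m w n Φ ε) weight_nonneg sum_weight (A4 m w n)
    (fun _ x => if i ∈ x.1.labels then
      -(llr (ε x.1.worker x.1.degree) * noiseSign x.2 - γ) / 2 else 0) (-(θ / 2))
    (Real.exp (-((capacity w D Φ ε - D * (Real.exp (γ / 2) - 1)) / m))) (Real.exp_pos _).le ?_
  · rw [neg_neg] at h1
    refine (pr_mono weight_nonneg fun ω _ hω => ?_).trans h1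
    change -(θ / 2) ≤ ∑ q ∈ A4 m w n, if i ∈ (ω q).1.labels then
      -(llr (ε (ω q).1.worker (ω q).1.degree) * noiseSign (ω q).2 - γ) / 2 else 0
    rw [← Finset.sum_filter, ← Finset.sum_div, Finset.sum_neg_distrib, neg_div, neg_le_neg_iff]
    exact div_le_div_of_nonneg_right hω (by norm_num)
  · intro q hq
    have hq' : m ≤ (q : ℕ) := by
      have := mem_A4.1 hq
      omega
    have h2 : ∀ x : Query m w × Bool, Real.exp (if i ∈ x.1.labels then
        -(llr (ε x.1.worker x.1.degree) * noiseSign x.2 - γ) / 2 else 0) =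
        if i ∈ x.1.labels then (fun k d b => Real.exp (-(llr (ε k d) * noiseSign b - γ) / 2))
          x.1.worker x.1.degree x.2 else 1 := by
      intro x
      split_ifs <;> simp
    simp only [h2]
    rw [sum_weight_label hΦ hD q hq' i
      (fun k d b => Real.exp (-(llr (ε k d) * noiseSign b - γ) / 2))]
    have h3 : ∀ d ∈ Finset.Icc 1 D, (Φ d).toReal * ((d : ℝ) / m * ((w : ℝ)⁻¹ * ∑ k,
        ((1 - (ε k d : ℝ)) * Real.exp (-(llr (ε k d) * noiseSign false - γ) / 2) +
          ε k d * Real.exp (-(llr (ε k d) * noiseSign true - γ) / 2) - 1))) ≤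
        (Φ d).toReal * (D * (Real.exp (γ / 2) - 1) / m) - (∑ k : Fin w,
          (d : ℝ) * (Φ d).toReal / (w : ℝ) *
            (Real.sqrt (1 - (ε k d : ℝ)) - Real.sqrt (ε k d : ℝ)) ^ 2) / m := by
      intro d hd
      have hdD : (d : ℝ) ≤ D := by exact_mod_cast (Finset.mem_Icc.1 hd).2
      have hg : 0 ≤ Real.exp (γ / 2) - 1 := by
        linarith [Real.one_le_exp (show 0 ≤ γ / 2 by linarith)]
      have h4 : ∀ k : Fin w, (1 - (ε k d : ℝ)) * Real.exp (-(llr (ε k d) * noiseSign false - γ) / 2)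
          + ε k d * Real.exp (-(llr (ε k d) * noiseSign true - γ) / 2) - 1 ≤
          (Real.exp (γ / 2) - 1) -
            (Real.sqrt (1 - (ε k d : ℝ)) - Real.sqrt (ε k d : ℝ)) ^ 2 := by
        intro k
        have h5 := exp_half_llr (γ := γ) (hε0 k d hd) (hε1 k d hd)
        simp only [noiseSign, Bool.false_eq_true, if_false, if_true]
        rw [h5]
        nlinarith [mul_nonneg hg (sq_nonneg (Real.sqrt (1 - (ε k d : ℝ)) - Real.sqrt (ε k d : ℝ)))]
      have h6 : (w : ℝ)⁻¹ * ∑ k : Fin w, ((Real.exp (γ / 2) - 1) -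
            (Real.sqrt (1 - (ε k d : ℝ)) - Real.sqrt (ε k d : ℝ)) ^ 2) =
          (Real.exp (γ / 2) - 1) - (w : ℝ)⁻¹ *
            ∑ k : Fin w, (Real.sqrt (1 - (ε k d : ℝ)) - Real.sqrt (ε k d : ℝ)) ^ 2 := by
        rw [Finset.sum_sub_distrib, Finset.sum_const, Finset.card_univ, Fintype.card_fin,
          nsmul_eq_mul, mul_sub, inv_mul_cancel_left₀ hw]
      have hP : 0 ≤ (Φ d).toReal := ENNReal.toReal_nonneg
      calc _ ≤ (Φ d).toReal * ((d : ℝ) / m * ((w : ℝ)⁻¹ * ∑ k : Fin w, ((Real.exp (γ / 2) - 1) -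
            (Real.sqrt (1 - (ε k d : ℝ)) - Real.sqrt (ε k d : ℝ)) ^ 2))) := by
            refine mul_le_mul_of_nonneg_left (mul_le_mul_of_nonneg_left
              (mul_le_mul_of_nonneg_left (Finset.sum_le_sum fun k _ => h4 k) (by positivity))
              (by positivity)) hP
        _ = (Φ d).toReal * ((d : ℝ) * (Real.exp (γ / 2) - 1) / m) - (∑ k : Fin w,
          (d : ℝ) * (Φ d).toReal / (w : ℝ) *
            (Real.sqrt (1 - (ε k d : ℝ)) - Real.sqrt (ε k d : ℝ)) ^ 2) / m := by
            rw [h6, ← Finset.mul_sum]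
            ring
        _ ≤ _ := by gcongr
    have h7 := Finset.sum_le_sum h3
    rw [Finset.sum_sub_distrib, ← Finset.sum_mul, sum_degree hΦ, one_mul, ← Finset.sum_div] at h7
    have h8 := Real.add_one_le_exp (-((capacity w D Φ ε - D * (Real.exp (γ / 2) - 1)) / m))
    have h9 : -((capacity w D Φ ε - D * (Real.exp (γ / 2) - 1)) / m) =
        D * (Real.exp (γ / 2) - 1) / m - capacity w D Φ ε / m := by ring
    unfold capacity at h8 h9 ⊢
    linarith

end LargeDeviations

/-! ### Correctness of the estimates outside the exceptional events -/

section Correct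

variable {m w n : ℕ}

/-- The noise of an answer as a unit. -/
def noiseUnit (b : Bool) : ℤˣ := if b then -1 else 1

theorem noiseUnit_cast (b : Bool) : (((noiseUnit b : ℤˣ) : ℤ) : ℝ) = noiseSign b := by
  cases b <;> simp [noiseUnit, noiseSign]

theorem unit_cast_mul_self (u : ℤˣ) : ((u : ℤ) : ℝ) * ((u : ℤ) : ℝ) = 1 := by
  rcases Int.units_eq_one_or u with rfl | rfl <;> simp

theorem signWith_eq {c : Bool} {u : ℤˣ} {r : ℝ} (h : 0 < ((u : ℤ) : ℝ) * r) :
    signWith c r = u := by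
  rcases Int.units_eq_one_or u with rfl | rfl
  · have : 0 < r := by simpa using h
    simp [signWith, this]
  · have : r < 0 := by simpa using h
    simp [signWith, this, this.not_gt]

theorem answers_eq (x : Fin m → ℤˣ) (ω : Sample m w n) (j : Fin n) :
    ω.answers x j = noiseUnit (ω.1 j).2 * ∏ i ∈ (ω.design j).labels, x i := rfl

theorem est1_cast (x : Fin m → ℤˣ) (ω : Sample m w n) (hmn : m ≤ n)
    (hfirst : ∀ (j : Fin n) (hj : (j : ℕ) < m), (ω.design j).labels = {⟨j, hj⟩}) (b : Fin m) :
    ((est1 (ω.answers x) b : ℤ) : ℝ) = firstSign ω.1 b * ((x b : ℤ) : ℝ) := by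
  have hb : (b : ℕ) < n := b.2.trans_le hmn
  rw [est1, dif_pos hb, firstSign, dif_pos hb, answers_eq, hfirst ⟨b, hb⟩ b.2]
  simp [noiseUnit_cast]

/-- A positive relative vote means that the second estimate is right, with no tie. -/
theorem est2_eq (x : Fin m → ℤˣ) (ω : Sample m w n) (hmn : m ≤ n)
    (hfirst : ∀ (j : Fin n) (hj : (j : ℕ) < m), (ω.design j).labels = {⟨j, hj⟩})
    (c : Fin m → Bool) {a : Fin m} (ha : 0 < vote ω.1 a) :
    est2 ω.design (ω.answers x) c a = x a := by
  refine signWith_eq ?_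
  have h1 : ∑ j ∈ (A2 m n).filter fun j => a ∈ (ω.design j).labels,
      ((message ω.design (ω.answers x) (est1 (ω.answers x)) j a : ℤ) : ℝ) =
      ((x a : ℤ) : ℝ) * vote ω.1 a := by
    rw [vote, Finset.mul_sum]
    refine Finset.sum_congr rfl fun j hj => ?_
    have haj : a ∈ (ω.design j).labels := (Finset.mem_filter.1 hj).2
    rw [message, answers_eq, ← Finset.mul_prod_erase _ _ haj]
    push_cast
    rw [noiseUnit_cast, Finset.prod_congr rfl fun b _ => est1_cast x ω hmn hfirst b,
      Finset.prod_mul_distrib]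
    have h2 : (∏ b ∈ (ω.design j).labels.erase a, ((x b : ℤ) : ℝ)) *
        ∏ b ∈ (ω.design j).labels.erase a, ((x b : ℤ) : ℝ) = 1 := by
      rw [← Finset.prod_mul_distrib]
      exact Finset.prod_eq_one fun b _ => unit_cast_mul_self _
    have h3 : (ω.1 j).1.labels = (ω.design j).labels := rfl
    rw [h3]
    linear_combination (noiseSign (ω.1 j).2 * ((x a : ℤ) : ℝ) *
      ∏ b ∈ (ω.design j).labels.erase a, firstSign ω.1 b) * h2
  rw [h1, ← mul_assoc, unit_cast_mul_self, one_mul]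
  exact ha

/-- Disjoint sets that meet `W` are at most as many as the elements of `W`. -/
theorem card_filter_meets_le {κ α : Type*} [DecidableEq α] (Q : Finset κ) (t : κ → Finset α)
    (W : Finset α) (P : κ → Prop) [DecidablePred P] (hP : ∀ j ∈ Q, P j → ∃ a ∈ t j, a ∈ W)
    (hd : ∀ j ∈ Q, ∀ j' ∈ Q, j ≠ j' → Disjoint (t j) (t j')) : (Q.filter P).card ≤ W.card := by
  classical
  rcases (Q.filter P).eq_empty_or_nonempty with h0 | ⟨j₀, h0⟩
  · simp [h0]
  obtain ⟨a₀, -⟩ := hP j₀ (Finset.mem_filter.1 h0).1 (Finset.mem_filter.1 h0).2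
  have h : ∀ j, ∃ a, j ∈ Q.filter P → a ∈ t j ∧ a ∈ W := by
    intro j
    by_cases hj : j ∈ Q.filter P
    · obtain ⟨a, ha⟩ := hP j (Finset.mem_filter.1 hj).1 (Finset.mem_filter.1 hj).2
      exact ⟨a, fun _ => ha⟩
    · exact ⟨a₀, fun h => absurd h hj⟩
  choose f hf using h
  refine Finset.card_le_card_of_injOn f (fun j hj => (hf j hj).2) ?_
  intro j hj j' hj' h
  by_contra hne
  have h1 := (hf j hj).1
  have h2 := (hf j' hj').1
  rw [h] at h1
  exact Finset.disjoint_left.1 (hd j (Finset.mem_filter.1 hj).1 j' (Finset.mem_filter.1 hj').1 hne)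
    h1 h2

theorem abs_trunc_sub_le {l r e : ℝ} (h1 : l ≤ e) (h2 : e ≤ 1 / 2) :
    |max l (min (1 / 2) r) - e| ≤ |r - e| := by
  rcases le_total r e with h | h
  · rw [abs_of_nonpos (sub_nonpos.2 h), min_eq_right (h.trans h2),
      abs_of_nonpos (sub_nonpos.2 (max_le h1 h))]
    linarith [le_max_right l r]
  · rw [abs_of_nonneg (sub_nonneg.2 h), max_eq_right (h1.trans (le_min h2 h)),
      abs_of_nonneg (sub_nonneg.2 (le_min h2 h))]
    linarith [min_le_right (1 / 2) r]

theorem abs_llr_sub_le {l p q : ℝ} (hl : 0 < l) (hp : l ≤ p) (hp2 : p ≤ 1 / 2) (hq : l ≤ q)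
    (hq2 : q ≤ 1 / 2) : |llr p - llr q| ≤ 2 / l * |p - q| := by
  have key : ∀ p q : ℝ, l ≤ p → p ≤ 1 / 2 → l ≤ q → q ≤ 1 / 2 →
      llr p - llr q ≤ 2 / l * |p - q| := by
    intro p q hp hp2 hq hq2
    have hp0 : 0 < p := hl.trans_le hp
    have hq0 : 0 < q := hl.trans_le hq
    have hp1 : 0 < 1 - p := by linarith
    have hq1 : 0 < 1 - q := by linarith
    have h1 : llr p - llr q = Real.log ((1 - p) / (1 - q)) + Real.log (q / p) := by
      rw [llr, llr, Real.log_div hp1.ne' hp0.ne', Real.log_div hq1.ne' hq0.ne',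
        Real.log_div hp1.ne' hq1.ne', Real.log_div hq0.ne' hp0.ne']
      ring
    have h2 := Real.log_le_sub_one_of_pos (div_pos hp1 hq1)
    have h3 := Real.log_le_sub_one_of_pos (div_pos hq0 hp0)
    have h4 : (1 - p) / (1 - q) - 1 ≤ |p - q| / l := by
      rw [div_sub_one hq1.ne']
      calc (1 - p - (1 - q)) / (1 - q) ≤ |p - q| / (1 - q) := by
            gcongr
            rw [abs_sub_comm]
            linarith [le_abs_self (q - p)]
        _ ≤ |p - q| / l := by
            gcongr
            linarith
    have h5 : q / p - 1 ≤ |p - q| / l := by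
      rw [div_sub_one hp0.ne']
      calc (q - p) / p ≤ |p - q| / p := by
            gcongr
            rw [abs_sub_comm]
            exact le_abs_self _
        _ ≤ |p - q| / l := by gcongr
    have h6 : 2 / l * |p - q| = |p - q| / l + |p - q| / l := by ring
    linarith
  refine abs_le.2 ⟨?_, key p q hp hp2 hq hq2⟩
  have := key q p hq hq2 hp hp2
  rw [abs_sub_comm] at this
  linarith

theorem llr_nonneg {p : ℝ} (hp : 0 < p) (hp2 : p ≤ 1 / 2) : 0 ≤ llr p := by
  refine Real.log_nonneg ?_
  rw [one_le_div hp]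
  linarith

theorem llr_le {l p : ℝ} (hl : 0 < l) (hp : l ≤ p) (hp2 : p ≤ 1 / 2) : llr p ≤ 1 / l := by
  have hp0 : 0 < p := hl.trans_le hp
  have h1 := Real.log_le_sub_one_of_pos (div_pos (show 0 < 1 - p by linarith) hp0)
  have h2 : (1 - p) / p = 1 / p - 1 := by rw [sub_div, div_self hp0.ne']
  have h3 : 1 / p ≤ 1 / l := one_div_le_one_div_of_le hl hp
  unfold llr
  linarith

/-- The estimated noise parameter of a worker node is accurate if few of the labels below it have
wrong second estimates. -/
theorem abs_noiseEst_sub_le (x : Fin m → ℤˣ) (ω : Sample m w n) (c : Fin m → Bool)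
    (hest : ∀ a, 0 < vote ω.1 a → est2 ω.design (ω.answers x) c a = x a)
    {lam e δ θ : ℝ} (hl : lam ≤ e) (he : e ≤ 1 / 2) (he0 : 0 ≤ e) (hδ : 0 < δ) (hθ : 5 < θ)
    {K : ℕ} (hK : K + 10 + 5 * δ ≤ 2 * δ * (θ - 5)) (k : Fin w) (d : ℕ) (S₃ : Finset (Fin n))
    (hsub : S₃.filter (fun j => (ω.design j).worker = k ∧ (ω.design j).degree = d) ⊆
      nodeQueries ω.1 k d)
    (hcard : (nodeQueries ω.1 k d \
      S₃.filter fun j => (ω.design j).worker = k ∧ (ω.design j).degree = d).card ≤ 5)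
    (hdisj : ∀ j ∈ S₃, ∀ j' ∈ S₃, j ≠ j' →
      Disjoint (ω.design j).labels (ω.design j').labels)
    (hwrong : (((nodeQueries ω.1 k d).biUnion fun j => (ω.1 j).1.labels).filter
      fun a => vote ω.1 a ≤ 0).card < K)
    (hN : θ < ((nodeQueries ω.1 k d).card : ℝ))
    (hnoise : ∀ σ : ℝ, |σ| = 1 → ∑ j ∈ nodeQueries ω.1 k d,
      (σ * ((if (ω.1 j).2 then 1 else 0) - e) - δ) < 0) :
    |noiseEst lam ω.design (ω.answers x) c S₃ k d - e| ≤ 3 * δ := by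
  classical
  set Q := S₃.filter fun j => (ω.design j).worker = k ∧ (ω.design j).degree = d with hQ
  set F := nodeQueries ω.1 k d with hF
  set B := Q.filter fun j => ω.answers x j ≠
    ∏ a ∈ (ω.design j).labels, est2 ω.design (ω.answers x) c a with hB
  set X := F.filter fun j => (ω.1 j).2 = true with hX
  set R := Q.filter fun j => ∃ a ∈ (ω.design j).labels, vote ω.1 a ≤ 0 with hR
  have hRK : R.card ≤ K := by
    refine (card_filter_meets_le Q (fun j => (ω.design j).labels) _ _ ?_ ?_).trans hwrong.le
    · rintro j hj ⟨a, ha, hv⟩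
      exact ⟨a, ha, Finset.mem_filter.2 ⟨Finset.mem_biUnion.2 ⟨j, hsub hj, ha⟩, hv⟩⟩
    · exact fun j hj j' hj' => hdisj j (Finset.mem_filter.1 hj).1 j' (Finset.mem_filter.1 hj').1
  have hgood : ∀ j ∈ Q, j ∉ R → (ω.answers x j ≠
      ∏ a ∈ (ω.design j).labels, est2 ω.design (ω.answers x) c a ↔ (ω.1 j).2 = true) := by
    intro j hj hjR
    have h1 : ∀ a ∈ (ω.design j).labels, est2 ω.design (ω.answers x) c a = x a := by
      intro a ha
      refine hest a (not_le.1 fun hv => hjR (Finset.mem_filter.2 ⟨hj, a, ha, hv⟩))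
    rw [Finset.prod_congr rfl h1, answers_eq, Ne, mul_eq_right, noiseUnit]
    cases (ω.1 j).2 <;> simp
  have hBX : B ⊆ X ∪ R := by
    intro j hj
    obtain ⟨hjQ, hne⟩ := Finset.mem_filter.1 hj
    by_cases hjR : j ∈ R
    · exact Finset.mem_union_right _ hjR
    · exact Finset.mem_union_left _ (Finset.mem_filter.2 ⟨hsub hjQ, (hgood j hjQ hjR).1 hne⟩)
  have hXB : X ⊆ (B ∪ R) ∪ (F \ Q) := by
    intro j hj
    obtain ⟨hjF, hb⟩ := Finset.mem_filter.1 hj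
    by_cases hjQ : j ∈ Q
    · refine Finset.mem_union_left _ ?_
      by_cases hjR : j ∈ R
      · exact Finset.mem_union_right _ hjR
      · exact Finset.mem_union_left _ (Finset.mem_filter.2 ⟨hjQ, (hgood j hjQ hjR).2 hb⟩)
    · exact Finset.mem_union_right _ (Finset.mem_sdiff.2 ⟨hjF, hjQ⟩)
  have c1 : (B.card : ℝ) ≤ X.card + K := by
    have := (Finset.card_le_card hBX).trans (Finset.card_union_le _ _)
    exact_mod_cast this.trans (Nat.add_le_add_left hRK _)
  have c2 : (X.card : ℝ) ≤ B.card + K + 5 := by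
    have h1 := (Finset.card_le_card hXB).trans (Finset.card_union_le _ _)
    have h2 := Finset.card_union_le B R
    have : X.card ≤ B.card + K + 5 := by omega
    exact_mod_cast this
  have c3 : (F.card : ℝ) ≤ Q.card + 5 := by
    have h1 := Finset.card_sdiff_add_card_eq_card hsub
    have : F.card ≤ Q.card + 5 := by omega
    exact_mod_cast this
  have c4 : (Q.card : ℝ) ≤ F.card := by exact_mod_cast Finset.card_le_card hsub
  have hsum : ∀ σ : ℝ, ∑ j ∈ F, (σ * ((if (ω.1 j).2 then 1 else 0) - e) - δ) =
      σ * (X.card - e * F.card) - δ * F.card := by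
    intro σ
    rw [Finset.sum_sub_distrib, ← Finset.mul_sum, Finset.sum_sub_distrib, Finset.sum_boole,
      Finset.sum_const, Finset.sum_const, nsmul_eq_mul, nsmul_eq_mul]
    ring
  have n1 := hnoise 1 (by simp)
  have n2 := hnoise (-1) (by simp)
  rw [hsum] at n1 n2
  have hQ0 : (0 : ℝ) < Q.card := by linarith
  have e1 : e * F.card ≤ e * Q.card + 5 := by nlinarith
  have e2 : e * Q.card ≤ e * F.card := mul_le_mul_of_nonneg_left c4 he0
  have e3 : δ * F.card ≤ δ * Q.card + 5 * δ := by nlinarith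
  have e4 : 2 * δ * (θ - 5) ≤ 2 * δ * Q.card :=
    mul_le_mul_of_nonneg_left (by linarith) (by positivity)
  rw [noiseEst]
  refine (abs_trunc_sub_le hl he).trans ?_
  change |(B.card : ℝ) / Q.card - e| ≤ 3 * δ
  rw [abs_le]
  constructor
  · rw [le_sub_iff_add_le, le_div_iff₀ hQ0]
    nlinarith
  · rw [sub_le_iff_le_add, div_le_iff₀ hQ0]
    nlinarith

end Correct

section Algorithm

variable {m w n : ℕ}

/-- The final vote is right if few of the labels below the fourth-set queries have wrong second
estimates, the estimated weights are accurate, and the vote with the true weights and the noise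
alone is clear. -/
theorem est4_eq (x : Fin m → ℤˣ) (ω : Sample m w n) (c : Fin m → Bool) (c' : Bool) (i : Fin m)
    (hest : ∀ a, 0 < vote ω.1 a → est2 ω.design (ω.answers x) c a = x a)
    {lam δ : ℝ} (hl : 0 < lam) (hl2 : lam ≤ 1 / 2) (hδ : 0 ≤ δ) {e : Fin n → ℝ} {K : ℕ} {S₄ S₃ : Finset (Fin n)}
    (hsub : S₄ ⊆ queries4 ω.design i) (hcard : (queries4 ω.design i \ S₄).card ≤ 3)
    (he : ∀ j ∈ queries4 ω.design i, lam ≤ e j ∧ e j ≤ 1 / 2)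
    (hnoise : ∀ j ∈ S₄, |noiseEst lam ω.design (ω.answers x) c S₃ (ω.design j).worker
      (ω.design j).degree - e j| ≤ 3 * δ)
    (hdisj : ∀ j ∈ S₄, ∀ j' ∈ S₄, j ≠ j' →
      Disjoint ((ω.design j).labels.erase i) ((ω.design j').labels.erase i))
    (hwrong : (((queries4 ω.design i).biUnion fun j => (ω.1 j).1.labels).filter
      fun a => vote ω.1 a ≤ 0).card < K)
    (hvote : (2 * K + 3) / lam < ∑ j ∈ queries4 ω.design i,
      (llr (e j) * noiseSign (ω.1 j).2 - 2 / lam * (3 * δ))) :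
    est4 lam ω.design (ω.answers x) c c' S₄ S₃ i = x i := by
  classical
  set z := est2 ω.design (ω.answers x) c with hz
  set p : Fin n → ℝ := fun j => noiseEst lam ω.design (ω.answers x) c S₃ (ω.design j).worker
      (ω.design j).degree with hp
  have hp1 : ∀ j, lam ≤ p j := fun j => le_max_left _ _
  have hp2 : ∀ j, p j ≤ 1 / 2 := fun j => max_le hl2 (min_le_left _ _)
  refine signWith_eq ?_
  rw [Finset.mul_sum]
  set R := S₄.filter fun j => ∃ a ∈ (ω.design j).labels.erase i, vote ω.1 a ≤ 0 with hR
  have hRK : R.card ≤ K := by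
    refine (card_filter_meets_le S₄ (fun j => (ω.design j).labels.erase i) _ _ ?_ hdisj).trans
      hwrong.le
    rintro j hj ⟨a, ha, hv⟩
    exact ⟨a, ha, Finset.mem_filter.2 ⟨Finset.mem_biUnion.2
      ⟨j, hsub hj, Finset.mem_of_mem_erase ha⟩, hv⟩⟩
  have hl0 : 0 ≤ 1 / lam := by positivity
  have hsign : ∀ j, noiseSign (ω.1 j).2 = 1 ∨ noiseSign (ω.1 j).2 = -1 := fun j => by
    cases (ω.1 j).2 <;> simp [noiseSign]
  have hterm : ∀ j ∈ S₄, llr (e j) * noiseSign (ω.1 j).2 - 2 / lam * (3 * δ) -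
      (if j ∈ R then 2 / lam else 0) ≤
      ((x i : ℤ) : ℝ) * (Real.log ((1 - p j) / p j) *
        ((message ω.design (ω.answers x) z j i : ℤ) : ℝ)) := by
    intro j hj
    have hij : i ∈ (ω.design j).labels := (Finset.mem_filter.1 (hsub hj)).2
    obtain ⟨he1, he2⟩ := he j (hsub hj)
    have h1 := abs_llr_sub_le hl (hp1 j) (hp2 j) he1 he2
    have h2 : |llr (p j) - llr (e j)| ≤ 2 / lam * (3 * δ) :=
      h1.trans (mul_le_mul_of_nonneg_left (hnoise j hj) (by positivity))
    have h3 := abs_le.1 h2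
    have h4 : ((x i : ℤ) : ℝ) * (Real.log ((1 - p j) / p j) *
        ((message ω.design (ω.answers x) z j i : ℤ) : ℝ)) = llr (p j) * (noiseSign (ω.1 j).2 *
        ((∏ a ∈ (ω.design j).labels.erase i, (x a * z a) : ℤˣ) : ℤ)) := by
      rw [message, answers_eq, ← Finset.mul_prod_erase _ _ hij, Finset.prod_mul_distrib]
      push_cast
      rw [noiseUnit_cast, llr]
      linear_combination (Real.log ((1 - p j) / p j) * noiseSign (ω.1 j).2 *
        (∏ a ∈ (ω.design j).labels.erase i, ((x a : ℤ) : ℝ)) *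
        ∏ a ∈ (ω.design j).labels.erase i, ((z a : ℤ) : ℝ)) * unit_cast_mul_self (x i)
    rw [h4]
    by_cases hjR : j ∈ R
    · rw [if_pos hjR]
      have h5 := llr_le hl he1 he2
      have h6 := llr_nonneg (hl.trans_le he1) he2
      have h7 := llr_le hl (hp1 j) (hp2 j)
      have h8 := llr_nonneg (hl.trans_le (hp1 j)) (hp2 j)
      have h9 : 2 / lam = 1 / lam + 1 / lam := by ring
      have h10 := (abs_nonneg _).trans h2
      rcases hsign j with h | h <;>
        rcases Int.units_eq_one_or (∏ a ∈ (ω.design j).labels.erase i, (x a * z a)) with h' | h' <;>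
        rw [h, h'] <;> push_cast <;> linarith
    · rw [if_neg hjR]
      have h5 : ∏ a ∈ (ω.design j).labels.erase i, (x a * z a) = 1 := by
        refine Finset.prod_eq_one fun a ha => ?_
        rw [hest a (not_le.1 fun hv => hjR (Finset.mem_filter.2 ⟨hj, a, ha, hv⟩))]
        exact Int.units_mul_self _
      rw [h5]
      push_cast
      rcases hsign j with h | h <;> rw [h] <;> linarith [h3.1, h3.2]
  refine lt_of_lt_of_le ?_ (Finset.sum_le_sum hterm)
  rw [Finset.sum_sub_distrib, Finset.sum_ite_mem, Finset.sum_const, nsmul_eq_mul]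
  have hinter : ((S₄ ∩ R).card : ℝ) ≤ K := by
    exact_mod_cast (Finset.card_le_card Finset.inter_subset_right).trans hRK
  have hrem : ∑ j ∈ queries4 ω.design i \ S₄,
      (llr (e j) * noiseSign (ω.1 j).2 - 2 / lam * (3 * δ)) ≤ 3 * (1 / lam) := by
    refine (Finset.sum_le_card_nsmul _ _ (1 / lam) fun j hj => ?_).trans ?_
    · obtain ⟨he1, he2⟩ := he j (Finset.mem_sdiff.1 hj).1
      have h5 := llr_le hl he1 he2
      have h6 := llr_nonneg (hl.trans_le he1) he2
      have h7 : 0 ≤ 2 / lam * (3 * δ) := by positivity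
      rcases hsign j with h | h <;> rw [h] <;> linarith
    · rw [nsmul_eq_mul]
      exact mul_le_mul_of_nonneg_right (by exact_mod_cast hcard) hl0
  rw [← Finset.sum_sdiff hsub] at hvote
  have h1 : (2 * K + 3) / lam = K * (2 / lam) + 3 * (1 / lam) := by ring
  have h2 : ((S₄ ∩ R).card : ℝ) * (2 / lam) ≤ K * (2 / lam) := by gcongr
  linarith

variable [NeZero w] {D : ℕ} {Φ : PMF ℕ} {ε : Fin w → ℕ → unitInterval}

/-- The conditions under which the algorithm recovers every label: no label has two loops in its
graph; fewer than `K` labels below the fourth-set queries of a label, or below the third-set queries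
of a worker node, have wrong second estimates; the votes with the true weights are clear, with room
for the errors of the estimated weights (at most `2 / lam * (3 * δ)` for each query) and for the
removed or misled queries; and each worker node has more than `θ` third-set queries, whose proportion
of wrong answers is within `δ` of its mean. -/
structure Good (lam δ θ : ℝ) (K D : ℕ) (Φ : PMF ℕ) (ε : Fin w → ℕ → unitInterval)
    (ω : Fin n → Query m w × Bool) : Prop where
  uncrowded : ∀ i, ¬ Crowded (designOf ω) i
  label_wrong : ∀ i, ((((queries4 (designOf ω) i).biUnion fun j => (ω j).1.labels).filter
    fun a => vote ω a ≤ 0).card < K)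
  final_vote : ∀ i, (2 * K + 3) / lam < ∑ j ∈ queries4 (designOf ω) i,
    (llr (ε (ω j).1.worker (ω j).1.degree) * noiseSign (ω j).2 - 2 / lam * (3 * δ))
  node_wrong : ∀ k, ∀ d ∈ Finset.Icc 1 D, Φ d ≠ 0 →
    ((((nodeQueries ω k d).biUnion fun j => (ω j).1.labels).filter
      fun a => vote ω a ≤ 0).card < K)
  node_card : ∀ k, ∀ d ∈ Finset.Icc 1 D, Φ d ≠ 0 → θ < ((nodeQueries ω k d).card : ℝ)
  node_noise : ∀ k, ∀ d ∈ Finset.Icc 1 D, Φ d ≠ 0 → ∀ σ : ℝ, |σ| = 1 →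
    ∑ j ∈ nodeQueries ω k d, (σ * ((if (ω j).2 then 1 else 0) - (ε k d : ℝ)) - δ) < 0


/-- Outside the exceptional events the algorithm returns the true labels. -/
theorem algorithm_eq {lam δ θ : ℝ} {K : ℕ} (hΦ : Φ.support ⊆ Set.Icc 1 D) (hD : D ≤ m)
    (hmn : m ≤ n) (hl : 0 < lam) (hl2 : lam ≤ 1 / 2)
    (hε : ∀ k, ∀ d ∈ Finset.Icc 1 D, lam ≤ (ε k d : ℝ) ∧ (ε k d : ℝ) ≤ 1 / 2) (hδ : 0 < δ)
    (hθ : 5 < θ) (hK : K + 10 + 5 * δ ≤ 2 * δ * (θ - 5)) (rule : PruningRule m w n)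
    (x : Fin m → ℤˣ) (ω : Sample m w n) (hgood : Good lam δ θ K D Φ ε ω.1)
    (hsupp : ∀ j, weight m w n Φ ε j (ω.1 j) ≠ 0) (i : Fin m) :
    algorithm lam rule ω.design (ω.answers x) ω.2.1 ω.2.2 i = some (x i) := by
  classical
  have hfirst : ∀ (j : Fin n) (hj : (j : ℕ) < m), (ω.design j).labels = {⟨j, hj⟩} :=
    fun j hj => labels_of_weight_ne_zero j hj _ (hsupp j)
  have hest := fun a (ha : 0 < vote ω.1 a) => est2_eq x ω hmn hfirst (ω.2.1 i) ha
  obtain ⟨S₄, S₃, hr, h4, h3, c4, c3, hpair⟩ :=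
    Phase0.eq_some (hgood.uncrowded i) (rule.valid ω.design i)
  rw [algorithm, hr]
  have hdeg : ∀ j ∈ queries4 ω.design i,
      (ω.design j).degree ∈ Finset.Icc 1 D ∧ Φ (ω.design j).degree ≠ 0 := by
    intro j hj
    have hjm : m ≤ (j : ℕ) := by
      have := mem_A4.1 (Finset.mem_filter.1 hj).1
      omega
    exact degree_of_weight_ne_zero hΦ hD j hjm _ (hsupp j)
  have hkid : ∀ j ∈ S₃, kids ω.design i j = (ω.design j).labels := fun j hj =>
    if_neg (disjoint_A3_A4 (Finset.mem_filter.1 (h3 hj)).1)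
  have hkid4 : ∀ j ∈ S₄, kids ω.design i j = (ω.design j).labels.erase i := fun j hj =>
    if_pos (Finset.mem_filter.1 (h4 hj)).1
  have hdis : ∀ j ∈ S₄ ∪ S₃, ∀ j' ∈ S₄ ∪ S₃, j ≠ j' →
      Disjoint (kids ω.design i j) (kids ω.design i j') := by
    intro j hj j' hj' hne
    by_contra h
    exact hpair j hj j' hj' ⟨hne, h⟩
  refine congrArg some (est4_eq x ω (ω.2.1 i) (ω.2.2 i) i hest hl hl2 hδ.le
    (e := fun j => ε (ω.design j).worker (ω.design j).degree) h4 c4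
    (fun j hj => hε _ _ (hdeg j hj).1) ?_ ?_ (hgood.label_wrong i) (hgood.final_vote i))
  · intro j hj
    obtain ⟨hd, hΦd⟩ := hdeg j (h4 hj)
    obtain ⟨he1, he2⟩ := hε (ω.design j).worker _ hd
    refine abs_noiseEst_sub_le x ω (ω.2.1 i) hest he1 he2 (hl.le.trans he1) hδ hθ hK _ _ S₃ ?_ ?_ ?_
      (hgood.node_wrong _ _ hd hΦd) (hgood.node_card _ _ hd hΦd) (hgood.node_noise _ _ hd hΦd)
    · intro j' hj'
      obtain ⟨h, hn⟩ := Finset.mem_filter.1 hj'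
      exact Finset.mem_filter.2 ⟨(Finset.mem_filter.1 (h3 h)).1, hn⟩
    · refine (Finset.card_le_card fun j' hj' => ?_).trans c3
      obtain ⟨hF, hnot⟩ := Finset.mem_sdiff.1 hj'
      obtain ⟨hA, hn⟩ := Finset.mem_filter.1 hF
      refine Finset.mem_sdiff.2 ⟨Finset.mem_filter.2 ⟨hA, Finset.mem_image.2
        ⟨j, hj, Prod.ext hn.1.symm hn.2.symm⟩⟩, fun h => hnot (Finset.mem_filter.2 ⟨h, hn⟩)⟩
    · intro j' hj' j'' hj'' hne
      have := hdis j' (Finset.mem_union_right _ hj') j'' (Finset.mem_union_right _ hj'') hne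
      rwa [hkid _ hj', hkid _ hj''] at this
  · intro j hj j' hj' hne
    have := hdis j (Finset.mem_union_left _ hj) j' (Finset.mem_union_left _ hj') hne
    rwa [hkid4 _ hj, hkid4 _ hj'] at this

end Algorithm

section UnionBound

/-! ### The failure probability for a given number of labels -/

variable {m w n : ℕ}

theorem card_filter_between {a b : ℕ} (hb : b ≤ n) :
    (Finset.univ.filter fun j : Fin n => a ≤ (j : ℕ) ∧ (j : ℕ) < b).card = b - a := by
  rw [← Finset.card_map Fin.valEmbedding, ← Nat.card_Ico]
  congr 1
  ext x
  simp only [Finset.mem_map, Finset.mem_filter, Finset.mem_univ, true_and, Fin.valEmbedding_apply,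
    Finset.mem_Ico]
  exact ⟨fun ⟨j, hj, h⟩ => h ▸ hj, fun h => ⟨⟨x, h.2.trans_le hb⟩, h, rfl⟩⟩

theorem card_A2 (h : m + size2 m ≤ n) : (A2 m n).card = size2 m := by
  rw [A2, card_filter_between h, Nat.add_sub_cancel_left]

theorem card_A3 (h : m + size2 m + size3 m w ≤ n) : (A3 m w n).card = size3 m w := by
  rw [A3, card_filter_between h, Nat.add_sub_cancel_left]

theorem card_A4 : (A4 m w n).card = n - (m + size2 m + size3 m w) := by
  rw [← card_filter_between (n := n) le_rfl, A4]
  congr 1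
  ext j
  simp

theorem nodeQueries_update {j : Fin n} (hj : j ∈ A2 m n) (ω : Fin n → Query m w × Bool)
    (x : Query m w × Bool) (k : Fin w) (d : ℕ) :
    ((nodeQueries (Function.update ω j x) k d).biUnion
      fun q => (Function.update ω j x q).1.labels) =
    (nodeQueries ω k d).biUnion fun q => (ω q).1.labels := by
  have hne : ∀ q ∈ A3 m w n, Function.update ω j x q = ω q := by
    intro q hq
    refine Function.update_of_ne ?_ _ _
    rintro rfl
    rw [mem_A2] at hj
    rw [mem_A3] at hq
    omega
  refine Finset.biUnion_congr (Finset.filter_congr fun q hq => by rw [hne q hq]) fun q hq => ?_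
  rw [hne q (Finset.mem_filter.1 hq).1]

theorem queries4_update {j : Fin n} (hj : j ∈ A2 m n) (ω : Fin n → Query m w × Bool)
    (x : Query m w × Bool) (i : Fin m) :
    ((queries4 (designOf (Function.update ω j x)) i).biUnion
      fun q => (Function.update ω j x q).1.labels) =
    (queries4 (designOf ω) i).biUnion fun q => (ω q).1.labels := by
  have hne : ∀ q ∈ A4 m w n, Function.update ω j x q = ω q := by
    intro q hq
    refine Function.update_of_ne ?_ _ _
    rintro rfl
    rw [mem_A2] at hj
    rw [mem_A4] at hq
    omega
  refine Finset.biUnion_congr (Finset.filter_congr fun q hq => ?_) fun q hq => ?_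
  · change i ∈ (Function.update ω j x q).1.labels ↔ i ∈ (ω q).1.labels
    rw [hne q hq]
  · rw [hne q (Finset.mem_filter.1 hq).1]


variable [NeZero w] {D : ℕ} {Φ : PMF ℕ} {ε : Fin w → ℕ → unitInterval}

/-- The union bound over all exceptional events. The seven terms are due, in this order, to the
first estimates, the loops in the inference graphs, the wrong second estimates that the final votes
use, the noise in the final votes, the wrong second estimates that the estimates of the noise
parameters use, worker nodes with few third-set queries, and the noise in the answers to these. -/
theorem law_failure_le (hΦ : Φ.support ⊆ Set.Icc 1 D) (hD : D ≤ m)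
    (hsize : m + size2 m + size3 m w ≤ n) {lam δ θ ρ v t s p₁ φ : ℝ} {K : ℕ} (hl : 0 < lam)
    (hl2 : lam ≤ 1 / 2)
    (hε : ∀ k, ∀ d ∈ Finset.Icc 1 D, lam ≤ (ε k d : ℝ) ∧ (ε k d : ℝ) < 1 / 2)
    (hε₁ : (∑ k, (ε k 1 : ℝ)) / w ≤ p₁) (hδ : 0 < δ) (hδ2 : δ ≤ 2)
    (hθ : 5 < θ) (hK : K + 10 + 5 * δ ≤ 2 * δ * (θ - 5)) (hm : LargeFor D ρ m) (hρ : 0 < ρ)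
    (hρ2 : ρ ≤ 2) (hρ1 : 2 * ρ ≤ 1 - 2 * p₁) (hs : 0 ≤ s) (hs1 : s ≤ 1)
    (hv : v ≤ advantage w D Φ ε) (ht : 0 ≤ t) (ht1 : t * D ≤ 1)
    (hφ : ∀ d, Φ d ≠ 0 → φ ≤ (Φ d).toReal) (rule : PruningRule m w n) (x : Fin m → ℤˣ) :
    law m w n Φ ε (failure lam rule x) ≤ ENNReal.ofReal (
      Real.exp (-(m * (s * ρ - s ^ 2))) +
      m * (17 * (17 * (queryFactor D ^ 16 * ((m : ℝ) ^ 2)⁻¹ * (1 + n / m : ℝ) ^ 16 *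
        (1 + size3 m w / w : ℝ) ^ 16)) +
        Real.exp (2 ^ D * D * (n / m)) *
          Real.exp (-(size2 m * (K / m * (t * (ρ / 2) ^ D * v - t ^ 2 * D ^ 2)))) +
        Real.exp ((2 * K + 3) / lam / 2) * Real.exp (-((n - (m + size2 m + size3 m w) : ℝ) *
          ((capacity w D Φ ε - D * (Real.exp (2 / lam * (3 * δ) / 2) - 1)) / m)))) +
      w * D * (Real.exp (2 ^ D * (size3 m w / w)) *
          Real.exp (-(size2 m * (K / m * (t * (ρ / 2) ^ D * v - t ^ 2 * D ^ 2)))) +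
        Real.exp θ * Real.exp (-(size3 m w * (φ / (2 * w)))) +
        2 * Real.exp (-(size3 m w * ((1 - Real.exp (-(δ ^ 2 / 4))) * φ / w))))) := by
  classical
  set p := weight m w n Φ ε with hp
  have hmn : m ≤ n := by omega
  have hw : (0 : ℝ) < w := by exact_mod_cast Nat.pos_of_ne_zero (NeZero.ne w)
  set E₁ : Set (Fin n → Query m w × Bool) := {ω | ¬ ρ * m ≤ ∑ b, firstSign ω b} with hE₁
  let C : Fin m → Set (Fin n → Query m w × Bool) := fun i => {ω | Crowded (designOf ω) i}
  let L : Fin m → Set (Fin n → Query m w × Bool) := fun i => {ω | ρ * m ≤ ∑ b, firstSign ω b ∧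
    K ≤ (((queries4 (designOf ω) i).biUnion fun j => (ω j).1.labels).filter
      fun a => vote ω a ≤ 0).card}
  let V : Fin m → Set (Fin n → Query m w × Bool) := fun i => {ω | ∑ j ∈ queries4 (designOf ω) i,
    (llr (ε (ω j).1.worker (ω j).1.degree) * noiseSign (ω j).2 - 2 / lam * (3 * δ)) ≤
      (2 * K + 3) / lam}
  let W : Fin w × ℕ → Set (Fin n → Query m w × Bool) := fun a => {ω | ρ * m ≤ ∑ b, firstSign ω b ∧
    K ≤ (((nodeQueries ω a.1 a.2).biUnion fun j => (ω j).1.labels).filter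
      fun b => vote ω b ≤ 0).card}
  let N : Fin w × ℕ → Set (Fin n → Query m w × Bool) := fun a =>
    {ω | ((nodeQueries ω a.1 a.2).card : ℝ) ≤ θ}
  let X : ℝ → Fin w × ℕ → Set (Fin n → Query m w × Bool) := fun σ a =>
    {ω | 0 ≤ ∑ j ∈ nodeQueries ω a.1 a.2,
      (σ * ((if (ω j).2 then 1 else 0) - (ε a.1 a.2 : ℝ)) - δ)}
  let nodes : Finset (Fin w × ℕ) :=
    Finset.univ ×ˢ (Finset.Icc 1 D).filter fun d => Φ d ≠ 0
  have hnodes : ∀ {a}, a ∈ nodes ↔ a.2 ∈ Finset.Icc 1 D ∧ Φ a.2 ≠ 0 := fun {a} => by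
    simp [nodes]
  have hcm : ((Finset.univ : Finset (Fin m)).card : ℝ) ≤ m := by simp
  have hcn : (nodes.card : ℝ) ≤ w * D := by
    have : nodes.card ≤ w * D := by
      rw [Finset.card_product, Finset.card_univ, Fintype.card_fin]
      refine Nat.mul_le_mul_left _ ((Finset.card_filter_le _ _).trans ?_)
      simp
    exact_mod_cast this
  set bad : Set (Fin n → Query m w × Bool) := E₁ ∪
    {ω | ∃ i ∈ Finset.univ, ω ∈ C i ∪ L i ∪ V i} ∪
    {ω | ∃ a ∈ nodes, ω ∈ W a ∪ N a ∪ (X 1 a ∪ X (-1) a)} with hbad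
  -- outside the exceptional events the algorithm succeeds
  have hfail : ∀ ω ∈ failure lam rule x, ω.1 ∈ {ω | (∀ j, p j (ω j) ≠ 0) → ω ∈ bad} := by
    rintro ω ⟨i, hi⟩ hsupp
    by_contra hnot
    have h1 : ρ * m ≤ ∑ b, firstSign ω.1 b := by
      by_contra h
      exact hnot (.inl (.inl h))
    have h2 : ∀ i, ω.1 ∉ C i ∪ L i ∪ V i := fun i h =>
      hnot (.inl (.inr ⟨i, Finset.mem_univ _, h⟩))
    have h3 : ∀ k, ∀ d ∈ Finset.Icc 1 D, Φ d ≠ 0 →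
        ω.1 ∉ W (k, d) ∪ N (k, d) ∪ (X 1 (k, d) ∪ X (-1) (k, d)) := fun k d hd hd' h =>
      hnot (.inr ⟨(k, d), hnodes.2 ⟨hd, hd'⟩, h⟩)
    refine hi (algorithm_eq hΦ hD hmn hl hl2 (fun k d hd => ⟨(hε k d hd).1, (hε k d hd).2.le⟩) hδ
      hθ hK rule x ω ⟨fun i h => h2 i (.inl (.inl h)), fun i => ?_, fun i => ?_,
        fun k d hd hd' => ?_, fun k d hd hd' => ?_, fun k d hd hd' σ hσ => ?_⟩ hsupp i)
    · exact not_le.1 fun h => h2 i (.inl (.inr ⟨h1, h⟩))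
    · exact not_le.1 fun h => h2 i (.inr h)
    · exact not_le.1 fun h => h3 k d hd hd' (.inl (.inl ⟨h1, h⟩))
    · exact not_le.1 fun h => h3 k d hd hd' (.inl (.inr h))
    · rcases eq_or_eq_neg_of_abs_eq hσ with rfl | rfl
      · exact not_le.1 fun h => h3 k d hd hd' (.inr (.inl h))
      · exact not_le.1 fun h => h3 k d hd hd' (.inr (.inr h))
  refine (law_le_pr _ _ hfail).trans (ENNReal.ofReal_le_ofReal ?_)
  refine (pr_mono (E := {ω | (∀ j, p j (ω j) ≠ 0) → ω ∈ bad}) (F := bad) weight_nonneg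
    fun ω hω h => h hω).trans ?_
  refine (pr_union_le weight_nonneg _ _).trans (add_le_add
    ((pr_union_le weight_nonneg _ _).trans (add_le_add ?_ ?_)) ?_)
  · exact pr_firstSign_le hmn hε₁ hρ1 hs hs1
  · refine (pr_exists_le weight_nonneg _ _).trans
      ((Finset.sum_le_card_nsmul _ _ _ fun i _ => ?_).trans
        ((nsmul_eq_mul _ _).trans_le (mul_le_mul_of_nonneg_right hcm (by positivity))))
    refine (pr_union_le weight_nonneg _ _).trans (add_le_add
      ((pr_union_le weight_nonneg _ _).trans (add_le_add ?_ ?_)) ?_)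
    · exact pr_crowded_le hΦ hD i
    · refine (pr_many_wrong_le hΦ hD hm hρ hρ2 (fun k d hd => (hε k d hd).2) hv ht ht1 _
        (fun j hj ω y => queries4_update hj ω y i) K).trans ?_
      rw [card_A2 (by omega), ← Real.exp_nat_mul, mul_neg]
      exact mul_le_mul_of_nonneg_right (expect_two_pow_label_le hΦ hD i) (Real.exp_pos _).le
    · refine (pr_final_vote_le hΦ hD i (fun k d hd => hl.trans_le (hε k d hd).1)
        (fun k d hd => (hε k d hd).2.trans (by norm_num)) (by positivity) _).trans (le_of_eq ?_)
      rw [card_A4, ← Real.exp_nat_mul, mul_neg, Nat.cast_sub hsize]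
      push_cast
      rfl
  · refine (pr_exists_le weight_nonneg _ _).trans
      ((Finset.sum_le_card_nsmul _ _ _ fun a ha => ?_).trans
        ((nsmul_eq_mul _ _).trans_le (mul_le_mul_of_nonneg_right hcn (by positivity))))
    obtain ⟨hd, hd'⟩ := hnodes.1 ha
    have hφa := hφ _ hd'
    have hX : ∀ σ : ℝ, |σ| = 1 → pr p (X σ a) ≤
        Real.exp (-(size3 m w * ((1 - Real.exp (-(δ ^ 2 / 4))) * φ / w))) := by
      intro σ hσ
      refine (pr_node_noise_le hΦ hD a.1 hd hδ hδ2 hσ).trans ?_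
      rw [card_A3 hsize, ← Real.exp_nat_mul, mul_neg]
      have h1 : 0 ≤ 1 - Real.exp (-(δ ^ 2 / 4)) :=
        sub_nonneg.2 (Real.exp_le_one_iff.2 (by have := sq_nonneg δ; linarith))
      gcongr
    refine (pr_union_le weight_nonneg _ _).trans (add_le_add
      ((pr_union_le weight_nonneg _ _).trans (add_le_add ?_ ?_)) ?_)
    · refine (pr_many_wrong_le hΦ hD hm hρ hρ2 (fun k d hd => (hε k d hd).2) hv ht ht1 _
        (fun j hj ω y => nodeQueries_update hj ω y a.1 a.2) K).trans ?_
      rw [card_A2 (by omega), ← Real.exp_nat_mul, mul_neg]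
      exact mul_le_mul_of_nonneg_right (expect_two_pow_node_le hΦ hD a.1 hd) (Real.exp_pos _).le
    · refine (pr_node_card_le hΦ hD a.1 hd θ).trans ?_
      rw [card_A3 hsize, ← Real.exp_nat_mul, mul_neg]
      gcongr
    · refine (pr_union_le weight_nonneg _ _).trans ((add_le_add (hX 1 (by simp))
        (hX (-1) (by simp))).trans (le_of_eq ?_))
      ring

end UnionBound

/-! ### Growth rates -/

theorem tendsto_log_nat : Tendsto (fun m : ℕ => Real.log m) atTop atTop :=
  Real.tendsto_log_atTop.comp tendsto_natCast_atTop_atTop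

theorem tendsto_log_log_nat : Tendsto (fun m : ℕ => Real.log (Real.log m)) atTop atTop :=
  Real.tendsto_log_atTop.comp tendsto_log_nat

theorem eventually_mul_log_log_sq_le (B : ℝ) :
    ∀ᶠ m : ℕ in atTop, B * Real.log (Real.log m) ^ 2 ≤ Real.sqrt (Real.log m) := by
  have h1 : Tendsto (fun m : ℕ => Real.sqrt (Real.log m)) atTop atTop :=
    Real.tendsto_sqrt_atTop.comp tendsto_log_nat
  have hB : 0 < 1 / (4 * |B| + 1) := by positivity
  have h2 := h1.eventually ((isLittleO_iff.1 (Real.isLittleO_pow_log_id_atTop (n := 2))) hB)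
  filter_upwards [h2, tendsto_log_nat.eventually_ge_atTop 0] with m hm h0
  rw [Real.log_sqrt h0, Real.norm_eq_abs, abs_of_nonneg (sq_nonneg _), id, Real.norm_eq_abs,
    abs_of_nonneg (Real.sqrt_nonneg _), div_mul_eq_mul_div, one_mul, le_div_iff₀ (by positivity)]
    at hm
  have h3 := mul_le_mul_of_nonneg_right (le_abs_self B) (sq_nonneg (Real.log (Real.log m)))
  nlinarith [sq_nonneg (Real.log (Real.log m))]

theorem eventually_size2 : ∀ᶠ m : ℕ in atTop,
    (m : ℝ) * (Real.log m / (2 * Real.log (Real.log m))) ≤ size2 m ∧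
      (size2 m : ℝ) ≤ m * (Real.log m / Real.log (Real.log m)) := by
  filter_upwards [tendsto_log_nat.eventually_ge_atTop 1, tendsto_log_log_nat.eventually_ge_atTop 1,
    eventually_ge_atTop 2] with m hL hl hm
  have hm : (2 : ℝ) ≤ m := by exact_mod_cast hm
  have h1 : Real.log (Real.log m) ≤ Real.log m := by
    have := Real.log_le_sub_one_of_pos (show 0 < Real.log m by linarith)
    linarith
  have h2 : 1 ≤ Real.log m / Real.log (Real.log m) := (one_le_div (by linarith)).2 h1
  have h3 : 2 ≤ (m : ℝ) * (Real.log m / Real.log (Real.log m)) := by nlinarith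
  refine ⟨?_, Nat.floor_le (by linarith)⟩
  have h4 := (Nat.sub_one_lt_floor ((m : ℝ) * (Real.log m / Real.log (Real.log m)))).le
  have h5 : (m : ℝ) * (Real.log m / (2 * Real.log (Real.log m))) =
      m * (Real.log m / Real.log (Real.log m)) / 2 := by
    rw [mul_comm 2, ← div_div]
    ring
  rw [h5, size2]
  linarith

theorem eventually_size3 (w : ℕ → ℕ) [∀ m, NeZero (w m)] : ∀ᶠ m : ℕ in atTop,
    Real.log m * Real.log (Real.log m) / 2 ≤ size3 m (w m) / w m ∧
      (size3 m (w m) : ℝ) / w m ≤ Real.log m * Real.log (Real.log m) := by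
  filter_upwards [tendsto_log_nat.eventually_ge_atTop 2, tendsto_log_log_nat.eventually_ge_atTop 1]
    with m hL hl
  have hw1 : (1 : ℝ) ≤ w m := by exact_mod_cast Nat.one_le_iff_ne_zero.2 (NeZero.ne (w m))
  have hw : (0 : ℝ) < w m := by linarith
  have h1 : 2 ≤ Real.log m * Real.log (Real.log m) := by nlinarith
  have h2 : 2 ≤ (w m : ℝ) * Real.log m * Real.log (Real.log m) := by
    rw [mul_assoc]
    nlinarith
  rw [le_div_iff₀ hw, div_le_iff₀ hw]
  constructor
  · have h4 := (Nat.sub_one_lt_floor ((w m : ℝ) * Real.log m * Real.log (Real.log m))).le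
    rw [size3]
    linarith
  · rw [mul_comm, ← mul_assoc]
    exact Nat.floor_le (by linarith)

/-- The first three sets are of smaller order than the fourth one. -/
theorem eventually_sizes_le {w : ℕ → ℕ} [∀ m, NeZero (w m)]
    (hw : (fun m : ℕ => (w m : ℝ)) =o[atTop] fun m : ℕ => (m : ℝ) / Real.log (Real.log m))
    {c : ℝ} (hc : 0 < c) :
    ∀ᶠ m : ℕ in atTop, (m + size2 m + size3 m (w m) : ℝ) ≤ c * (m * Real.log m) := by
  filter_upwards [tendsto_log_nat.eventually_ge_atTop (3 / c),
    tendsto_log_log_nat.eventually_ge_atTop (3 / c), tendsto_log_log_nat.eventually_gt_atTop 0,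
    eventually_size2, eventually_size3 w, isLittleO_iff.1 hw (show 0 < c / 3 by positivity)]
    with m hL hl hl0 h2 h3 hwm
  have hwpos : (0 : ℝ) < w m := by exact_mod_cast Nat.pos_of_ne_zero (NeZero.ne (w m))
  have hL0 : 0 < Real.log m := lt_of_lt_of_le (by positivity) hL
  rw [div_le_iff₀ hc] at hL hl
  rw [Real.norm_natCast, Real.norm_eq_abs, abs_of_nonneg (by positivity), ← mul_div_assoc,
    le_div_iff₀ hl0] at hwm
  have hm0 : (0 : ℝ) ≤ m := Nat.cast_nonneg m
  have e1 : (m : ℝ) ≤ c / 3 * (m * Real.log m) := by nlinarith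
  have e2 : (size2 m : ℝ) ≤ c / 3 * (m * Real.log m) := by
    refine h2.2.trans ?_
    rw [← mul_div_assoc, div_le_iff₀ hl0]
    nlinarith [mul_nonneg hm0 hL0.le]
  have e3 : (size3 m (w m) : ℝ) ≤ c / 3 * (m * Real.log m) := by
    have := (div_le_iff₀ hwpos).1 h3.2
    nlinarith
  linarith

theorem eventually_le_of_isLittleO {w : ℕ → ℕ}
    (hw : (fun m : ℕ => (w m : ℝ)) =o[atTop] fun m : ℕ => (m : ℝ) / Real.log (Real.log m)) :
    ∀ᶠ m : ℕ in atTop, (w m : ℝ) ≤ m := by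
  filter_upwards [tendsto_log_log_nat.eventually_ge_atTop 1, isLittleO_iff.1 hw one_pos]
    with m hl hwm
  have h0 : 0 < Real.log (Real.log m) := by linarith
  rw [Real.norm_natCast, Real.norm_eq_abs, abs_of_nonneg (by positivity), one_mul] at hwm
  exact hwm.trans (div_le_self (Nat.cast_nonneg m) hl)

theorem eventually_largeFor (D : ℕ) {ρ : ℝ} (hρ : 0 < ρ) : ∀ᶠ m : ℕ in atTop, LargeFor D ρ m := by
  have h0 : Tendsto (fun m : ℕ => 1 / (m : ℝ)) atTop (𝓝 0) := tendsto_one_div_atTop_nhds_zero_nat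
  have h1 : ∀ k ∈ Finset.range (D + 1), ∀ᶠ m : ℕ in atTop,
      (ρ / 2) ^ k ≤ (ρ - 1 / m) ^ k - (k : ℝ) ^ 2 / m := by
    intro k _
    rcases Nat.eq_zero_or_pos k with rfl | hk
    · simp
    have h2 : Tendsto (fun m : ℕ => (ρ - 1 / (m : ℝ)) ^ k - (k : ℝ) ^ 2 * (1 / m)) atTop
        (𝓝 ((ρ - 0) ^ k - (k : ℝ) ^ 2 * 0)) :=
      ((tendsto_const_nhds.sub h0).pow k).sub (tendsto_const_nhds.mul h0)
    rw [sub_zero, mul_zero, sub_zero] at h2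
    have h3 : (ρ / 2) ^ k < ρ ^ k := pow_lt_pow_left₀ (by linarith) (by positivity) hk.ne'
    filter_upwards [h2.eventually_const_lt h3] with m hm
    rw [mul_one_div] at hm
    exact hm.le
  filter_upwards [h0.eventually_le_const hρ, (Finset.eventually_all _).2 h1] with m hm hk
  exact ⟨hm, fun k hkD => hk k (Finset.mem_range.2 (by omega))⟩

/-! ### The capacity -/

section Capacity

variable {w D : ℕ} {Φ : PMF ℕ} {ε : Fin w → ℕ → unitInterval}

/-- Compares the rate at which a query reveals a label with the mean of its message. -/
theorem sqrt_sub_sqrt_sq_le {p : ℝ} (hp : 0 ≤ p) (hp2 : p ≤ 1 / 2) :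
    (Real.sqrt (1 - p) - Real.sqrt p) ^ 2 ≤ 1 - 2 * p := by
  have h1 := Real.sq_sqrt hp
  have h2 := Real.sq_sqrt (show 0 ≤ 1 - p by linarith)
  have h3 : Real.sqrt p ≤ Real.sqrt (1 - p) := Real.sqrt_le_sqrt (by linarith)
  nlinarith [Real.sqrt_nonneg p]

theorem capacity_le_advantage (hε : ∀ k, ∀ d ∈ Finset.Icc 1 D, (ε k d : ℝ) < 1 / 2) :
    capacity w D Φ ε ≤ advantage w D Φ ε := by
  refine Finset.sum_le_sum fun d hd => ?_
  rw [← mul_assoc, Finset.mul_sum]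
  refine Finset.sum_le_sum fun k _ => ?_
  rw [← div_eq_mul_inv]
  exact mul_le_mul_of_nonneg_left (sqrt_sub_sqrt_sq_le (ε k d).2.1 (hε k d hd).le) (by positivity)

theorem advantage_le [NeZero w] (hΦ : Φ.support ⊆ Set.Icc 1 D) : advantage w D Φ ε ≤ D := by
  have hw : (w : ℝ) ≠ 0 := Nat.cast_ne_zero.2 (NeZero.ne w)
  calc advantage w D Φ ε ≤ ∑ d ∈ Finset.Icc 1 D, (D : ℝ) * (Φ d).toReal := by
        refine Finset.sum_le_sum fun d hd => ?_
        have h1 : (w : ℝ)⁻¹ * ∑ k, (1 - 2 * (ε k d : ℝ)) ≤ 1 := by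
          calc (w : ℝ)⁻¹ * ∑ k, (1 - 2 * (ε k d : ℝ)) ≤ (w : ℝ)⁻¹ * ∑ _k : Fin w, (1 : ℝ) := by
                gcongr with k
                linarith [(ε k d).2.1]
            _ = 1 := by simp [hw]
        have h2 : (d : ℝ) ≤ D := by exact_mod_cast (Finset.mem_Icc.1 hd).2
        calc _ ≤ (d : ℝ) * (Φ d).toReal * 1 := by gcongr
          _ ≤ _ := by rw [mul_one]; gcongr
    _ = D := by rw [← Finset.mul_sum, sum_degree hΦ, mul_one]

theorem capacity_pos [NeZero w] (hΦ : Φ.support ⊆ Set.Icc 1 D)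
    (hε : ∀ k, ∀ d ∈ Finset.Icc 1 D, (ε k d : ℝ) < 1 / 2) : 0 < capacity w D Φ ε := by
  obtain ⟨d, hd⟩ := Φ.support_nonempty
  have hd' : d ∈ Finset.Icc 1 D := Finset.mem_Icc.2 (hΦ hd)
  have hd1 : (0 : ℝ) < d := by exact_mod_cast (hΦ hd).1
  have hw : (0 : ℝ) < w := by exact_mod_cast Nat.pos_of_ne_zero (NeZero.ne w)
  have hΦd : 0 < (Φ d).toReal :=
    ENNReal.toReal_pos ((Φ.mem_support_iff d).1 hd) (Φ.apply_ne_top d)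
  refine Finset.sum_pos' (fun d _ => Finset.sum_nonneg fun k _ => by positivity)
    ⟨d, hd', Finset.sum_pos (fun k _ => ?_) ⟨0, Finset.mem_univ _⟩⟩
  have h1 : Real.sqrt (ε k d) < Real.sqrt (1 - ε k d) :=
    Real.sqrt_lt_sqrt (ε k d).2.1 (by linarith [hε k d hd'])
  have h2 : 0 < (Real.sqrt (1 - (ε k d : ℝ)) - Real.sqrt (ε k d : ℝ)) ^ 2 :=
    pow_pos (sub_pos.2 h1) 2
  positivity

/-- As `Φ` has finite support, its positive values are bounded away from zero. -/
theorem exists_le_of_ne_zero (hΦ : Φ.support ⊆ Set.Icc 1 D) :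
    ∃ φ : ℝ, 0 < φ ∧ ∀ d, Φ d ≠ 0 → φ ≤ (Φ d).toReal := by
  have hfin : Φ.support.Finite := (Set.finite_Icc 1 D).subset hΦ
  obtain ⟨d, hd, hmin⟩ := hfin.exists_minimalFor (fun d => (Φ d).toReal) _ Φ.support_nonempty
  refine ⟨(Φ d).toReal, ENNReal.toReal_pos ((Φ.mem_support_iff d).1 hd) (Φ.apply_ne_top d),
    fun e he => ?_⟩
  exact (le_total _ _).elim id fun h => hmin ((Φ.mem_support_iff e).2 he) h

end Capacity

/-! ### The exceptional events for a growing number of labels -/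

/-- The expected number of labels with two loops in their graphs is at most polylogarithmic in `M`,
divided by `M`. -/
theorem loops_le {M N r L l C q : ℝ} (hM : 0 < M) (hN : 0 ≤ N) (hr : 0 ≤ r) (hL : 1 ≤ L)
    (hlL : l ≤ L) (hq : 0 ≤ q) (hC : 0 ≤ C) (hNC : N ≤ C * (M * L)) (hrL : r ≤ L * l) :
    M * (17 * (17 * (q * (M ^ 2)⁻¹ * (1 + N / M) ^ 16 * (1 + r) ^ 16))) ≤
      289 * q * (1 + C) ^ 16 * 2 ^ 16 * (L ^ 48 / M) := by
  have h1 : 1 + N / M ≤ (1 + C) * L := by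
    have : N / M ≤ C * L := by
      rw [div_le_iff₀ hM]
      linarith
    linarith
  have h2 : 1 + r ≤ 2 * L ^ 2 := by nlinarith
  calc M * (17 * (17 * (q * (M ^ 2)⁻¹ * (1 + N / M) ^ 16 * (1 + r) ^ 16)))
      ≤ M * (17 * (17 * (q * (M ^ 2)⁻¹ * ((1 + C) * L) ^ 16 * (2 * L ^ 2) ^ 16))) := by gcongr
    _ = 289 * q * (1 + C) ^ 16 * 2 ^ 16 * (L ^ 48 / M) := by
        field_simp
        ring

/-- If the error probability decreases by a factor `exp (-Y)`, where `Y` exceeds the exponent `b`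
of the crude bound by `2 log M`, then a union bound over `M` events leaves `1 / M`. -/
theorem mul_exp_mul_exp_le {M b Y : ℝ} (hM : 0 < M) (h : b + 2 * Real.log M ≤ Y) :
    M * (Real.exp b * Real.exp (-Y)) ≤ 1 / M := by
  have h1 : M = Real.exp (Real.log M) := (Real.exp_log hM).symm
  have h2 : 1 / M = Real.exp (-Real.log M) := by rw [Real.exp_neg, Real.exp_log hM, one_div]
  rw [h2]
  nth_rewrite 1 [h1]
  rw [← Real.exp_add, ← Real.exp_add, Real.exp_le_exp]
  linarith

/-- The accuracy `δ` of the estimated noise parameters under which the estimated weights cost a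
negligible part of the exponent. -/
theorem exists_accuracy (C D : ℝ) {lam η : ℝ} (hη : 0 < η) :
    ∃ δ : ℝ, 0 < δ ∧ δ ≤ 2 ∧ C * (D * (Real.exp (2 / lam * (3 * δ) / 2) - 1)) ≤ η / 4 := by
  have h1 : Tendsto (fun δ : ℝ => C * (D * (Real.exp (2 / lam * (3 * δ) / 2) - 1))) (𝓝[>] 0)
      (𝓝 (C * (D * (Real.exp (2 / lam * (3 * 0) / 2) - 1)))) := by
    refine Tendsto.mono_left (Continuous.tendsto ?_ 0) nhdsWithin_le_nhds
    fun_prop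
  rw [mul_zero, mul_zero, zero_div, Real.exp_zero, sub_self, mul_zero, mul_zero] at h1
  have h2 := h1.eventually_le_const (show 0 < η / 4 by positivity)
  obtain ⟨δ, h⟩ := (h2.and (Ioc_mem_nhdsGT (show (0 : ℝ) < 2 by norm_num))).exists
  exact ⟨δ, h.2.1, h.2.2, h.1⟩

/-- The error probability of the final votes: if the number `N` of queries exceeds the optimal one
by the factor `1 + η`, then the exponent exceeds `log M`, with room for the losses. -/
theorem final_votes_le {M N S L cap C η x K lam D : ℝ} (hM : 0 < M) (hL : Real.log M = L)
    (hx : 0 ≤ x) (hS : 0 ≤ S) (hcap : (1 + η) * (M * L) ≤ N * cap)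
    (hN : N ≤ C * (M * L)) (hL0 : 0 ≤ L) (hxC : C * x ≤ η / 4) (hcapD : cap ≤ D)
    (hS' : D * S ≤ η / 4 * (M * L)) (hK : (2 * K + 3) / lam / 2 ≤ η / 4 * L) :
    M * (Real.exp ((2 * K + 3) / lam / 2) * Real.exp (-((N - S) * ((cap - x) / M)))) ≤
      Real.exp (-(η / 4 * L)) := by
  have h1 : (1 + η / 2) * L ≤ (N - S) * ((cap - x) / M) := by
    rw [← mul_div_assoc, le_div_iff₀ hM]
    have e1 : N * x ≤ η / 4 * (M * L) := by
      have h : 0 ≤ M * L := by positivity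
      nlinarith
    have e2 : S * cap ≤ η / 4 * (M * L) := by nlinarith
    nlinarith [mul_nonneg hS hx]
  nth_rewrite 1 [← Real.exp_log hM]
  rw [hL, ← Real.exp_add, ← Real.exp_add, Real.exp_le_exp]
  linarith

/-- The requirement on the number `K` of wrong second estimates for the noise parameters to be
estimated accurately, where `Q` is the root of `L = log m`. -/
theorem accuracy_le {L l r φ δ Q K : ℝ} (hφ : 0 < φ) (hδ : 0 < δ) (hQ : 1 ≤ Q) (hQL : Q * Q = L)
    (hl : 1 ≤ l) (hr : L * l / 2 ≤ r) (hQδ : (12 + 15 * δ) / (δ * φ / 4) ≤ Q) (hK : K ≤ 2 * Q) :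
    K + 10 + 5 * δ ≤ 2 * δ * (φ / 4 * r - 5) := by
  rw [div_le_iff₀ (by positivity)] at hQδ
  have hL : 0 ≤ L := by nlinarith
  have h4 : δ * φ / 4 * L ≤ 2 * δ * (φ / 4 * r) := by
    have h5 : L / 2 ≤ r := by nlinarith
    calc δ * φ / 4 * L = 2 * δ * (φ / 4 * (L / 2)) := by ring
      _ ≤ _ := by gcongr
  have h6 : (12 + 15 * δ) * Q ≤ δ * φ / 4 * L := by
    calc (12 + 15 * δ) * Q ≤ Q * (δ * φ / 4) * Q := by gcongr
      _ = δ * φ / 4 * (Q * Q) := by ring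
      _ = _ := by rw [hQL]
  nlinarith

/-- The exponent of the probability that `K` of the second estimates are wrong. -/
theorem many_wrong_exponent_ge {M m L l Q κ K S : ℝ} (hm : 0 < m) (hκ : 0 < κ) (hL : 0 ≤ L)
    (hl : 1 ≤ l) (hQ : 0 ≤ Q) (hQM : 2 * M / κ * l ^ 2 ≤ Q) (hK : Q ≤ K)
    (hS : m * (L / (2 * l)) ≤ S) : M * (L * l) ≤ S * (K / m * κ) := by
  have h4 : M * l ^ 2 ≤ κ / 2 * Q := by
    have : 2 * M / κ * l ^ 2 = M * l ^ 2 / (κ / 2) := by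
      field_simp
    rw [this, div_le_iff₀ (by positivity)] at hQM
    linarith
  have h5 : M * (L * l) ≤ L / (2 * l) * (Q * κ) := by
    rw [div_mul_eq_mul_div, le_div_iff₀ (by linarith)]
    nlinarith
  have h6 : 0 ≤ S := le_trans (by positivity) hS
  calc M * (L * l) ≤ L / (2 * l) * (Q * κ) := h5
    _ = m * (L / (2 * l)) * (Q / m * κ) := by
        field_simp
    _ ≤ S * (K / m * κ) := by
        gcongr

theorem mul_le_mul_of_div_le {b c L l r : ℝ} (hc : 0 < c) (hL : 0 ≤ L) (hl : b / c ≤ l)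
    (hr : L * l / 2 ≤ r) : b / 2 * L ≤ c * r := by
  rw [div_le_iff₀ hc] at hl
  calc b / 2 * L ≤ l * c / 2 * L := by gcongr
    _ = c * (L * l / 2) := by ring
    _ ≤ c * r := by gcongr

theorem vote_margin_le {lam η L Q K : ℝ} (hlam : 0 < lam) (hη : 0 < η) (hQ : 1 ≤ Q)
    (hQL : Q * Q = L) (hQη : 14 / (lam * η) ≤ Q) (hK : K ≤ 2 * Q) :
    (2 * K + 3) / lam / 2 ≤ η / 4 * L := by
  rw [div_le_iff₀ (by positivity)] at hQη
  rw [div_div, div_le_iff₀ (by positivity), ← hQL]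
  nlinarith

section ErrorBound

theorem tendsto_errorBound (C₁ C₂ a b : ℝ) (ha : 0 < a) (hb : 0 < b) :
    Tendsto (fun m : ℕ => Real.exp (-(m * a)) + C₁ * (Real.log m ^ 48 / m) +
      C₂ * (1 / (m : ℝ)) + Real.exp (-(b * Real.log m))) atTop (𝓝 0) := by
  have h1 : Tendsto (fun m : ℕ => Real.exp (-(m * a))) atTop (𝓝 0) :=
    Real.tendsto_exp_neg_atTop_nhds_zero.comp (tendsto_natCast_atTop_atTop.atTop_mul_const ha)
  have h2 : Tendsto (fun m : ℕ => Real.log m ^ 48 / (m : ℝ)) atTop (𝓝 0) :=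
    (Real.isLittleO_pow_log_id_atTop (n := 48)).tendsto_div_nhds_zero.comp
      tendsto_natCast_atTop_atTop
  have h3 : Tendsto (fun m : ℕ => 1 / (m : ℝ)) atTop (𝓝 0) := tendsto_one_div_atTop_nhds_zero_nat
  have h4 : Tendsto (fun m : ℕ => Real.exp (-(b * Real.log m))) atTop (𝓝 0) :=
    Real.tendsto_exp_neg_atTop_nhds_zero.comp (tendsto_log_nat.const_mul_atTop hb)
  simpa using ((h1.add (h2.const_mul C₁)).add (h3.const_mul C₂)).add h4

variable {m w n D : ℕ} [NeZero w] {Φ : PMF ℕ} {ε : Fin w → ℕ → unitInterval}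

/-- The bound of the failure probability for `m` so large that `L = log m`, `l = log log m` and
`Q = √(log m)` exceed given constants and that `Q` exceeds a given multiple of `l ^ 2`. At most `K`
wrong second estimates, with `Q ≤ K ≤ 2 * Q`, are tolerated: so many have no influence on votes and
estimates from `L` queries or more, while the exponent of their probability, of order `K * L / l`,
exceeds the number of labels, of order `L * l`, that are at stake. -/
theorem law_failure_le_errorBound (hΦ : Φ.support ⊆ Set.Icc 1 D) (hD1 : 1 ≤ D) (hDm : D ≤ m)
    (hm0 : 0 < m) {lam η δ ρ v t s p₁ φ C κ β M L l Q r : ℝ} {K : ℕ}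
    (hL : Real.log m = L) (hr : r = size3 m w / w)
    (hlam : 0 < lam) (hη : 0 < η) (hδ : 0 < δ) (hδ2 : δ ≤ 2)
    (hδC : C * (D * (Real.exp (2 / lam * (3 * δ) / 2) - 1)) ≤ η / 4)
    (hε : ∀ k, ∀ d ∈ Finset.Icc 1 D, lam ≤ (ε k d : ℝ) ∧ (ε k d : ℝ) < 1 / 2)
    (hε₁ : (∑ k, (ε k 1 : ℝ)) / w ≤ p₁)
    (hρ : 0 < ρ) (hρ2 : ρ ≤ 2) (hρ1 : 2 * ρ ≤ 1 - 2 * p₁) (hs : 0 < s) (hs1 : s ≤ 1)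
    (hC : 0 < C) (hvdef : v = (1 + η) / C) (ht : 0 < t) (ht1 : t * D ≤ 1)
    (hκdef : κ = t * (ρ / 2) ^ D * v - t ^ 2 * D ^ 2) (hκ : 0 < κ)
    (hφ : 0 < φ) (hφΦ : ∀ d, Φ d ≠ 0 → φ ≤ (Φ d).toReal)
    (hβdef : β = 1 - Real.exp (-(δ ^ 2 / 4))) (hβ : 0 < β)
    (hMdef : M = 2 + 2 ^ D * D * C + 2 ^ D)
    (hn : (1 + η) * optimalSize m w D Φ ε ≤ n) (hnC : (n : ℝ) ≤ C * (m * L))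
    (hlarge : LargeFor D ρ m) (hL1 : 1 ≤ L) (hl1 : 1 ≤ l) (hlL : l ≤ L) (hlφ : 48 / φ ≤ l)
    (hlβ : 4 / (β * φ) ≤ l) (hq1 : 1 ≤ Q) (hqq : Q * Q = L)
    (hqη : 14 / (lam * η) ≤ Q) (hqδ : (12 + 15 * δ) / (δ * φ / 4) ≤ Q)
    (hK1 : Q ≤ K) (hK2 : (K : ℝ) ≤ 2 * Q)
    (h2 : (m : ℝ) * (L / (2 * l)) ≤ size2 m) (h3 : L * l / 2 ≤ r) (h3' : r ≤ L * l)
    (hwm : (w : ℝ) ≤ m) (hsq : 2 * M / κ * l ^ 2 ≤ Q)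
    (hsD : (m + size2 m + size3 m w : ℝ) ≤ 1 / D * (m * L))
    (hsη : (m + size2 m + size3 m w : ℝ) ≤ η / 4 / D * (m * L))
    (rule : PruningRule m w n) (x : Fin m → ℤˣ) :
    law m w n Φ ε (failure lam rule x) ≤ ENNReal.ofReal (Real.exp (-(m * (s * ρ - s ^ 2))) +
      289 * queryFactor D ^ 16 * (1 + C) ^ 16 * 2 ^ 16 * (L ^ 48 / m) +
        (1 + 4 * D) * (1 / (m : ℝ)) + Real.exp (-(η / 4 * L))) := by
  have hD0 : (1 : ℝ) ≤ D := by exact_mod_cast hD1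
  have hm : (0 : ℝ) < m := by exact_mod_cast hm0
  have hw0 : (0 : ℝ) < w := by exact_mod_cast Nat.pos_of_ne_zero (NeZero.ne w)
  have hl2 : lam ≤ 1 / 2 := by
    have := hε 0 1 (Finset.mem_Icc.2 ⟨le_rfl, hD1⟩)
    linarith
  have hL0 : 0 ≤ L := by linarith
  have hmL : 0 < (m : ℝ) * L := by positivity
  -- the capacity
  have hε' : ∀ k, ∀ d ∈ Finset.Icc 1 D, (ε k d : ℝ) < 1 / 2 := fun k d hd => (hε k d hd).2
  have hcap0 := capacity_pos hΦ hε'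
  have hcapA := capacity_le_advantage (Φ := Φ) hε'
  have hcapD := hcapA.trans (advantage_le hΦ)
  have hcap : (1 + η) * (m * L) ≤ n * capacity w D Φ ε := by
    have : (1 + η) * (m * L / capacity w D Φ ε) ≤ n := hL ▸ hn
    rwa [← mul_div_assoc, div_le_iff₀ hcap0] at this
  have hvcap : v ≤ capacity w D Φ ε := by
    rw [hvdef, div_le_iff₀ hC]
    have h4 := hcap.trans (mul_le_mul_of_nonneg_right hnC hcap0.le)
    refine le_of_mul_le_mul_right (h4.trans (le_of_eq ?_)) hmL
    ring
  have hsize : m + size2 m + size3 m w ≤ n := by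
    have h4 : (m : ℝ) * L ≤ n * D :=
      calc (m : ℝ) * L ≤ (1 + η) * (m * L) := le_mul_of_one_le_left hmL.le (by linarith)
        _ ≤ n * capacity w D Φ ε := hcap
        _ ≤ n * D := by gcongr
    have h5 : (m + size2 m + size3 m w : ℝ) ≤ n := by
      refine hsD.trans ?_
      rw [one_div_mul_eq_div, div_le_iff₀ (by linarith)]
      exact h4
    exact_mod_cast h5
  have hLl : L ≤ L * l := le_mul_of_one_le_right hL0 hl1
  have hθ5 : 5 < φ / 4 * r := by
    have := mul_le_mul_of_div_le hφ hL0 hlφ h3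
    linarith only [this, hL1]
  have hθK := accuracy_le hφ hδ hq1 hqq hl1 h3 hqδ hK2
  have hY := many_wrong_exponent_ge hm hκ hL0 hl1 (zero_le_one.trans hq1) hsq hK1 h2
  have hnm : (n : ℝ) / m ≤ C * L := by
    rw [div_le_iff₀ hm]
    linarith
  refine (law_failure_le hΦ hDm hsize hlam hl2 hε hε₁ hδ hδ2 hθ5 hθK hlarge hρ hρ2 hρ1 hs.le
    hs1 (hvcap.trans hcapA) ht.le ht1 hφΦ rule x).trans (ENNReal.ofReal_le_ofReal ?_)
  have hr0 : 0 ≤ r := by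
    rw [hr]
    positivity
  have b1 := loops_le (q := queryFactor D ^ 16) hm (Nat.cast_nonneg n) hr0 hL1 hlL
    (by positivity) hC.le hnC h3'
  have b2 : (m : ℝ) * (Real.exp (2 ^ D * D * (n / m)) *
      Real.exp (-(size2 m * (K / m * κ)))) ≤ 1 / m := by
    refine mul_exp_mul_exp_le hm (le_trans ?_ hY)
    rw [hL]
    have h4 : 2 ^ D * (D : ℝ) * (n / m) ≤ 2 ^ D * D * (C * (L * l)) := by
      gcongr
      exact hnm.trans (by gcongr)
    have h5 : M * (L * l) = 2 * (L * l) + 2 ^ D * D * (C * (L * l)) + 2 ^ D * (L * l) := by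
      rw [hMdef]
      ring
    have h6 : 0 ≤ 2 ^ D * (L * l) := by positivity
    linarith only [h4, h5, h6, hLl]
  have b3 := final_votes_le (K := K) (lam := lam) (D := D) hm hL
    (x := D * (Real.exp (2 / lam * (3 * δ) / 2) - 1))
    (S := m + size2 m + size3 m w) (by
      refine mul_nonneg (by positivity) (sub_nonneg.2 (Real.one_le_exp (by positivity))))
    (by positivity) hcap hnC hL0 hδC hcapD (by
      rw [div_mul_eq_mul_div, le_div_iff₀ (by linarith)] at hsη
      linarith) (vote_margin_le hlam hη hq1 hqq hqη hK2)
  have b4 : (m : ℝ) * (Real.exp (2 ^ D * r) *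
      Real.exp (-(size2 m * (K / m * κ)))) ≤ 1 / m := by
    refine mul_exp_mul_exp_le hm (le_trans ?_ hY)
    rw [hL]
    have h4 : 2 ^ D * r ≤ 2 ^ D * (L * l) := by
      gcongr
    have h5 : M * (L * l) = 2 * (L * l) + 2 ^ D * D * (C * (L * l)) + 2 ^ D * (L * l) := by
      rw [hMdef]
      ring
    have h6 : 0 ≤ 2 ^ D * D * (C * (L * l)) := by positivity
    linarith only [h4, h5, h6, hLl]
  have b5 : (m : ℝ) * (Real.exp (φ / 4 * r) * Real.exp (-(size3 m w * (φ / (2 * w))))) ≤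
      1 / m := by
    refine mul_exp_mul_exp_le hm ?_
    rw [hL]
    have : (size3 m w : ℝ) * (φ / (2 * w)) = φ / 2 * r := by
      rw [hr]
      field_simp
    rw [this]
    have h4 := mul_le_mul_of_div_le hφ hL0 hlφ h3
    linarith only [h4, hL0]
  have b6 : (m : ℝ) * (Real.exp 0 * Real.exp (-(size3 m w * (β * φ / w)))) ≤ 1 / m := by
    refine mul_exp_mul_exp_le hm ?_
    rw [hL]
    have : (size3 m w : ℝ) * (β * φ / w) = β * φ * r := by
      rw [hr]
      field_simp
    rw [this]
    have h4 := mul_le_mul_of_div_le (mul_pos hβ hφ) hL0 hlβ h3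
    linarith only [h4]
  rw [Real.exp_zero, one_mul] at b6
  have b7 : ∀ {u : ℝ}, 0 ≤ u → (m : ℝ) * u ≤ 1 / m → (w : ℝ) * D * u ≤ D * (1 / m) := by
    intro u hu hmu
    calc (w : ℝ) * D * u = D * (w * u) := by ring
      _ ≤ D * (m * u) := by gcongr
      _ ≤ D * (1 / m) := by gcongr
  have d4 := b7 (by positivity) b4
  have d5 := b7 (by positivity) b5
  have d6 := b7 (Real.exp_pos _).le b6
  rw [← hr, mul_add, mul_add, mul_add, mul_add, mul_left_comm _ (2 : ℝ), ← hβdef, ← hκdef]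
  linarith only [b1, b2, b3, d4, d5, d6]

end ErrorBound

end XorQuery

end

theorem theorem2
    -- the maximal degree, the degree distribution, and constants
    (D : ℕ) (Φ : PMF ℕ) (hΦ : Φ.support ⊆ Set.Icc 1 D)
    (lam η p₁ : ℝ) (hlam : 0 < lam) (hη : 0 < η) (hp₁ : p₁ < 1 / 2)
    -- the number of workers
    (w : ℕ → ℕ) [∀ m, NeZero (w m)]
    (hw : (fun m : ℕ => (w m : ℝ)) =o[atTop] fun m : ℕ => (m : ℝ) / Real.log (Real.log m))
    -- the noise parameters
    (ε : ∀ m, Fin (w m) → ℕ → unitInterval)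
    (hε : ∀ m k, ∀ d ∈ Finset.Icc 1 D, lam ≤ (ε m k d : ℝ) ∧ (ε m k d : ℝ) < 1 / 2)
    (hε₁ : ∀ᶠ m : ℕ in atTop, (∑ k, (ε m k 1 : ℝ)) / (w m : ℝ) ≤ p₁)
    -- the number of queries
    (n : ℕ → ℕ)
    (hn : ∀ᶠ m : ℕ in atTop, (1 + η) * XorQuery.optimalSize m (w m) D Φ (ε m) ≤ (n m : ℝ))
    (hn' : (fun m : ℕ => (n m : ℝ)) =O[atTop] fun m : ℕ => (m : ℝ) * Real.log m)
    -- the true labels, and the choices made in the pruning phase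
    (x : ∀ m, Fin m → ℤˣ)
    (rule : ∀ m, XorQuery.PruningRule m (w m) (n m)) :
    Tendsto (fun m : ℕ =>
        XorQuery.law m (w m) (n m) Φ (ε m) (XorQuery.failure lam (rule m) (x m)))
      atTop (𝓝 0) := by
  obtain ⟨φ, hφ, hφΦ⟩ := XorQuery.exists_le_of_ne_zero hΦ
  obtain ⟨C, hC, hnC⟩ := hn'.exists_pos
  rw [isBigOWith_iff] at hnC
  have hD1 : 1 ≤ D := by
    obtain ⟨d, hd⟩ := Φ.support_nonempty
    exact (hΦ hd).1.trans (hΦ hd).2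
  have hD0 : (1 : ℝ) ≤ D := by exact_mod_cast hD1
  obtain ⟨δ, hδ, hδ2, hδC⟩ := XorQuery.exists_accuracy C D (lam := lam) hη
  -- the proportion of correct first estimates exceeds one half by at least `ρ / 2`
  set ρ : ℝ := min 1 ((1 - 2 * p₁) / 2) with hρdef
  have hρ : 0 < ρ := lt_min one_pos (by linarith)
  have hρ2 : ρ ≤ 2 := (min_le_left _ _).trans (by norm_num)
  have hρ1 : 2 * ρ ≤ 1 - 2 * p₁ := by
    have := min_le_right 1 ((1 - 2 * p₁) / 2)
    linarith
  -- `s`, and `t` below, are the arguments at which the exponential moments are taken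
  set s : ℝ := min 1 (ρ / 2) with hsdef
  have hs : 0 < s := lt_min one_pos (by linarith)
  have hs1 : s ≤ 1 := min_le_left _ _
  have ha : 0 < s * ρ - s ^ 2 := by
    have := min_le_right 1 (ρ / 2)
    nlinarith
  -- since `n = O(m log m)`, the capacity is bounded away from zero
  set v : ℝ := (1 + η) / C with hvdef
  have hv : 0 < v := by positivity
  set c : ℝ := (ρ / 2) ^ D * v with hcdef
  have hc : 0 < c := by positivity
  set t : ℝ := min (1 / D) (c / (2 * D ^ 2)) with htdef
  have ht : 0 < t := lt_min (by positivity) (by positivity)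
  have ht1 : t * D ≤ 1 := by
    have := min_le_left (1 / (D : ℝ)) (c / (2 * D ^ 2))
    exact (le_div_iff₀ (by linarith)).1 this
  -- the exponent, per message, of the probability that given second estimates are all wrong
  set κ : ℝ := t * (ρ / 2) ^ D * v - t ^ 2 * D ^ 2 with hκdef
  have hκ : 0 < κ := by
    have h1 : t * (2 * (D : ℝ) ^ 2) ≤ c :=
      (le_div_iff₀ (by positivity)).1 (min_le_right (1 / (D : ℝ)) (c / (2 * D ^ 2)))
    have h2 : κ = t * (c - t * D ^ 2) := by rw [hκdef, hcdef]; ring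
    rw [h2]
    refine mul_pos ht ?_
    nlinarith
  set β : ℝ := 1 - Real.exp (-(δ ^ 2 / 4)) with hβdef
  have hβ : 0 < β := sub_pos.2 (Real.exp_lt_one_iff.2 (by have := pow_pos hδ 2; linarith))
  -- the multiple of `log m * log log m` that the exponent for `K` wrong estimates has to reach
  set M : ℝ := 2 + 2 ^ D * D * C + 2 ^ D with hMdef
  have hsqrt : Tendsto (fun m : ℕ => Real.sqrt (Real.log m)) atTop atTop :=
    Real.tendsto_sqrt_atTop.comp XorQuery.tendsto_log_nat
  set C₁ : ℝ := 289 * XorQuery.queryFactor D ^ 16 * (1 + C) ^ 16 * 2 ^ 16 with hC₁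
  have hbound : ∀ᶠ m : ℕ in atTop, XorQuery.law m (w m) (n m) Φ (ε m) (XorQuery.failure lam (rule m) (x m)) ≤
      ENNReal.ofReal (Real.exp (-(m * (s * ρ - s ^ 2))) + C₁ * (Real.log m ^ 48 / m) +
        (1 + 4 * D) * (1 / (m : ℝ)) + Real.exp (-(η / 4 * Real.log m))) := by
    filter_upwards [hε₁, hn, hnC, eventually_ge_atTop D, eventually_gt_atTop 0,
      XorQuery.eventually_largeFor D hρ, XorQuery.tendsto_log_nat.eventually_ge_atTop 1,
      XorQuery.tendsto_log_log_nat.eventually_ge_atTop 1,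
      XorQuery.tendsto_log_log_nat.eventually_ge_atTop (48 / φ),
      XorQuery.tendsto_log_log_nat.eventually_ge_atTop (4 / (β * φ)),
      hsqrt.eventually_ge_atTop 1, hsqrt.eventually_ge_atTop (14 / (lam * η)),
      hsqrt.eventually_ge_atTop ((12 + 15 * δ) / (δ * φ / 4)),
      XorQuery.eventually_size2, XorQuery.eventually_size3 w, XorQuery.eventually_le_of_isLittleO hw,
      XorQuery.eventually_mul_log_log_sq_le (2 * M / κ),
      XorQuery.eventually_sizes_le hw (show 0 < 1 / (D : ℝ) by positivity),
      XorQuery.eventually_sizes_le hw (show 0 < η / 4 / D by positivity)]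
      with m hε₁ hn hnC hDm hm0 hlarge hL1 hl1 hlφ hlβ hq1 hqη hqδ h2 h3 hwm hsq hsD hsη
    have hlL : Real.log (Real.log m) ≤ Real.log m := by
      have := Real.log_le_sub_one_of_pos (show 0 < Real.log m by linarith)
      linarith
    have hm : (0 : ℝ) < m := by exact_mod_cast hm0
    rw [Real.norm_natCast, Real.norm_eq_abs, abs_of_pos (mul_pos hm (by linarith))] at hnC
    have hK2 : ((⌈Real.sqrt (Real.log m)⌉₊ : ℕ) : ℝ) ≤ 2 * Real.sqrt (Real.log m) := by
      have := (Nat.ceil_lt_add_one (Real.sqrt_nonneg (Real.log m))).le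
      linarith
    exact XorQuery.law_failure_le_errorBound hΦ hD1 hDm hm0 rfl rfl hlam hη hδ hδ2 hδC (hε m) hε₁ hρ hρ2 hρ1
      hs hs1 hC hvdef ht ht1 hκdef hκ hφ hφΦ hβdef hβ hMdef hn hnC hlarge hL1 hl1 hlL hlφ hlβ
      hq1 (Real.mul_self_sqrt (by linarith)) hqη hqδ (Nat.le_ceil _) hK2 h2.1 h3.1 h3.2 hwm hsq hsD
      hsη (rule m) (x m)
  refine tendsto_of_tendsto_of_tendsto_of_le_of_le' tendsto_const_nhds ?_
    (Eventually.of_forall fun _ => zero_le) hbound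
  have := ENNReal.tendsto_ofReal (XorQuery.tendsto_errorBound C₁ (1 + 4 * D) _ (η / 4) ha (by positivity))
  rwa [ENNReal.ofReal_zero] at this
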